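/- Let $d\ge 1$, $p>1$, $D>0$, $L\ge 0$ and $\kappa>0$. There is a constant $c>0$, depending only on $d,p,D,L$ and $\kappa$, such that the following holds. Let $\lambda,\mu$ be compactly supported probability measures on $\mathbb R^d$, absolutely continuous with respect to Lebesgue measure, such that $$\lambda(B_r(z))\ge D\,r^d\qquad\text{for every ball } B_r(z)\subset\operatorname{supp}\lambda .$$ Assume that the quadratic optimal transport problem $\min_{\pi\in\Pi(\lambda,\mu)}\int|x-y|^2\,d\pi$, where $\Pi(\lambda,\mu)$ is the set of couplings of $\lambda$ and $\mu$, is minimised by $\pi=(\mathrm{id},T)_\#\lambda$ for a map $T$ that is $L$-Lipschitz on $\operatorname{supp}\lambda$. For $\varepsilon>0$ let $\pi_\varepsilon$ be a minimiser over $\pi\in\Pi(\lambda,\mu)$ of $$\int|x-y|^2\,d\pi+\varepsilon^2\int h_p\Big(\frac{d\pi}{d(\lambda\otimes\mu)}\Big)\,d(\lambda\otimes\mu),\qquad h_p(t)=\frac{t^p-1}{p-1},$$ where the functional is $+\infty$ if $\pi$ is not absolutely continuous with respect to $\lambda\otimes\mu$. Then there is $\varepsilon_0>0$ (which may depend on $\lambda,\mu,T$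 and all the constants above) such that for all $0<\varepsilon\le\varepsilon_0$ and all $(x,y)\in\operatorname{supp}\pi_\varepsilon$, $$|y-T(x)|\le c\,R\qquad\text{or}\qquad d(x,\partial\operatorname{supp}\lambda)<R,\qquad\text{where } R=\kappa\,\varepsilon^{\frac{4}{(d(p-1)+2)(d+2)}} .$$ -/

import Mathlib

open MeasureTheory
open scoped NNReal ENNReal

noncomputable section

/-- The set `Π(lam, mu)` of couplings of `lam` and `mu`. -/
def couplings {X : Type*} [MeasurableSpace X] (lam mu : Measure X) : Set (Measure (X × X)) :=
  {π | π.fst = lam ∧ π.snd = mu}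

/-- The quadratic transport cost `∫ |x - y|² dπ`, with values in `[0, ∞]`. -/
def transportCost {d : ℕ}
    (π : Measure (EuclideanSpace ℝ (Fin d) × EuclideanSpace ℝ (Fin d))) : ℝ≥0∞ :=
  ∫⁻ z, ENNReal.ofReal (‖z.1 - z.2‖ ^ 2) ∂π

/-- `π` minimises the (unregularised) quadratic optimal transport problem `OT(lam, mu)`. -/
def IsOTMinimiser {d : ℕ} (lam mu : Measure (EuclideanSpace ℝ (Fin d)))
    (π : Measure (EuclideanSpace ℝ (Fin d) × EuclideanSpace ℝ (Fin d))) : Prop :=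
  π ∈ couplings lam mu ∧ IsMinOn transportCost (couplings lam mu) π

/-- The polynomial regularisation `h_p(z) = (|z|^p - 1) / (p - 1)`, used for `p > 1`. -/
def polyReg (p z : ℝ) : ℝ := (|z| ^ p - 1) / (p - 1)

open Classical in
/-- The regularised cost `∫ |x - y|² dπ + ε² ∫ h(dπ/dP) dP` with `P = lam ⊗ mu`. It is `+∞` if
`π` is not absolutely continuous with respect to `P` or if `h(dπ/dP)` is not `P`-integrable
(for `h` bounded below and `P` finite, the latter means `∫ h(dπ/dP) dP = +∞`). -/
def regularisedCost {d : ℕ} (h : ℝ → ℝ) (ε : ℝ) (lam mu : Measure (EuclideanSpace ℝ (Fin d)))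
    (π : Measure (EuclideanSpace ℝ (Fin d) × EuclideanSpace ℝ (Fin d))) : EReal :=
  if π ≪ lam.prod mu ∧
      Integrable (fun z => h ((π.rnDeriv (lam.prod mu) z).toReal)) (lam.prod mu) then
    (transportCost π : EReal) +
      ((ε ^ 2 * ∫ z, h ((π.rnDeriv (lam.prod mu) z).toReal) ∂(lam.prod mu) : ℝ) : EReal)
  else ⊤

/-- `π` minimises the regularised optimal transport problem `OT_h(lam, mu)` with regularisation
parameter `ε`. -/
def IsROTMinimiser {d : ℕ} (h : ℝ → ℝ) (ε : ℝ) (lam mu : Measure (EuclideanSpace ℝ (Fin d)))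
    (π : Measure (EuclideanSpace ℝ (Fin d) × EuclideanSpace ℝ (Fin d))) : Prop :=
  π ∈ couplings lam mu ∧ IsMinOn (regularisedCost h ε lam mu) (couplings lam mu) π

end

/-! Since `mu` is the image of `lam` under `T`, the problem can be pulled back to kernels on `lam ⊗
lam`: a pair `(x, z)` stands for transport from `x` to `T z`. Rockafellar's potential `φ` of the
optimal map turns the cost, up to constants fixed by the marginals, into twice the Bregman gap `φ x
- φ z - ⟪T z, x - z⟫`, which is nonnegative on the support and at most `L ‖x - z‖²`. Pushing forward
does not increase the `L^p` norm of densities, so a regularised minimiser becomes a minimal kernel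
(`IsROTMinimiser.exists_kernel`).

Scales: with `N = d (p - 1) + 2`, let `δ ^ N = ε ^ 2`, `δ = ω ^ (d + 2)` and `R = κ ω ^ 2`.
Spreading mass over cells of size `δ` costs order `δ ^ 2` both in transport and in regularisation,
so the minimal energy is `O(δ ^ 2)`. On the other hand `R ^ (d + 2) = κ ^ (d + 2) δ ^ 2`.

Suppose `(x, y)` is in the support, the `R`-ball around `x` lies in the support of `lam`, and `y` is
farther than `(8 + 3 L) R` from `T x`. Exchanging mass between pairs of points cannot pay
(`IsMinKernel.swap`), which gives cyclical monotonicity with error `R ^ 2` against all but a small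
mass of other pairs. Hence most of the mass in a ball of radius `R / 8` near `x` is also displaced
by at least order `R`. By the density bound this is mass of order `R ^ d` with Bregman gap at least
`R ^ 2 / 8`, so a cost of at least `c3 δ ^ 2` sits on large gaps
(`IsMinKernel.le_lintegral_of_far`).

This only matches the order of the energy bound. A contradiction for every `κ` needs the cost of
large gaps to be `o(δ ^ 2)`. For this the minimal kernel is compared with a competitor: on pairs
with small gap it is replaced by its symmetrisation, and the mass left over is coupled to itself
(`IsMinKernel.cost_indicator_le`). Symmetrising does not increase the convex regularisation, and it
hardly changes the cost because the gap is almost symmetric near almost every point: `T` is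
differentiable there with coercive derivative `A`, and the gap is close to `⟪A (x - z), x - z⟫ / 2`
in both orders (`IsOTMinimiser.exists_almost_symmetric`). The leftover has small mass, and
`exists_selfCoupling` couples it to itself at a small multiple of `δ ^ 2`.

The self-coupling estimate needs `d ≥ 2` for a dyadic sum to converge. In dimension one the
displacement is contradicted directly: the mass to the right of a point would have to move into a
half-line of strictly smaller mass (`IsMinKernel.not_far_of_dim_one`). -/

/-! ### Reordering of fourfold integrals, for integrals over two pairs of points. -/

section FourFold

variable {X : Type*} [MeasurableSpace X] {l : Measure X} [SFinite l]

theorem lintegral_four_rotate {F : X × X × X × X → ℝ≥0∞} (hF : Measurable F) :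
    ∫⁻ x, ∫⁻ z, ∫⁻ x', ∫⁻ z', F (x, z, x', z') ∂l ∂l ∂l ∂l =
      ∫⁻ x, ∫⁻ z', ∫⁻ z, ∫⁻ x', F (x, z, x', z') ∂l ∂l ∂l ∂l := by
  refine lintegral_congr fun x => ?_
  have h1 : ∀ z, ∫⁻ x', ∫⁻ z', F (x, z, x', z') ∂l ∂l = ∫⁻ z', ∫⁻ x', F (x, z, x', z') ∂l ∂l :=
    fun z => lintegral_lintegral_swap (by fun_prop)
  simp_rw [h1]
  exact lintegral_lintegral_swap (by
    have : Measurable (fun q : (X × X) × X => F (x, q.1.1, q.2, q.1.2)) := by fun_prop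
    exact this.lintegral_prod_right'.aemeasurable)

theorem lintegral_four_swap {F : X × X × X × X → ℝ≥0∞} (hF : Measurable F) :
    ∫⁻ x, ∫⁻ z, ∫⁻ x', ∫⁻ z', F (x, z, x', z') ∂l ∂l ∂l ∂l =
      ∫⁻ x, ∫⁻ z, ∫⁻ x', ∫⁻ z', F (x', z', x, z) ∂l ∂l ∂l ∂l := by
  have e1 : ∀ G : X × X × X × X → ℝ≥0∞, Measurable G →
      ∫⁻ x, ∫⁻ z, ∫⁻ x', ∫⁻ z', G (x, z, x', z') ∂l ∂l ∂l ∂l =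
        ∫⁻ a, ∫⁻ b, G (a.1, a.2, b.1, b.2) ∂(l.prod l) ∂(l.prod l) := by
    intro G hG
    rw [lintegral_prod]
    · refine lintegral_congr fun x => lintegral_congr fun z => ?_
      rw [lintegral_prod]
      fun_prop
    · have : Measurable (fun q : (X × X) × (X × X) => G (q.1.1, q.1.2, q.2.1, q.2.2)) := by fun_prop
      exact this.lintegral_prod_right'.aemeasurable
  rw [e1 F hF, e1 (fun q => F (q.2.2.1, q.2.2.2, q.1, q.2.1)) (by fun_prop)]
  exact lintegral_lintegral_swap (by fun_prop)

end FourFold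

/-- Convexity of the power, with the tangent taken at `u + v` (Bernoulli's inequality for `-v / (u +
v)`). The coefficient of `u ^ p` is exactly one, so the excess is linear in the added mass `v` once
`u + v` is bounded. -/
theorem ENNReal.add_rpow_le_add_mul {u v : ℝ≥0∞} {p : ℝ} (hp : 1 < p) :
    (u + v) ^ p ≤ u ^ p + ENNReal.ofReal p * (u + v) ^ (p - 1) * v := by
  by_cases hu : u = ∞
  · simp [hu, show (0 : ℝ) < p by linarith]
  by_cases hv : v = ∞
  · have hp0 : ENNReal.ofReal p ≠ 0 := by simp; linarith
    simp [hv, show (0 : ℝ) < p by linarith, show (0 : ℝ) < p - 1 by linarith, hp0]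
  lift u to ℝ≥0 using hu
  lift v to ℝ≥0 using hv
  have hp0 : 0 ≤ p := by linarith
  have key : ((u : ℝ) + v) ^ p ≤ (u : ℝ) ^ p + p * ((u : ℝ) + v) ^ (p - 1) * v := by
    rcases eq_or_lt_of_le (show (0 : ℝ) ≤ u + v by positivity) with h0 | h0
    · rw [← h0, Real.zero_rpow (by linarith), Real.zero_rpow (by linarith)]
      simp; positivity
    · have hb := one_add_mul_self_le_rpow_one_add (s := -(v / (u + v) : ℝ))
        (by rw [neg_le_neg_iff, div_le_one h0]; linarith [u.2]) hp.le
      have e1 : (1 : ℝ) + -(v / (u + v)) = u / (u + v) := by field_simp; ring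
      rw [e1, Real.div_rpow u.coe_nonneg h0.le, le_div_iff₀ (by positivity)] at hb
      have e2 : ((u : ℝ) + v) ^ p = (u + v) ^ (p - 1) * (u + v) := by
        rw [← Real.rpow_add_one h0.ne']; congr 1; ring
      have e3 : (v / (u + v) : ℝ) * ((u : ℝ) + v) ^ p = v * (u + v) ^ (p - 1) := by
        rw [e2]; field_simp
      have : (1 + p * -(v / (u + v) : ℝ)) * ((u : ℝ) + v) ^ p
          = ((u : ℝ) + v) ^ p - p * (v * (u + v) ^ (p - 1)) := by
        rw [← e3]; ring
      rw [this] at hb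
      linarith
  have : ((u : ℝ≥0∞) + v) = ((u + v : ℝ≥0) : ℝ≥0∞) := by push_cast; rfl
  rw [this, ← ENNReal.coe_rpow_of_nonneg _ hp0, ← ENNReal.coe_rpow_of_nonneg _ hp0,
    ← ENNReal.coe_rpow_of_nonneg _ (by linarith : (0 : ℝ) ≤ p - 1),
    ENNReal.ofReal_eq_coe_nnreal hp0]
  norm_cast

/-! ### Minimal kernels: two competitors and the inequalities they give. -/

section Kernels

variable {X : Type*} [MeasurableSpace X]

/-- `σ` is the density with respect to `l ⊗ l` of a measure both of whose marginals have
density `g` with respect to `l`. -/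
structure IsKernelDensity (l : Measure X) (g : X → ℝ≥0∞) (σ : X × X → ℝ≥0∞) : Prop where
  meas : Measurable σ
  left : ∀ᵐ x ∂l, ∫⁻ y, σ (x, y) ∂l = g x
  right : ∀ᵐ y ∂l, ∫⁻ x, σ (x, y) ∂l = g y

/-- The regularised energy of a kernel density. -/
noncomputable def kernelEnergy (l : Measure X) (D : X × X → ℝ≥0∞) (a : ℝ≥0∞) (p : ℝ)
    (σ : X × X → ℝ≥0∞) : ℝ≥0∞ :=
  ∫⁻ x, ∫⁻ y, D (x, y) * σ (x, y) ∂l ∂l + a * ∫⁻ x, ∫⁻ y, σ (x, y) ^ p ∂l ∂l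

/-- `σ` minimises the regularised energy among kernel densities with marginals `l`. -/
def IsMinKernel (l : Measure X) (D : X × X → ℝ≥0∞) (a : ℝ≥0∞) (p : ℝ) (σ : X × X → ℝ≥0∞) : Prop :=
  IsKernelDensity l 1 σ ∧
    ∀ σ', IsKernelDensity l 1 σ' → kernelEnergy l D a p σ ≤ kernelEnergy l D a p σ'

variable {l : Measure X}

theorem IsKernelDensity.lintegral_eq {g : X → ℝ≥0∞} {σ : X × X → ℝ≥0∞}
    (h : IsKernelDensity l g σ) : ∫⁻ x, ∫⁻ y, σ (x, y) ∂l ∂l = ∫⁻ x, g x ∂l :=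
  lintegral_congr_ae h.left

variable [IsProbabilityMeasure l]

/-- Exchanging mass between pairs of points cannot lower the energy of a minimal kernel. -/
theorem IsMinKernel.swap {D σ : X × X → ℝ≥0∞} {a : ℝ≥0∞} {p : ℝ} (hp : 1 < p)
    (hD : Measurable D) (h : IsMinKernel l D a p σ)
    (hfin : kernelEnergy l D a p σ ≠ ∞)
    {τ : ℝ≥0∞} (hτ0 : τ ≠ 0) {W : Set (X × X × X × X)} (hW : MeasurableSet W)
    (hsymm : ∀ x z x' z', (x, z, x', z') ∈ W → (x', z', x, z) ∈ W)
    (hWτ : ∀ x z x' z', (x, z, x', z') ∈ W → σ (x, z') ≤ τ)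
    (hWlt : ∀ x z x' z', (x, z, x', z') ∈ W →
      D (x, z') + D (x', z) + 2 * (a * ENNReal.ofReal p * (2 * τ) ^ (p - 1)) <
        D (x, z) + D (x', z')) :
    ∫⁻ x, ∫⁻ z, ∫⁻ x', ∫⁻ z', W.indicator 1 (x, z, x', z') * σ (x, z) * σ (x', z')
      ∂l ∂l ∂l ∂l = 0 := by
  have hσ := h.1.meas
  set w : X × X × X × X → ℝ≥0∞ := W.indicator 1 with hw
  have hwm : Measurable w := measurable_one.indicator hW
  have hw1 : ∀ q, w q ≤ 1 := fun q => Set.indicator_le_self' (by simp) q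
  have hws : ∀ x z x' z', w (x', z', x, z) = w (x, z, x', z') := by
    intro x z x' z'
    by_cases hq : (x, z, x', z') ∈ W
    · rw [hw, Set.indicator_of_mem hq, Set.indicator_of_mem (hsymm _ _ _ _ hq)]; rfl
    · rw [hw, Set.indicator_of_notMem hq, Set.indicator_of_notMem fun h' => hq (hsymm _ _ _ _ h')]
  -- `σ * I` is the mass taken away when each two pairs in `W` exchange their second points, and `P`
  -- is the mass this creates on the exchanged pairs.
  set I : X × X → ℝ≥0∞ := fun q => ∫⁻ x', ∫⁻ z', w (q.1, q.2, x', z') * σ (x', z') ∂l ∂l with hI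
  set P : X × X → ℝ≥0∞ := fun q => ∫⁻ z, ∫⁻ x', w (q.1, z, x', q.2) * σ (q.1, z) * σ (x', q.2)
    ∂l ∂l with hP
  have hIm : Measurable I := by
    have : Measurable fun q : ((X × X) × X) × X =>
      w (q.1.1.1, q.1.1.2, q.1.2, q.2) * σ (q.1.2, q.2) := by fun_prop
    exact (this.lintegral_prod_right').lintegral_prod_right'
  have hPm : Measurable P := by
    have : Measurable fun q : ((X × X) × X) × X =>
      w (q.1.1.1, q.1.2, q.2, q.1.1.2) * σ (q.1.1.1, q.1.2) * σ (q.2, q.1.1.2) := by fun_prop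
    exact (this.lintegral_prod_right').lintegral_prod_right'
  have hσ1 : ∫⁻ x, ∫⁻ y, σ (x, y) ∂l ∂l = 1 := by
    rw [h.1.lintegral_eq]; simp
  have hI1 : ∀ q, I q ≤ 1 := by
    intro q
    rw [← hσ1]
    refine lintegral_mono fun x' => lintegral_mono fun z' => ?_
    exact mul_le_of_le_one_left' (hw1 _)
  have hP1 : ∀ᵐ x ∂l, ∀ᵐ z' ∂l, P (x, z') ≤ 1 := by
    filter_upwards [h.1.left] with x hx
    filter_upwards [h.1.right] with z' hz'
    calc P (x, z') ≤ ∫⁻ z, ∫⁻ x', σ (x, z) * σ (x', z') ∂l ∂l := by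
          refine lintegral_mono fun x' => lintegral_mono fun z' => ?_
          rw [mul_assoc]
          exact mul_le_of_le_one_left' (hw1 _)
      _ = ∫⁻ z, σ (x, z) * 1 ∂l := by
          refine lintegral_congr fun z => ?_
          rw [lintegral_const_mul _ (by fun_prop), hz']; rfl
      _ = 1 := by simpa using hx
      _ ≤ 1 := le_rfl
  have hPτ : ∀ x z', ¬ σ (x, z') ≤ τ → P (x, z') = 0 := by
    intro x z' hn
    have : ∀ z x', w (x, z, x', z') = 0 := fun z x' =>
      Set.indicator_of_notMem (fun hq => hn (hWτ _ _ _ _ hq)) _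
    simp [hP, this]
  -- The fraction exchanged: `s ≤ 1` keeps the competitor nonnegative, and `s ≤ τ` with `P ≤ 1`
  -- keeps the created density below `2 * τ` where `σ ≤ τ`.
  set s : ℝ≥0∞ := min 1 τ with hs
  have hs0 : s ≠ 0 := by simp [hs, hτ0]
  have hs1 : s ≤ 1 := min_le_left _ _
  have hsτ : s ≤ τ := min_le_right _ _
  have hs_fin : s ≠ ∞ := ne_top_of_le_ne_top ENNReal.one_ne_top hs1
  have hsI : ∀ q, s * I q ≤ 1 := fun q => mul_le_one' hs1 (hI1 q)
  set σ' : X × X → ℝ≥0∞ := fun q => σ q * (1 - s * I q) + s * P q with hσ'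
  have hadd : ∀ q, σ q * (1 - s * I q) + s * (σ q * I q) = σ q := by
    intro q
    rw [show s * (σ q * I q) = σ q * (s * I q) by ring, ← mul_add, tsub_add_cancel_of_le (hsI q),
      mul_one]
  have hσ'm : Measurable σ' := by fun_prop
  have hmarg1 : ∀ x, ∫⁻ z', P (x, z') ∂l = ∫⁻ z, σ (x, z) * I (x, z) ∂l := by
    intro x
    simp only [hP, hI]
    calc ∫⁻ z', ∫⁻ z, ∫⁻ x', w (x, z, x', z') * σ (x, z) * σ (x', z') ∂l ∂l ∂l
        = ∫⁻ z, ∫⁻ z', ∫⁻ x', w (x, z, x', z') * σ (x, z) * σ (x', z') ∂l ∂l ∂l := by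
          refine lintegral_lintegral_swap ?_
          have : Measurable fun q : (X × X) × X =>
            w (x, q.1.2, q.2, q.1.1) * σ (x, q.1.2) * σ (q.2, q.1.1) := by fun_prop
          exact this.lintegral_prod_right'.aemeasurable
      _ = ∫⁻ z, ∫⁻ x', ∫⁻ z', w (x, z, x', z') * σ (x, z) * σ (x', z') ∂l ∂l ∂l := by
          refine lintegral_congr fun z => lintegral_lintegral_swap (by fun_prop)
      _ = ∫⁻ z, σ (x, z) * ∫⁻ x', ∫⁻ z', w (x, z, x', z') * σ (x', z') ∂l ∂l ∂l := by
          refine lintegral_congr fun z => ?_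
          rw [← lintegral_const_mul _ (by
            have : Measurable fun q : X × X => w (x, z, q.1, q.2) * σ (q.1, q.2) := by fun_prop
            exact this.lintegral_prod_right')]
          refine lintegral_congr fun x' => ?_
          rw [← lintegral_const_mul _ (by fun_prop)]
          refine lintegral_congr fun z' => ?_
          ring
  have hmarg2 : ∀ z', ∫⁻ x, P (x, z') ∂l = ∫⁻ x', σ (x', z') * I (x', z') ∂l := by
    intro z'
    simp only [hP, hI]
    calc ∫⁻ x, ∫⁻ z, ∫⁻ x', w (x, z, x', z') * σ (x, z) * σ (x', z') ∂l ∂l ∂l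
        = ∫⁻ x, ∫⁻ x', ∫⁻ z, w (x, z, x', z') * σ (x, z) * σ (x', z') ∂l ∂l ∂l := by
          refine lintegral_congr fun z => lintegral_lintegral_swap (by fun_prop)
      _ = ∫⁻ x', ∫⁻ x, ∫⁻ z, w (x, z, x', z') * σ (x, z) * σ (x', z') ∂l ∂l ∂l := by
          refine lintegral_lintegral_swap ?_
          have : Measurable fun q : (X × X) × X =>
            w (q.1.1, q.2, q.1.2, z') * σ (q.1.1, q.2) * σ (q.1.2, z') := by fun_prop
          exact this.lintegral_prod_right'.aemeasurable
      _ = ∫⁻ x', σ (x', z') * ∫⁻ x, ∫⁻ z, w (x', z', x, z) * σ (x, z) ∂l ∂l ∂l := by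
          refine lintegral_congr fun x' => ?_
          rw [← lintegral_const_mul _ (by
            have : Measurable fun q : X × X => w (x', z', q.1, q.2) * σ (q.1, q.2) := by fun_prop
            exact this.lintegral_prod_right')]
          refine lintegral_congr fun x => ?_
          rw [← lintegral_const_mul _ (by fun_prop)]
          refine lintegral_congr fun z => ?_
          rw [hws x z x' z']
          ring
  have hker : IsKernelDensity l 1 σ' := by
    refine ⟨hσ'm, ?_, ?_⟩
    · filter_upwards [h.1.left] with x hx
      rw [← hx]
      simp only [hσ']
      rw [lintegral_add_left (by fun_prop), lintegral_const_mul _ (by fun_prop), hmarg1,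
        ← lintegral_const_mul _ (by fun_prop), ← lintegral_add_left (by fun_prop)]
      exact lintegral_congr fun z => hadd _
    · filter_upwards [h.1.right] with z hz
      rw [← hz]
      simp only [hσ']
      rw [lintegral_add_left (by fun_prop), lintegral_const_mul _ (by fun_prop), hmarg2,
        ← lintegral_const_mul _ (by fun_prop), ← lintegral_add_left (by fun_prop)]
      exact lintegral_congr fun z => hadd _
  have hmin := h.2 σ' hker
  have hlin : ∀ f g : X × X → ℝ≥0∞, Measurable f → Measurable g →
      ∫⁻ x, ∫⁻ y, f (x, y) + g (x, y) ∂l ∂l =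
        ∫⁻ x, ∫⁻ y, f (x, y) ∂l ∂l + ∫⁻ x, ∫⁻ y, g (x, y) ∂l ∂l := by
    intro f g hf hg
    rw [← lintegral_add_left hf.lintegral_prod_right']
    exact lintegral_congr fun x => lintegral_add_left (by fun_prop) _
  have hcm : ∀ (c : ℝ≥0∞) (f : X × X → ℝ≥0∞), Measurable f →
      ∫⁻ x, ∫⁻ y, c * f (x, y) ∂l ∂l = c * ∫⁻ x, ∫⁻ y, f (x, y) ∂l ∂l := by
    intro c f hf
    rw [← lintegral_const_mul _ hf.lintegral_prod_right']
    exact lintegral_congr fun x => lintegral_const_mul _ (by fun_prop)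
  have hcost : ∫⁻ x, ∫⁻ y, D (x, y) * σ' (x, y) ∂l ∂l
      + s * ∫⁻ x, ∫⁻ y, D (x, y) * (σ (x, y) * I (x, y)) ∂l ∂l
      = ∫⁻ x, ∫⁻ y, D (x, y) * σ (x, y) ∂l ∂l + s * ∫⁻ x, ∫⁻ y, D (x, y) * P (x, y) ∂l ∂l := by
    rw [← hcm s (fun q => D q * (σ q * I q)) (by fun_prop),
      ← hcm s (fun q => D q * P q) (by fun_prop),
      ← hlin (fun q => D q * σ' q) (fun q => s * (D q * (σ q * I q))) (by fun_prop) (by fun_prop),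
      ← hlin (fun q => D q * σ q) (fun q => s * (D q * P q)) (by fun_prop) (by fun_prop)]
    refine lintegral_congr fun x => lintegral_congr fun y => ?_
    conv_rhs => rw [← hadd (x, y)]
    simp only [hσ']
    ring
  set c : ℝ≥0∞ := ENNReal.ofReal p * (2 * τ) ^ (p - 1) with hc
  have hent : ∫⁻ x, ∫⁻ y, σ' (x, y) ^ p ∂l ∂l ≤ ∫⁻ x, ∫⁻ y, σ (x, y) ^ p ∂l ∂l
      + s * (c * ∫⁻ x, ∫⁻ y, P (x, y) ∂l ∂l) := by
    rw [← hcm c P hPm, ← hcm s (fun q => c * P q) (by fun_prop),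
      ← hlin (fun q => σ q ^ p) (fun q => s * (c * P q)) (by fun_prop) (by fun_prop)]
    refine lintegral_mono_ae ?_
    filter_upwards [hP1] with x hx
    refine lintegral_mono_ae ?_
    filter_upwards [hx] with y hy
    have hle : σ' (x, y) ≤ σ (x, y) + s * P (x, y) :=
      add_le_add (mul_le_of_le_one_right' tsub_le_self) le_rfl
    refine (ENNReal.rpow_le_rpow hle (by linarith)).trans ?_
    refine (ENNReal.add_rpow_le_add_mul hp).trans ?_
    refine add_le_add le_rfl ?_
    by_cases hn : σ (x, y) ≤ τ
    · rw [show s * (c * P (x, y)) = c * (s * P (x, y)) by ring]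
      refine mul_le_mul_left ?_ _
      refine mul_le_mul_right ?_ _
      refine ENNReal.rpow_le_rpow ?_ (by linarith)
      rw [two_mul]
      exact add_le_add hn ((mul_le_of_le_one_right' hy).trans hsτ)
    · rw [hPτ _ _ hn]; simp
  -- After cancelling the finite energy of `σ`, both sides are linear in the exchanged mass and the
  -- factor `s` drops out.
  have hmain : ∫⁻ x, ∫⁻ y, D (x, y) * (σ (x, y) * I (x, y)) ∂l ∂l ≤
      ∫⁻ x, ∫⁻ y, D (x, y) * P (x, y) ∂l ∂l + a * (c * ∫⁻ x, ∫⁻ y, P (x, y) ∂l ∂l) := by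
    have h1 : kernelEnergy l D a p σ + s * ∫⁻ x, ∫⁻ y, D (x, y) * (σ (x, y) * I (x, y)) ∂l ∂l ≤
        kernelEnergy l D a p σ + s * (∫⁻ x, ∫⁻ y, D (x, y) * P (x, y) ∂l ∂l +
          a * (c * ∫⁻ x, ∫⁻ y, P (x, y) ∂l ∂l)) := by
      calc _ ≤ kernelEnergy l D a p σ' + s * ∫⁻ x, ∫⁻ y, D (x, y) * (σ (x, y) * I (x, y)) ∂l ∂l :=
            add_le_add hmin le_rfl
        _ = (∫⁻ x, ∫⁻ y, D (x, y) * σ' (x, y) ∂l ∂l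
              + s * ∫⁻ x, ∫⁻ y, D (x, y) * (σ (x, y) * I (x, y)) ∂l ∂l)
              + a * ∫⁻ x, ∫⁻ y, σ' (x, y) ^ p ∂l ∂l := by
            rw [kernelEnergy]; ring
        _ ≤ (∫⁻ x, ∫⁻ y, D (x, y) * σ (x, y) ∂l ∂l + s * ∫⁻ x, ∫⁻ y, D (x, y) * P (x, y) ∂l ∂l)
            + a * (∫⁻ x, ∫⁻ y, σ (x, y) ^ p ∂l ∂l + s * (c * ∫⁻ x, ∫⁻ y, P (x, y) ∂l ∂l)) := by
            rw [hcost]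
            gcongr
        _ = _ := by rw [kernelEnergy]; ring
    have h2 := (ENNReal.add_le_add_iff_left hfin).1 h1
    exact (ENNReal.mul_le_mul_iff_right hs0 hs_fin).1 h2
  set u : X × X × X × X → ℝ≥0∞ := fun q => w q * σ (q.1, q.2.1) * σ (q.2.2.1, q.2.2.2) with hu
  have hum : Measurable u := by fun_prop
  have hus : ∀ x z x' z', u (x', z', x, z) = u (x, z, x', z') := by
    intro x z x' z'
    simp only [hu, hws x z x' z']
    ring
  set L : (X × X × X × X → ℝ≥0∞) → ℝ≥0∞ := fun F =>
    ∫⁻ x, ∫⁻ z, ∫⁻ x', ∫⁻ z', F (x, z, x', z') * u (x, z, x', z') ∂l ∂l ∂l ∂l with hL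
  have hLprod : ∀ F : X × X × X × X → ℝ≥0∞, Measurable F →
      L F = ∫⁻ q, F q * u q ∂(l.prod (l.prod (l.prod l))) := by
    intro F hF
    rw [lintegral_prod _ (by fun_prop)]
    refine lintegral_congr fun x => ?_
    rw [lintegral_prod _ (by fun_prop)]
    refine lintegral_congr fun z => ?_
    rw [lintegral_prod _ (by fun_prop)]
  have hA : ∫⁻ x, ∫⁻ z, D (x, z) * (σ (x, z) * I (x, z)) ∂l ∂l = L (fun q => D (q.1, q.2.1)) := by
    refine lintegral_congr fun x => lintegral_congr fun z => ?_
    simp only [hI]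
    rw [← mul_assoc, ← lintegral_const_mul _ (by
      have : Measurable fun q : X × X => w (x, z, q.1, q.2) * σ (q.1, q.2) := by fun_prop
      exact this.lintegral_prod_right')]
    refine lintegral_congr fun x' => ?_
    rw [← lintegral_const_mul _ (by fun_prop)]
    refine lintegral_congr fun z' => ?_
    simp only [hu]
    ring
  have hrot : ∀ f : X × X → ℝ≥0∞, Measurable f →
      ∫⁻ x, ∫⁻ z', f (x, z') * P (x, z') ∂l ∂l = L (fun q => f (q.1, q.2.2.2)) := by
    intro f hf
    simp only [hL]
    rw [lintegral_four_rotate (F := fun q => f (q.1, q.2.2.2) * u q) (by fun_prop)]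
    refine lintegral_congr fun x => lintegral_congr fun z' => ?_
    simp only [hP]
    rw [← lintegral_const_mul _ (by
      have : Measurable fun q : X × X => w (x, q.1, q.2, z') * σ (x, q.1) * σ (q.2, z') := by
        fun_prop
      exact this.lintegral_prod_right')]
    refine lintegral_congr fun z => ?_
    rw [← lintegral_const_mul _ (by fun_prop)]
  have hB := hrot D hD
  have hC : ∫⁻ x, ∫⁻ y, P (x, y) ∂l ∂l = L (fun _ => 1) := by
    rw [← hrot (fun _ => 1) measurable_const]
    simp
  have hswap : ∀ F : X × X × X × X → ℝ≥0∞, Measurable F →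
      L F = L (fun q => F (q.2.2.1, q.2.2.2, q.1, q.2.1)) := by
    intro F hF
    simp only [hL]
    rw [lintegral_four_swap (F := fun q => F q * u q) (by fun_prop)]
    simp only [hus]
  have hA' := hswap (fun q => D (q.1, q.2.1)) (by fun_prop)
  have hB' := hswap (fun q => D (q.1, q.2.2.2)) (by fun_prop)
  simp only at hA' hB'
  have hLadd : ∀ F G : X × X × X × X → ℝ≥0∞, Measurable F → Measurable G →
      L (fun q => F q + G q) = L F + L G := by
    intro F G hF hG
    rw [hLprod _ hF, hLprod _ hG, hLprod (fun q => F q + G q) (by fun_prop),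
      ← lintegral_add_left (by fun_prop)]
    simp only [add_mul]
  have hLc : ∀ k : ℝ≥0∞, L (fun _ => k) = k * L (fun _ => 1) := by
    intro k
    rw [hLprod (fun _ => k) (by fun_prop), hLprod (fun _ => 1) (by fun_prop),
      ← lintegral_const_mul _ (by fun_prop)]
    simp
  set G : X × X × X × X → ℝ≥0∞ := fun q => D (q.1, q.2.1) + D (q.2.2.1, q.2.2.2) with hG
  set F : X × X × X × X → ℝ≥0∞ := fun q =>
    D (q.1, q.2.2.2) + D (q.2.2.1, q.2.1) + 2 * (a * c) with hF
  have hLG : L G = 2 * L (fun q => D (q.1, q.2.1)) := by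
    rw [hG, hLadd (fun q => D (q.1, q.2.1)) (fun q => D (q.2.2.1, q.2.2.2)) (by fun_prop)
      (by fun_prop), ← hA', two_mul]
  have hLF : L F = 2 * L (fun q => D (q.1, q.2.2.2)) + 2 * (a * c) * L (fun _ => 1) := by
    rw [hF, hLadd (fun q => D (q.1, q.2.2.2) + D (q.2.2.1, q.2.1)) (fun _ => 2 * (a * c))
      (by fun_prop) (by fun_prop), hLadd (fun q => D (q.1, q.2.2.2)) (fun q => D (q.2.2.1, q.2.1))
      (by fun_prop) (by fun_prop), ← hB', hLc (2 * (a * c)),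
      ← two_mul]
  -- Minimality gives this inequality between integrals against `u`, whereas on `W` the integrands
  -- satisfy `F < G`. Both can hold only if `u` vanishes almost everywhere. The symmetrised cost
  -- counts two created pairs, hence the factor two in `hWlt`.
  have hLGF : L G ≤ L F := by
    rw [hA, hB, hC] at hmain
    rw [hLG, hLF]
    calc 2 * L (fun q => D (q.1, q.2.1)) ≤
          2 * (L (fun q => D (q.1, q.2.2.2)) + a * (c * L (fun _ => 1))) := by gcongr
      _ = _ := by ring
  have hLGfin : L G ≠ ∞ := by
    rw [hLG]
    refine ENNReal.mul_ne_top (by simp) (ne_top_of_le_ne_top hfin ?_)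
    rw [← hA]
    refine le_trans ?_ le_self_add
    refine lintegral_mono fun x => lintegral_mono fun z => ?_
    exact mul_le_mul_right (mul_le_of_le_one_right' (hI1 _)) _
  have hFm : Measurable F := by fun_prop
  have hGm : Measurable G := by fun_prop
  have hpt : ∀ q, F q * u q ≤ G q * u q := by
    intro q
    by_cases hq : q ∈ W
    · refine mul_le_mul_left ?_ _
      have := (hWlt q.1 q.2.1 q.2.2.1 q.2.2.2 hq).le
      simp only [hF, hG, hc]
      rwa [← mul_assoc a]
    · have : u q = 0 := by
        have : w q = 0 := Set.indicator_of_notMem hq _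
        simp [hu, this]
      simp [this]
  rw [hLprod _ hGm] at hLGfin
  rw [hLprod _ hGm, hLprod _ hFm] at hLGF
  have hae := ae_eq_of_ae_le_of_lintegral_le (Filter.Eventually.of_forall hpt)
    (ne_top_of_le_ne_top hLGfin (lintegral_mono hpt)) (by fun_prop) hLGF
  have hLu : L (fun _ => 1) ≠ ∞ := by
    rw [← hC]
    refine ne_top_of_le_ne_top (b := 1) (by simp) ?_
    calc ∫⁻ x, ∫⁻ y, P (x, y) ∂l ∂l ≤ ∫⁻ x, ∫⁻ y, 1 ∂l ∂l := by
          refine lintegral_mono_ae ?_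
          filter_upwards [hP1] with x hx
          exact lintegral_mono_ae hx
      _ = 1 := by simp
  rw [hLprod (fun _ => 1) (by fun_prop)] at hLu
  simp only [one_mul] at hLu
  have hufin := ae_lt_top hum hLu
  have hgoal : ∫⁻ q, u q ∂(l.prod (l.prod (l.prod l))) = 0 := by
    rw [lintegral_eq_zero_iff hum]
    filter_upwards [hae, hufin] with q hq hqfin
    by_contra hne
    have hqW : q ∈ W := by
      by_contra hn
      apply hne
      have : w q = 0 := Set.indicator_of_notMem hn _
      simp [hu, this]
    have hlt := hWlt q.1 q.2.1 q.2.2.1 q.2.2.2 hqW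
    have : F q < G q := by
      simp only [hF, hG, hc]
      rwa [← mul_assoc a]
    exact absurd hq (((ENNReal.mul_lt_mul_iff_left hne hqfin.ne).2 this).ne)
  have := hLprod (fun _ => 1) (by fun_prop)
  simp only [one_mul, hL] at this
  rw [hgoal] at this
  exact this

/-- Convexity of the power at `θ⁻¹ * u` and `(1 - θ)⁻¹ * v`. Taking `θ` close to one makes the
factor of `u ^ p` close to one, at the expense of `v`, which will be small. -/
theorem ENNReal.add_rpow_le_weighted {u v θ : ℝ≥0∞} (hθ0 : θ ≠ 0) (hθ1 : θ < 1) {p : ℝ}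
    (hp : 1 < p) :
    (u + v) ^ p ≤ θ * θ⁻¹ ^ p * u ^ p + (1 - θ) * (1 - θ)⁻¹ ^ p * v ^ p := by
  have hθt : θ ≠ ∞ := (hθ1.trans ENNReal.one_lt_top).ne
  have h1 : (1 - θ) ≠ 0 := (tsub_pos_of_lt hθ1).ne'
  have h1t : (1 - θ) ≠ ∞ := ne_top_of_le_ne_top ENNReal.one_ne_top tsub_le_self
  have := ENNReal.rpow_arith_mean_le_arith_mean2_rpow θ (1 - θ) (θ⁻¹ * u) ((1 - θ)⁻¹ * v)
    (add_tsub_cancel_of_le hθ1.le) hp.le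
  rw [← mul_assoc, ← mul_assoc, ENNReal.mul_inv_cancel hθ0 hθt, ENNReal.mul_inv_cancel h1 h1t,
    one_mul, one_mul, ENNReal.mul_rpow_of_nonneg _ _ (by linarith),
    ENNReal.mul_rpow_of_nonneg _ _ (by linarith), ← mul_assoc, ← mul_assoc] at this
  exact this

/-- Compared with its symmetrisation on `G \ H`, a minimal kernel carries little cost on `H`. -/
theorem IsMinKernel.cost_indicator_le {D σ : X × X → ℝ≥0∞} {a : ℝ≥0∞} {p : ℝ} (hp : 1 < p)
    (hD : Measurable D) (h : IsMinKernel l D a p σ)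
    (hfin : kernelEnergy l D a p σ ≠ ∞) {G H : Set (X × X)} (hG : MeasurableSet G)
    (hH : MeasurableSet H) {η s θ : ℝ≥0∞} (hGD : ∀ x y, (x, y) ∈ G → D (y, x) ≤ (1 + η) * D (x, y))
    (hs1 : s ≤ 1) (hθ0 : θ ≠ 0) (hθ1 : θ < 1) :
    ∃ g : X → ℝ≥0∞, Measurable g ∧ (∀ x, g x ≤ 1) ∧ s ≤ ∫⁻ x, g x ∂l ∧
      ∫⁻ x, g x ∂l ≤ s + ∫⁻ x, ∫⁻ y, (G \ H)ᶜ.indicator σ (x, y) ∂l ∂l ∧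
      ∀ τ, IsKernelDensity l g τ →
        ∫⁻ x, ∫⁻ y, H.indicator (fun q => D q * σ q) (x, y) ∂l ∂l
            + a * ∫⁻ x, ∫⁻ y, σ (x, y) ^ p ∂l ∂l ≤
          η * ∫⁻ x, ∫⁻ y, D (x, y) * σ (x, y) ∂l ∂l
            + θ * θ⁻¹ ^ p * (a * ∫⁻ x, ∫⁻ y, σ (x, y) ^ p ∂l ∂l)
            + ∫⁻ x, ∫⁻ y, D (x, y) * τ (x, y) ∂l ∂l
            + (1 - θ) * (1 - θ)⁻¹ ^ p * (a * ∫⁻ x, ∫⁻ y, τ (x, y) ^ p ∂l ∂l) := by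
  have hσ := h.1.meas
  set N : Set (X × X) := G \ H with hN
  have hNm : MeasurableSet N := hG.diff hH
  set σN : X × X → ℝ≥0∞ := N.indicator σ with hσN
  have hσNm : Measurable σN := hσ.indicator hNm
  have hσNle : ∀ q, σN q ≤ σ q := fun q => Set.indicator_le_self' (by simp) q
  have h1 : Measurable fun x => ∫⁻ y, σN (x, y) ∂l := hσNm.lintegral_prod_right'
  have h2 : Measurable fun y => ∫⁻ x, σN (x, y) ∂l := hσNm.lintegral_prod_left'
  -- Keeping only the fraction `1 - s` of the symmetrisation leaves a marginal deficit of at least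
  -- `s` everywhere. The later self-coupling of the deficit needs such a lower bound on its mass.
  set k : ℝ≥0∞ := (1 - s) * 2⁻¹ with hk
  have hk2 : k + k = 1 - s := by
    rw [hk, ← mul_add, ENNReal.inv_two_add_inv_two, mul_one]
  set m : X → ℝ≥0∞ := fun x => k * (∫⁻ y, σN (x, y) ∂l + ∫⁻ y, σN (y, x) ∂l) with hm
  have hmm : Measurable m := by fun_prop
  have hm1 : ∀ᵐ x ∂l, m x ≤ 1 - s := by
    filter_upwards [h.1.left, h.1.right] with x hx1 hx2
    have e1 : ∫⁻ y, σN (x, y) ∂l ≤ 1 := by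
      simp only [Pi.one_apply] at hx1
      exact hx1 ▸ lintegral_mono fun y => hσNle _
    have e2 : ∫⁻ y, σN (y, x) ∂l ≤ 1 := by
      simp only [Pi.one_apply] at hx2
      exact hx2 ▸ lintegral_mono fun y => hσNle _
    calc m x ≤ k * (1 + 1) := mul_le_mul_right (add_le_add e1 e2) _
      _ = 1 - s := by rw [mul_add, mul_one, hk2]
  have hmg : ∀ᵐ x ∂l, m x + (1 - m x) = 1 := by
    filter_upwards [hm1] with x hx
    exact add_tsub_cancel_of_le (hx.trans tsub_le_self)
  have hlin : ∀ f g : X × X → ℝ≥0∞, Measurable f → Measurable g →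
      ∫⁻ x, ∫⁻ y, f (x, y) + g (x, y) ∂l ∂l =
        ∫⁻ x, ∫⁻ y, f (x, y) ∂l ∂l + ∫⁻ x, ∫⁻ y, g (x, y) ∂l ∂l := by
    intro f g hf hg
    rw [← lintegral_add_left hf.lintegral_prod_right']
    exact lintegral_congr fun x => lintegral_add_left (by fun_prop) _
  have hcm : ∀ (c : ℝ≥0∞) (f : X × X → ℝ≥0∞), Measurable f →
      ∫⁻ x, ∫⁻ y, c * f (x, y) ∂l ∂l = c * ∫⁻ x, ∫⁻ y, f (x, y) ∂l ∂l := by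
    intro c f hf
    rw [← lintegral_const_mul _ hf.lintegral_prod_right']
    exact lintegral_congr fun x => lintegral_const_mul _ (by fun_prop)
  have hsw : ∀ f : X × X → ℝ≥0∞, Measurable f →
      ∫⁻ x, ∫⁻ y, f (y, x) ∂l ∂l = ∫⁻ x, ∫⁻ y, f (x, y) ∂l ∂l := fun f hf =>
    lintegral_lintegral_swap (by fun_prop)
  have hσ1 : ∫⁻ x, ∫⁻ y, σ (x, y) ∂l ∂l = 1 := by
    rw [h.1.lintegral_eq]; simp
  refine ⟨fun x => 1 - m x, by fun_prop, fun x => tsub_le_self, ?_, ?_, ?_⟩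
  · calc s = ∫⁻ x, s ∂l := by simp
      _ ≤ _ := by
        refine lintegral_mono_ae ?_
        filter_upwards [hm1] with x hx
        calc s = 1 - (1 - s) := (ENNReal.sub_sub_cancel ENNReal.one_ne_top hs1).symm
          _ ≤ _ := tsub_le_tsub_left hx _
  · set A := ∫⁻ x, ∫⁻ y, σN (x, y) ∂l ∂l with hA
    have hA1 : A ≤ 1 := hσ1 ▸ lintegral_mono fun x => lintegral_mono fun y => hσNle _
    have hAt : A ≠ ∞ := ne_top_of_le_ne_top ENNReal.one_ne_top hA1
    have e1 : ∫⁻ x, m x ∂l = (1 - s) * A := by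
      simp only [hm]
      rw [lintegral_const_mul _ (by fun_prop), lintegral_add_left h1, hsw σN hσNm, ← two_mul,
        ← mul_assoc, mul_comm k, two_mul, hk2]
    have e2 : ∫⁻ x, m x ∂l + ∫⁻ x, (1 - m x) ∂l = 1 := by
      rw [← lintegral_add_left hmm, lintegral_congr_ae hmg]; simp
    have e3 : A + ∫⁻ x, ∫⁻ y, Nᶜ.indicator σ (x, y) ∂l ∂l = 1 := by
      rw [hA, ← hlin σN (Nᶜ.indicator σ) hσNm (hσ.indicator hNm.compl), ← hσ1]
      refine lintegral_congr fun x => lintegral_congr fun y => ?_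
      exact congrFun (Set.indicator_self_add_compl N σ) (x, y)
    have e4 : A = (1 - s) * A + s * A := by
      rw [← add_mul, tsub_add_cancel_of_le hs1, one_mul]
    have hfin' : (1 - s) * A ≠ ∞ :=
      ENNReal.mul_ne_top (ne_top_of_le_ne_top ENNReal.one_ne_top tsub_le_self) hAt
    rw [e1] at e2
    refine (ENNReal.add_le_add_iff_left hfin').1 ?_
    rw [e2]
    calc 1 = A + ∫⁻ x, ∫⁻ y, Nᶜ.indicator σ (x, y) ∂l ∂l := e3.symm
      _ = ((1 - s) * A + s * A) + ∫⁻ x, ∫⁻ y, Nᶜ.indicator σ (x, y) ∂l ∂l := by rw [← e4]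
      _ ≤ (1 - s) * A + (s + ∫⁻ x, ∫⁻ y, Nᶜ.indicator σ (x, y) ∂l ∂l) := by
        rw [add_assoc]
        exact add_le_add le_rfl (add_le_add (mul_le_of_le_one_right' hA1) le_rfl)
  · intro τ hτ
    have hτm := hτ.meas
    -- The competitor: a symmetric part has equal marginals, so the deficit `g` is the same on both
    -- sides and a self-coupling `τ` of it restores the marginals.
    set σ' : X × X → ℝ≥0∞ := fun q => k * (σN q + σN (q.2, q.1)) + τ q with hσ'
    have hσ'm : Measurable σ' := by fun_prop
    have hker : IsKernelDensity l 1 σ' := by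
      refine ⟨hσ'm, ?_, ?_⟩
      · filter_upwards [hτ.left, hmg] with x hx hx2
        simp only [hσ']
        rw [lintegral_add_left (by fun_prop), hx, lintegral_const_mul _ (by fun_prop),
          lintegral_add_left (by fun_prop)]
        exact hx2
      · filter_upwards [hτ.right, hmg] with x hx hx2
        simp only [hσ']
        rw [lintegral_add_left (by fun_prop), hx, lintegral_const_mul _ (by fun_prop),
          lintegral_add_left (by fun_prop), add_comm (∫⁻ y, σN (y, x) ∂l)]
        exact hx2
    have hmin := h.2 σ' hker
    set A := ∫⁻ x, ∫⁻ y, D (x, y) * σ (x, y) ∂l ∂l with hA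
    set E := ∫⁻ x, ∫⁻ y, σ (x, y) ^ p ∂l ∂l with hE
    set AN := ∫⁻ x, ∫⁻ y, D (x, y) * σN (x, y) ∂l ∂l with hAN
    set AH := ∫⁻ x, ∫⁻ y, H.indicator (fun q => D q * σ q) (x, y) ∂l ∂l with hAH
    set C := ∫⁻ x, ∫⁻ y, D (x, y) * τ (x, y) ∂l ∂l with hC
    set Eτ := ∫⁻ x, ∫⁻ y, τ (x, y) ^ p ∂l ∂l with hEτ
    have hAt : A ≠ ∞ := ne_top_of_le_ne_top hfin le_self_add
    have hDσm : Measurable fun q => D q * σ q := by fun_prop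
    have hANH : AN + AH ≤ A := by
      rw [hAN, hAH, ← hlin (fun q => D q * σN q) _ (by fun_prop) (hDσm.indicator hH)]
      refine lintegral_mono fun x => lintegral_mono fun y => ?_
      by_cases hq : (x, y) ∈ H
      · have : σN (x, y) = 0 := Set.indicator_of_notMem (fun hn => hn.2 hq) _
        simp [this, hq]
      · simp only [Set.indicator_of_notMem hq, add_zero]
        exact mul_le_mul_right (hσNle _) _
    have hANr : ∫⁻ x, ∫⁻ y, D (x, y) * σN (y, x) ∂l ∂l ≤ (1 + η) * AN := by
      rw [← hsw (fun q => D q * σN (q.2, q.1)) (by fun_prop), hAN,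
        ← hcm _ (fun q => D q * σN q) (by fun_prop)]
      refine lintegral_mono fun x => lintegral_mono fun y => ?_
      by_cases hq : (x, y) ∈ N
      · rw [← mul_assoc]
        exact mul_le_mul_left (hGD x y hq.1) _
      · have : σN (x, y) = 0 := Set.indicator_of_notMem hq _
        simp [this]
    have hk1 : k ≤ 2⁻¹ := mul_le_of_le_one_left' tsub_le_self
    have hcost : ∫⁻ x, ∫⁻ y, D (x, y) * σ' (x, y) ∂l ∂l ≤ AN + η * AN + C := by
      calc ∫⁻ x, ∫⁻ y, D (x, y) * σ' (x, y) ∂l ∂l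
          = ∫⁻ x, ∫⁻ y, k * (D (x, y) * σN (x, y) + D (x, y) * σN (y, x)) + D (x, y) * τ (x, y)
              ∂l ∂l := by
            refine lintegral_congr fun x => lintegral_congr fun y => ?_
            simp only [hσ']
            ring
        _ = k * (AN + ∫⁻ x, ∫⁻ y, D (x, y) * σN (y, x) ∂l ∂l) + C := by
            rw [hlin (fun q => k * (D q * σN q + D q * σN (q.2, q.1))) (fun q => D q * τ q)
              (by fun_prop) (by fun_prop), hcm k (fun q => D q * σN q + D q * σN (q.2, q.1))
              (by fun_prop), hlin (fun q => D q * σN q) (fun q => D q * σN (q.2, q.1))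
              (by fun_prop) (by fun_prop)]
        _ ≤ 2⁻¹ * ((AN + η * AN) + (AN + η * AN)) + C := by
            gcongr
            · exact le_self_add
            · rwa [add_mul, one_mul] at hANr
        _ = AN + η * AN + C := by
            rw [← two_mul, ← mul_assoc, ENNReal.inv_mul_cancel (by simp) (by simp), one_mul]
    have hent : ∫⁻ x, ∫⁻ y, σ' (x, y) ^ p ∂l ∂l ≤
        θ * θ⁻¹ ^ p * E + (1 - θ) * (1 - θ)⁻¹ ^ p * Eτ := by
      set c1 := θ * θ⁻¹ ^ p
      set c2 := (1 - θ) * (1 - θ)⁻¹ ^ p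
      calc ∫⁻ x, ∫⁻ y, σ' (x, y) ^ p ∂l ∂l
          ≤ ∫⁻ x, ∫⁻ y, c1 * (2⁻¹ * σ (x, y) ^ p + 2⁻¹ * σ (y, x) ^ p) + c2 * τ (x, y) ^ p
            ∂l ∂l := by
            refine lintegral_mono fun x => lintegral_mono fun y => ?_
            have hle : σ' (x, y) ≤ (2⁻¹ * σ (x, y) + 2⁻¹ * σ (y, x)) + τ (x, y) := by
              simp only [hσ']
              rw [← mul_add]
              gcongr <;> exact hσNle _
            refine (ENNReal.rpow_le_rpow hle (by linarith)).trans ?_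
            refine (ENNReal.add_rpow_le_weighted hθ0 hθ1 hp).trans ?_
            gcongr
            exact ENNReal.rpow_arith_mean_le_arith_mean2_rpow _ _ _ _
              ENNReal.inv_two_add_inv_two hp.le
        _ = c1 * (2⁻¹ * E + 2⁻¹ * E) + c2 * Eτ := by
            rw [hlin (fun q => c1 * (2⁻¹ * σ q ^ p + 2⁻¹ * σ (q.2, q.1) ^ p)) (fun q => c2 * τ q ^ p)
              (by fun_prop) (by fun_prop), hcm c1 (fun q => 2⁻¹ * σ q ^ p + 2⁻¹ * σ (q.2, q.1) ^ p)
              (by fun_prop), hcm c2 (fun q => τ q ^ p) (by fun_prop),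
              hlin (fun q => 2⁻¹ * σ q ^ p) (fun q => 2⁻¹ * σ (q.2, q.1) ^ p) (by fun_prop)
              (by fun_prop), hcm 2⁻¹ (fun q => σ q ^ p) (by fun_prop),
              hcm 2⁻¹ (fun q => σ (q.2, q.1) ^ p) (by fun_prop),
              hsw (fun q => σ q ^ p) (by fun_prop)]
        _ = c1 * E + c2 * Eτ := by
            rw [← add_mul, ENNReal.inv_two_add_inv_two, one_mul]
    refine (ENNReal.add_le_add_iff_left hAt).1 ?_
    calc A + (AH + a * E) = kernelEnergy l D a p σ + AH := by rw [kernelEnergy]; ring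
      _ ≤ kernelEnergy l D a p σ' + AH := by gcongr
      _ ≤ (AN + η * AN + C) + a * (θ * θ⁻¹ ^ p * E + (1 - θ) * (1 - θ)⁻¹ ^ p * Eτ) + AH := by
          rw [kernelEnergy]; gcongr
      _ = (AN + AH) + η * AN + C + a * (θ * θ⁻¹ ^ p * E + (1 - θ) * (1 - θ)⁻¹ ^ p * Eτ) := by ring
      _ ≤ A + η * A + C + a * (θ * θ⁻¹ ^ p * E + (1 - θ) * (1 - θ)⁻¹ ^ p * Eτ) := by
          gcongr
          exact le_self_add.trans hANH
      _ = _ := by ring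

end Kernels

/-! ### A stopping-time partition of a discrete box into heavy dyadic cells. -/

namespace Dyadic

variable {d J : ℕ}

/-- The label of the dyadic cube of level `j` containing the point `n` of a discrete box. -/
def label (j : ℕ) (n : Fin d → Fin (2 ^ J)) : Fin d → ℕ := fun i => (n i : ℕ) / 2 ^ j

theorem label_mono {j k : ℕ} (h : j ≤ k) {n n' : Fin d → Fin (2 ^ J)}
    (hn : label j n = label j n') : label k n = label k n' := by
  funext i
  have := congrFun hn i
  simp only [label] at this ⊢
  rw [← Nat.add_sub_cancel' h, pow_add, ← Nat.div_div_eq_div_mul, ← Nat.div_div_eq_div_mul, this]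

theorem label_top (n n' : Fin d → Fin (2 ^ J)) : label J n = label J n' := by
  funext i
  simp only [label]
  rw [Nat.div_eq_of_lt (n i).2, Nat.div_eq_of_lt (n' i).2]

/-- A box with a measure can be partitioned into cells, each containing a heavy dyadic cube, such
that points of the same cell are not far apart. -/
theorem exists_cells (ν : Measure (Fin d → Fin (2 ^ J))) (m : ℕ → ℝ≥0∞) (hm : Antitone m)
    (htop : m J ≤ ν Set.univ) :
    ∃ (lev : (Fin d → Fin (2 ^ J)) → ℕ) (cell : (Fin d → Fin (2 ^ J)) → ℕ × (Fin d → ℕ)),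
      (∀ n, lev n ≤ J) ∧
      (∀ n n', cell n = cell n' → label (max (lev n) (lev n')) n = label (max (lev n) (lev n')) n') ∧
      (∀ n, m (lev n) ≤ ν {n' | cell n' = cell n}) ∧
      (∀ j < J, ν {n | lev n = j + 1} ≤ 2 ^ ((J - j) * d) * m j) := by
  classical
  set I := Fin d → Fin (2 ^ J) with hI
  set fib : ℕ → I → Set I := fun j n => {n' | label j n' = label j n} with hfib
  have hex : ∀ n : I, ∃ j, m j ≤ ν (fib j n) := fun n => ⟨J, by
    rwa [show fib J n = Set.univ from Set.eq_univ_of_forall fun n' => label_top n' n]⟩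
  -- The smallest heavy cube around a point may contain points of lower level. The cell is therefore
  -- taken from a point of minimal level inside that cube.
  set lev : I → ℕ := fun n => Nat.find (hex n) with hlev
  have hlev1 : ∀ n, m (lev n) ≤ ν (fib (lev n) n) := fun n => Nat.find_spec (hex n)
  have hlev2 : ∀ n j, m j ≤ ν (fib j n) → lev n ≤ j := fun n j h => Nat.find_min' (hex n) h
  have hrep : ∀ n : I, ∃ y, label (lev n) y = label (lev n) n ∧
      ∀ z, label (lev n) z = label (lev n) n → lev y ≤ lev z := by
    intro n
    have hne : ({z | label (lev n) z = label (lev n) n} : Set I).Nonempty := ⟨n, rfl⟩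
    refine ⟨Function.argminOn lev _ hne, Function.argminOn_mem lev _ hne, fun z hz => ?_⟩
    exact Function.argminOn_le lev _ hz
  choose rep hrep1 hrep2 using hrep
  have hrl : ∀ n, lev (rep n) ≤ lev n := fun n => hrep2 n n rfl
  refine ⟨lev, fun n => (lev (rep n), label (lev (rep n)) (rep n)), ?_, ?_, ?_, ?_⟩
  · intro n
    refine hlev2 n J ?_
    rwa [show fib J n = Set.univ from Set.eq_univ_of_forall fun n' => label_top n' n]
  · intro n n' h
    obtain ⟨h1, h2⟩ := Prod.mk.inj h
    rw [← h1] at h2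
    have e1 := label_mono (le_max_left (lev n) (lev n')) (hrep1 n)
    have e2 := label_mono (le_max_right (lev n) (lev n')) (hrep1 n')
    have e3 := label_mono ((hrl n).trans (le_max_left (lev n) (lev n'))) h2
    rw [← e1, ← e2, e3]
  · intro n
    refine (hm (hrl n)).trans ((hlev1 (rep n)).trans (measure_mono ?_))
    -- Level is constant on the cube of `rep n`: at most this level because the cube itself is
    -- heavy, at least because `rep n` is minimal in a larger cube. So the whole heavy cube falls
    -- into one cell.
    have hge : ∀ y, label (lev (rep n)) y = label (lev (rep n)) (rep n) → lev y = lev (rep n) := by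
      intro y hy
      refine le_antisymm (hlev2 y _ ?_) (hrep2 n y ((label_mono (hrl n) hy).trans (hrep1 n)))
      have : fib (lev (rep n)) y = fib (lev (rep n)) (rep n) := by
        ext z
        simp only [hfib, Set.mem_ofPred_eq, hy]
      rw [this]
      exact hlev1 _
    intro y hy
    have hy' : label (lev (rep n)) y = label (lev (rep n)) (rep n) := hy
    have e1 := hge y hy'
    have e2 : label (lev (rep n)) (rep y) = label (lev (rep n)) (rep n) := by
      rw [← hy']
      have := hrep1 y
      rwa [e1] at this
    have e3 := hge (rep y) e2
    simp only [Set.mem_ofPred_eq, e3, e2]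
  · intro j hj
    -- A point of level `j + 1` lies in a cube of level `j` that is not heavy, and there are `2 ^
    -- ((J - j) * d)` such cubes in the box.
    have hcover : {n : I | lev n = j + 1} ⊆ ⋃ c : Fin d → Fin (2 ^ (J - j)),
        {n : I | (∀ i, label j n i = c i) ∧ lev n = j + 1} := by
      intro n hn
      refine Set.mem_iUnion.2 ⟨fun i => ⟨label j n i, ?_⟩, fun i => rfl, hn⟩
      simp only [label]
      rw [Nat.div_lt_iff_lt_mul (by positivity), ← pow_add, Nat.sub_add_cancel hj.le]
      exact (n i).2
    calc ν {n : I | lev n = j + 1} ≤ ν (⋃ c : Fin d → Fin (2 ^ (J - j)),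
        {n : I | (∀ i, label j n i = c i) ∧ lev n = j + 1}) := measure_mono hcover
      _ ≤ ∑ c : Fin d → Fin (2 ^ (J - j)), ν {n : I | (∀ i, label j n i = c i) ∧ lev n = j + 1} :=
          measure_iUnion_fintype_le _ _
      _ ≤ ∑ c : Fin d → Fin (2 ^ (J - j)), m j := by
          refine Finset.sum_le_sum fun c _ => ?_
          rcases Set.eq_empty_or_nonempty {n : I | (∀ i, label j n i = c i) ∧ lev n = j + 1} with h | ⟨n, hn⟩
          · simp [h]
          · refine (measure_mono (t := fib j n) ?_).trans ?_
            · intro z hz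
              funext i
              rw [hz.1 i, hn.1 i]
            · by_contra hlt
              have := hlev2 n j (not_le.1 hlt).le
              have h2 : lev n = j + 1 := hn.2
              omega
      _ = 2 ^ ((J - j) * d) * m j := by
          rw [Finset.sum_const, Finset.card_univ, nsmul_eq_mul]
          congr 1
          simp [pow_mul]

/-- The fourth powers of the levels have small integral. -/
theorem lintegral_level_le (ν : Measure (Fin d → Fin (2 ^ J))) (lev : (Fin d → Fin (2 ^ J)) → ℕ)
    (hlev : ∀ n, lev n ≤ J) (J0 : ℕ) :
    ∫⁻ n, 4 ^ lev n ∂ν ≤ 4 ^ J0 * ν Set.univ +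
      ∑ j ∈ Finset.Ico J0 J, 4 ^ (j + 1) * ν {n | lev n = j + 1} := by
  calc ∫⁻ n, 4 ^ lev n ∂ν ≤ ∫⁻ n, (4 ^ J0 +
        ∑ j ∈ Finset.Ico J0 J, 4 ^ (j + 1) * ({n | lev n = j + 1} : Set _).indicator 1 n) ∂ν := by
        refine lintegral_mono fun n => ?_
        by_cases h : lev n ≤ J0
        · exact (pow_le_pow_right₀ (by norm_num) h).trans le_self_add
        · have hmem : lev n - 1 ∈ Finset.Ico J0 J := by
            have := hlev n
            simp only [Finset.mem_Ico]; omega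
          have h1 : lev n = lev n - 1 + 1 := by omega
          refine le_trans ?_ le_add_self
          refine le_trans ?_ (Finset.single_le_sum (f := fun j => (4 : ℝ≥0∞) ^ (j + 1) *
            ({n | lev n = j + 1} : Set _).indicator 1 n) (fun _ _ => zero_le) hmem)
          rw [Set.indicator_of_mem (by exact h1), ← h1]
          simp
    _ = _ := by
        rw [lintegral_add_left (by fun_prop), lintegral_finsetSum _ (by fun_prop)]
        congr 1
        · simp
        · refine Finset.sum_congr rfl fun j _ => ?_
          rw [lintegral_const_mul _ (by fun_prop), lintegral_indicator_one (Set.toFinite _).measurableSet]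

end Dyadic

/-! ### Coupling a small measure to itself at small regularised cost. -/

section SelfCoupling

variable {d : ℕ}

local notation "E" => EuclideanSpace ℝ (Fin d)

/-- The index of the cube of side `δ` containing `x`, in a box of `2 ^ J` cubes per side. -/
noncomputable def boxIndex (Λ δ : ℝ) (J : ℕ) (x : E) : Fin d → Fin (2 ^ J) := fun i =>
  ⟨min ⌊(x i + Λ) / δ⌋.toNat (2 ^ J - 1),
    (min_le_right _ _).trans_lt (Nat.sub_lt (by positivity) one_pos)⟩

theorem measurable_boxIndex (Λ δ : ℝ) (J : ℕ) : Measurable (boxIndex (d := d) Λ δ J) := by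
  refine measurable_pi_lambda _ fun i => ?_
  have h1 : Measurable fun x : E => ⌊(x i + Λ) / δ⌋ := by fun_prop
  exact (measurable_of_countable fun k : ℤ => (⟨min k.toNat (2 ^ J - 1),
    (min_le_right _ _).trans_lt (Nat.sub_lt (by positivity) one_pos)⟩ : Fin (2 ^ J))).comp h1

/-- Inside the box the truncation in `boxIndex` is inactive, so the index is a floor and equal
labels at level `k` confine each coordinate difference to `δ * 2 ^ k`. -/
theorem boxIndex_dist {Λ δ : ℝ} {J : ℕ} (hδ : 0 < δ) (hJ : 2 * Λ / δ < 2 ^ J) {x y : E}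
    (hx : ∀ i, |x i| ≤ Λ) (hy : ∀ i, |y i| ≤ Λ) {k : ℕ}
    (h : Dyadic.label k (boxIndex Λ δ J x) = Dyadic.label k (boxIndex Λ δ J y)) :
    ‖x - y‖ ^ 2 ≤ d * (δ ^ 2 * 4 ^ k) := by
  have key : ∀ z : E, (∀ i, |z i| ≤ Λ) → ∀ i,
      ((boxIndex Λ δ J z i : ℕ) : ℝ) ≤ (z i + Λ) / δ ∧
      (z i + Λ) / δ < (boxIndex Λ δ J z i : ℕ) + 1 := by
    intro z hz i
    have h0 : 0 ≤ (z i + Λ) / δ := div_nonneg (by linarith [(abs_le.1 (hz i)).1]) hδ.le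
    have h1 : (z i + Λ) / δ ≤ 2 * Λ / δ := by
      gcongr; linarith [(abs_le.1 (hz i)).2]
    have h2 : (0 : ℤ) ≤ ⌊(z i + Λ) / δ⌋ := Int.floor_nonneg.2 h0
    have h3 : ⌊(z i + Λ) / δ⌋ < (2 : ℤ) ^ J := by
      rw [Int.floor_lt]; push_cast; linarith
    have h4 : ⌊(z i + Λ) / δ⌋.toNat ≤ 2 ^ J - 1 := by
      have : ((2 ^ J : ℕ) : ℤ) = 2 ^ J := by push_cast; rfl
      omega
    have h5 : ((boxIndex Λ δ J z i : ℕ) : ℝ) = ⌊(z i + Λ) / δ⌋ := by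
      simp only [boxIndex, min_eq_left h4]
      have : ((⌊(z i + Λ) / δ⌋.toNat : ℤ) : ℝ) = (⌊(z i + Λ) / δ⌋ : ℝ) := by
        rw [Int.toNat_of_nonneg h2]
      exact_mod_cast this
    rw [h5]
    exact ⟨Int.floor_le _, Int.lt_floor_add_one _⟩
  rw [EuclideanSpace.norm_sq_eq]
  have hterm : ∀ i, ‖(x - y) i‖ ^ 2 ≤ δ ^ 2 * 4 ^ k := by
    intro i
    have hi := congrFun h i
    simp only [Dyadic.label] at hi
    set a := (boxIndex Λ δ J x i : ℕ)
    set b := (boxIndex Λ δ J y i : ℕ)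
    have hpos : 0 < 2 ^ k := by positivity
    have ha := Nat.div_add_mod a (2 ^ k)
    have hb := Nat.div_add_mod b (2 ^ k)
    have ha' := Nat.mod_lt a hpos
    have hb' := Nat.mod_lt b hpos
    rw [hi] at ha
    have hab : a + 1 ≤ b + 2 ^ k := by omega
    have hba : b + 1 ≤ a + 2 ^ k := by omega
    have hab' : (a : ℝ) + 1 ≤ b + 2 ^ k := by exact_mod_cast hab
    have hba' : (b : ℝ) + 1 ≤ a + 2 ^ k := by exact_mod_cast hba
    obtain ⟨x1, x2⟩ := key x hx i
    obtain ⟨y1, y2⟩ := key y hy i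
    have e : (x i + Λ) / δ - (y i + Λ) / δ = (x i - y i) / δ := by ring
    have habs : |(x i - y i) / δ| ≤ 2 ^ k := by
      rw [← e, abs_le]
      constructor <;> linarith
    rw [abs_div, abs_of_pos hδ, div_le_iff₀ hδ] at habs
    rw [PiLp.sub_apply, Real.norm_eq_abs, show (4 : ℝ) = 2 ^ 2 by norm_num, ← pow_mul, mul_comm 2 k,
      pow_mul, ← mul_pow, mul_comm δ]
    exact pow_le_pow_left₀ (abs_nonneg _) habs 2
  calc ∑ i, ‖(x - y) i‖ ^ 2 ≤ ∑ _i : Fin d, δ ^ 2 * 4 ^ k := Finset.sum_le_sum fun i _ => hterm i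
    _ = d * (δ ^ 2 * 4 ^ k) := by simp

theorem exists_box_exponent {Λ δ : ℝ} (hδ : 0 < δ) (hδΛ : δ ≤ Λ) :
    ∃ J : ℕ, 2 * Λ / δ < 2 ^ J ∧ 2 ^ J * δ ≤ 4 * Λ := by
  obtain ⟨k, hk1, hk2⟩ := exists_nat_pow_near (x := 2 * Λ / δ) (y := 2)
    (by rw [le_div_iff₀ hδ]; linarith) (by norm_num)
  refine ⟨k + 1, hk2, ?_⟩
  rw [le_div_iff₀ hδ] at hk1
  rw [pow_succ]; linarith

/-- The measure `g l` is coupled by independent products inside the dyadic cells. A point of level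
`j` then pays order `δ ^ 2 * 4 ^ j` in transport and in regularisation, and high levels carry little
mass since their points lie in light cubes. Levels up to `J0` are charged to the total mass, higher
ones to a geometric tail. For small mass, a large `J0` chosen first makes the bound a small multiple
of `δ ^ 2`. -/
theorem exists_selfCoupling (hd : 2 ≤ d) {p : ℝ} (hp : 1 < p) {Λ : ℝ} (hΛ : 0 < Λ) :
    ∃ C : ℝ, 0 < C ∧ ∀ J0 : ℕ, ∀ (l : Measure E) [IsProbabilityMeasure l],
      (∀ᵐ x ∂l, ∀ i, |x i| ≤ Λ) → ∀ δ : ℝ, 0 < δ → δ ≤ Λ → ∀ g : E → ℝ≥0∞, Measurable g →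
      (∀ x, g x ≤ 1) → ENNReal.ofReal (δ ^ d) ≤ ∫⁻ x, g x ∂l →
      ∃ τ : E × E → ℝ≥0∞, IsKernelDensity l g τ ∧
        ∫⁻ x, ∫⁻ y, ENNReal.ofReal (‖x - y‖ ^ 2) * τ (x, y) ∂l ∂l
          + ENNReal.ofReal (δ ^ ((d : ℝ) * (p - 1) + 2)) * ∫⁻ x, ∫⁻ y, τ (x, y) ^ p ∂l ∂l ≤
        ENNReal.ofReal (δ ^ 2) * (ENNReal.ofReal C * (4 ^ J0 * ∫⁻ x, g x ∂l
          + ENNReal.ofReal (((2 : ℝ) ^ (-(2 / (p - 1)))) ^ J0))) := by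
  have hp1 : 0 < p - 1 := by linarith
  set q : ℝ := (2 : ℝ) ^ (-(2 / (p - 1))) with hq
  have hq0 : 0 < q := by positivity
  have hq1 : q < 1 := Real.rpow_lt_one_of_one_lt_of_neg (by norm_num) (by
    rw [neg_lt_zero]; positivity)
  set C1 : ℝ := 4 * (4 * Λ) ^ d / (1 - q) with hC1
  have hC1pos : 0 < C1 := div_pos (by positivity) (by linarith)
  refine ⟨(2 * d + 1) * (1 + C1), by positivity, ?_⟩
  intro J0 l _ hl δ hδ hδΛ g hg hg1 hb
  obtain ⟨J, hJ1, hJ2⟩ := exists_box_exponent hδ hδΛ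
  set n : E → (Fin d → Fin (2 ^ J)) := boxIndex Λ δ J with hn
  have hnm : Measurable n := measurable_boxIndex Λ δ J
  set ν : Measure (Fin d → Fin (2 ^ J)) := (l.withDensity g).map n with hν
  have hνuniv : ν Set.univ = ∫⁻ x, g x ∂l := by
    rw [hν, Measure.map_apply hnm MeasurableSet.univ, Set.preimage_univ, withDensity_apply _ .univ,
      setLIntegral_univ]
  have hgfin : ∫⁻ x, g x ∂l ≠ ∞ := by
    refine ne_top_of_le_ne_top (b := 1) (by simp) ?_
    calc ∫⁻ x, g x ∂l ≤ ∫⁻ _, 1 ∂l := lintegral_mono hg1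
      _ = 1 := by simp
  -- The threshold for a heavy cube of level `j`. Since `q ^ (p - 1) = 1 / 4`, a density bounded by
  -- its inverse has regularisation of the same order `δ ^ 2 * 4 ^ j` as the squared diameter.
  set mr : ℕ → ℝ := fun j => δ ^ d * q ^ j with hmr
  have hmr0 : ∀ j, 0 < mr j := fun j => by positivity
  have hanti : Antitone fun j => ENNReal.ofReal (mr j) := by
    intro i j hij
    refine ENNReal.ofReal_le_ofReal ?_
    exact mul_le_mul_of_nonneg_left (pow_le_pow_of_le_one hq0.le hq1.le hij) (by positivity)
  obtain ⟨lev, cell, hlevJ, hclose, hheavy, hcount⟩ := Dyadic.exists_cells ν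
    (fun j => ENNReal.ofReal (mr j)) hanti (by
      rw [hνuniv]
      refine le_trans (ENNReal.ofReal_le_ofReal ?_) hb
      exact mul_le_of_le_one_right (by positivity) (pow_le_one₀ hq0.le hq1.le))
  set w : (Fin d → Fin (2 ^ J)) → ℝ≥0∞ := fun k => ν {k' | cell k' = cell k} with hw
  have hwpos : ∀ k, w k ≠ 0 := fun k h0 => by
    have := hheavy k
    change _ ≤ w k at this
    rw [h0, nonpos_iff_eq_zero, ENNReal.ofReal_eq_zero] at this
    exact absurd (hmr0 _) (not_lt.2 this)
  have hwtop : ∀ k, w k ≠ ∞ := fun k => ne_top_of_le_ne_top (hνuniv ▸ hgfin)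
    (measure_mono (Set.subset_univ _))
  have hwm : Measurable fun x => w (n x) := (measurable_of_finite w).comp hnm
  set χ : E × E → ℝ≥0∞ := fun z => if cell (n z.2) = cell (n z.1) then 1 else 0 with hχ
  have hχm : Measurable χ :=
    (measurable_of_finite fun k : (Fin d → Fin (2 ^ J)) × (Fin d → Fin (2 ^ J)) =>
      if cell k.2 = cell k.1 then (1 : ℝ≥0∞) else 0).comp
      ((hnm.comp measurable_fst).prodMk (hnm.comp measurable_snd))
  -- On each cell, the product of the restricted measure with itself, normalised by the mass `w` of
  -- the cell.
  set τ : E × E → ℝ≥0∞ := fun z => g z.1 * g z.2 * χ z * (w (n z.1))⁻¹ with hτ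
  have hτm : Measurable τ := by fun_prop
  have hτsymm : ∀ x y, τ (x, y) = τ (y, x) := by
    intro x y
    simp only [hτ, hχ]
    by_cases h : cell (n y) = cell (n x)
    · rw [if_pos h, if_pos h.symm]
      have : w (n x) = w (n y) := by simp only [hw, h]
      rw [this, mul_comm (g x)]
    · rw [if_neg h, if_neg fun h' => h h'.symm]; simp
  have hχint : ∀ x, ∫⁻ y, g y * χ (x, y) ∂l = w (n x) := by
    intro x
    simp only [hw, hν]
    rw [Measure.map_apply hnm (Set.toFinite _).measurableSet,
      withDensity_apply _ (hnm (Set.toFinite _).measurableSet),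
      ← lintegral_indicator (hnm (Set.toFinite _).measurableSet)]
    refine lintegral_congr fun y => ?_
    by_cases h : cell (n y) = cell (n x)
    · rw [Set.indicator_of_mem (by exact h)]
      simp only [hχ]; rw [if_pos h, mul_one]
    · rw [Set.indicator_of_notMem (by exact h)]
      simp only [hχ]; rw [if_neg h, mul_zero]
  have hτint : ∀ x, ∫⁻ y, τ (x, y) ∂l = g x := by
    intro x
    calc ∫⁻ y, τ (x, y) ∂l = ∫⁻ y, (g x * (w (n x))⁻¹) * (g y * χ (x, y)) ∂l := by
          refine lintegral_congr fun y => ?_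
          simp only [hτ]; ring
      _ = g x * ((w (n x))⁻¹ * w (n x)) := by
          rw [lintegral_const_mul _ (by fun_prop), hχint, mul_assoc]
      _ = g x := by rw [ENNReal.inv_mul_cancel (hwpos _) (hwtop _), mul_one]
  have hτint' : ∀ y, ∫⁻ x, τ (x, y) ∂l = g y := by
    intro y
    rw [← hτint y]
    exact lintegral_congr fun x => hτsymm x y
  refine ⟨τ, ⟨hτm, Filter.Eventually.of_forall hτint, Filter.Eventually.of_forall hτint'⟩, ?_⟩
  set S : ℝ≥0∞ := ∫⁻ x, 4 ^ lev (n x) * g x ∂l with hS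
  have hlevm : Measurable fun x => (4 : ℝ≥0∞) ^ lev (n x) :=
    (measurable_of_finite fun k => (4 : ℝ≥0∞) ^ lev k).comp hnm
  have hSν : S = ∫⁻ k, 4 ^ lev k ∂ν := by
    rw [hν, lintegral_map (measurable_of_finite _) hnm,
      lintegral_withDensity_eq_lintegral_mul _ hg hlevm]
    exact lintegral_congr fun x => mul_comm _ _
  have hScost : ∫⁻ x, ∫⁻ y, 4 ^ lev (n x) * τ (x, y) ∂l ∂l = S := by
    refine lintegral_congr fun x => ?_
    rw [lintegral_const_mul _ (by fun_prop), hτint]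
  have hScost' : ∫⁻ x, ∫⁻ y, 4 ^ lev (n y) * τ (x, y) ∂l ∂l = S := by
    rw [lintegral_lintegral_swap (by
      have : Measurable fun z : E × E => 4 ^ lev (n z.2) * τ z :=
        (hlevm.comp measurable_snd).mul hτm
      exact this.aemeasurable)]
    refine lintegral_congr fun x => ?_
    rw [lintegral_const_mul _ (by fun_prop), hτint']
  have hcost : ∫⁻ x, ∫⁻ y, ENNReal.ofReal (‖x - y‖ ^ 2) * τ (x, y) ∂l ∂l ≤
      ENNReal.ofReal (d * δ ^ 2) * (S + S) := by
    calc ∫⁻ x, ∫⁻ y, ENNReal.ofReal (‖x - y‖ ^ 2) * τ (x, y) ∂l ∂l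
        ≤ ∫⁻ x, ∫⁻ y, ENNReal.ofReal (d * δ ^ 2) * (4 ^ lev (n x) * τ (x, y) +
            4 ^ lev (n y) * τ (x, y)) ∂l ∂l := by
          refine lintegral_mono_ae ?_
          filter_upwards [hl] with x hx
          refine lintegral_mono_ae ?_
          filter_upwards [hl] with y hy
          by_cases h : cell (n y) = cell (n x)
          · suffices hs : ENNReal.ofReal (‖x - y‖ ^ 2) ≤
                ENNReal.ofReal (d * δ ^ 2) * (4 ^ lev (n x) + 4 ^ lev (n y)) by
              calc _ ≤ ENNReal.ofReal (d * δ ^ 2) * (4 ^ lev (n x) + 4 ^ lev (n y)) * τ (x, y) := by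
                    gcongr
                _ = _ := by ring
            have h1 := boxIndex_dist hδ hJ1 hy hx (hclose _ _ h)
            rw [norm_sub_rev] at h1
            refine (ENNReal.ofReal_le_ofReal h1).trans ?_
            rw [← mul_assoc, ENNReal.ofReal_mul (by positivity), ENNReal.ofReal_pow (by norm_num)]
            refine mul_le_mul_right ?_ _
            rw [ENNReal.ofReal_ofNat]
            rcases max_choice (lev (n y)) (lev (n x)) with h' | h' <;> rw [hn] at h' ⊢ <;> rw [h']
            · exact le_add_self
            · exact le_self_add
          · have : τ (x, y) = 0 := by
              simp only [hτ, hχ]; rw [if_neg h]; simp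
            simp [this]
      _ = ENNReal.ofReal (d * δ ^ 2) * (S + S) := by
          have hm1 : Measurable fun z : E × E => 4 ^ lev (n z.1) * τ z :=
            (hlevm.comp measurable_fst).mul hτm
          have hm2 : Measurable fun z : E × E => 4 ^ lev (n z.2) * τ z :=
            (hlevm.comp measurable_snd).mul hτm
          conv_rhs => enter [2, 1]; rw [← hScost]
          conv_rhs => enter [2, 2]; rw [← hScost']
          rw [← lintegral_add_left hm1.lintegral_prod_right',
            ← lintegral_const_mul (ENNReal.ofReal (d * δ ^ 2)) (by
              have h1 : Measurable fun x => ∫⁻ y, 4 ^ lev (n x) * τ (x, y) ∂l :=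
                hm1.lintegral_prod_right'
              have h2 : Measurable fun x => ∫⁻ y, 4 ^ lev (n y) * τ (x, y) ∂l :=
                hm2.lintegral_prod_right'
              exact h1.add h2)]
          refine lintegral_congr fun x => ?_
          rw [← lintegral_add_left (by fun_prop), lintegral_const_mul _ (by fun_prop)]
  have hent : ENNReal.ofReal (δ ^ ((d : ℝ) * (p - 1) + 2)) * ∫⁻ x, ∫⁻ y, τ (x, y) ^ p ∂l ∂l ≤
      ENNReal.ofReal (δ ^ 2) * S := by
    rw [← hScost]
    have hτle : ∀ x y, τ (x, y) ≤ (ENNReal.ofReal (mr (lev (n x))))⁻¹ := by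
      intro x y
      have h1 : χ (x, y) ≤ 1 := by
        simp only [hχ]; split_ifs <;> simp
      calc τ (x, y) ≤ 1 * 1 * 1 * (w (n x))⁻¹ := by
            simp only [hτ]; gcongr <;> exact hg1 _
        _ ≤ _ := by
            rw [one_mul, one_mul, one_mul]
            exact ENNReal.inv_le_inv.2 (hheavy _)
    have hpt : ∀ x y, ENNReal.ofReal (δ ^ ((d : ℝ) * (p - 1) + 2)) * τ (x, y) ^ p ≤
        ENNReal.ofReal (δ ^ 2) * (4 ^ lev (n x) * τ (x, y)) := by
      intro x y
      have e1 : τ (x, y) ^ p = τ (x, y) ^ (p - 1) * τ (x, y) := by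
        have := ENNReal.rpow_add_of_nonneg (x := τ (x, y)) (p - 1) 1 hp1.le zero_le_one
        rwa [sub_add_cancel, ENNReal.rpow_one] at this
      rw [e1]
      suffices hs : ENNReal.ofReal (δ ^ ((d : ℝ) * (p - 1) + 2)) *
          (ENNReal.ofReal (mr (lev (n x))))⁻¹ ^ (p - 1) ≤
          ENNReal.ofReal (δ ^ 2) * 4 ^ lev (n x) by
        calc _ ≤ ENNReal.ofReal (δ ^ ((d : ℝ) * (p - 1) + 2)) *
              ((ENNReal.ofReal (mr (lev (n x))))⁻¹ ^ (p - 1) * τ (x, y)) := by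
              gcongr; exact hτle x y
          _ = ENNReal.ofReal (δ ^ ((d : ℝ) * (p - 1) + 2)) *
              (ENNReal.ofReal (mr (lev (n x))))⁻¹ ^ (p - 1) * τ (x, y) := (mul_assoc _ _ _).symm
          _ ≤ ENNReal.ofReal (δ ^ 2) * 4 ^ lev (n x) * τ (x, y) := by gcongr
          _ = _ := mul_assoc _ _ _
      set j := lev (n x)
      rw [← ENNReal.ofReal_inv_of_pos (hmr0 j), ENNReal.ofReal_rpow_of_pos (by
        have := hmr0 j; positivity), ← ENNReal.ofReal_mul (by positivity)]
      have h4 : (4 : ℝ≥0∞) ^ j = ENNReal.ofReal (4 ^ j) := by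
        rw [ENNReal.ofReal_pow (by norm_num), ENNReal.ofReal_ofNat]
      rw [h4, ← ENNReal.ofReal_mul (by positivity)]
      refine ENNReal.ofReal_le_ofReal (le_of_eq ?_)
      have e2 : q ^ (p - 1) = 4⁻¹ := by
        rw [hq, ← Real.rpow_mul (by norm_num), show -(2 / (p - 1)) * (p - 1) = -2 by field_simp,
          Real.rpow_neg (by norm_num)]
        norm_num
      rw [Real.inv_rpow (hmr0 j).le, hmr, Real.mul_rpow (by positivity) (by positivity),
        ← Real.rpow_natCast (q) j, ← Real.rpow_mul hq0.le, mul_comm (j : ℝ), Real.rpow_mul hq0.le,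
        e2,
        ← Real.rpow_natCast δ d, ← Real.rpow_mul hδ.le, Real.rpow_add hδ, Real.rpow_natCast,
        inv_pow, Real.rpow_ofNat]
      have : δ ^ ((d : ℝ) * (p - 1)) ≠ 0 := by positivity
      field_simp
    have hm1 : Measurable fun z : E × E => τ z ^ p := by fun_prop
    have hm2 : Measurable fun z : E × E => 4 ^ lev (n z.1) * τ z :=
      (hlevm.comp measurable_fst).mul hτm
    rw [← lintegral_const_mul _ hm1.lintegral_prod_right',
      ← lintegral_const_mul _ hm2.lintegral_prod_right']
    refine lintegral_mono fun x => ?_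
    rw [← lintegral_const_mul _ (by fun_prop), ← lintegral_const_mul _ (by fun_prop)]
    exact lintegral_mono fun y => hpt x y
  have hSle : S ≤ 4 ^ J0 * ∫⁻ x, g x ∂l + ENNReal.ofReal (C1 * q ^ J0) := by
    rw [hSν, ← hνuniv]
    refine (Dyadic.lintegral_level_le ν lev hlevJ J0).trans ?_
    refine add_le_add le_rfl ?_
    calc ∑ j ∈ Finset.Ico J0 J, 4 ^ (j + 1) * ν {k | lev k = j + 1}
        ≤ ∑ j ∈ Finset.Ico J0 J, ENNReal.ofReal (4 * (4 * Λ) ^ d * q ^ j) := by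
          refine Finset.sum_le_sum fun j hj => ?_
          have hjJ := (Finset.mem_Ico.1 hj).2
          refine (mul_le_mul_right (hcount j hjJ) _).trans ?_
          have h4 : (4 : ℝ≥0∞) ^ (j + 1) = ENNReal.ofReal (4 ^ (j + 1)) := by
            rw [ENNReal.ofReal_pow (by norm_num), ENNReal.ofReal_ofNat]
          have h2 : (2 : ℝ≥0∞) ^ ((J - j) * d) = ENNReal.ofReal (2 ^ ((J - j) * d)) := by
            rw [ENNReal.ofReal_pow (by norm_num), ENNReal.ofReal_ofNat]
          rw [h4, h2, ← ENNReal.ofReal_mul (by positivity), ← ENNReal.ofReal_mul (by positivity)]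
          refine ENNReal.ofReal_le_ofReal ?_
          have e1 : (2 : ℝ) ^ ((J - j) * d) * (2 ^ j) ^ d * δ ^ d ≤ (4 * Λ) ^ d := by
            rw [pow_mul, ← mul_pow, ← mul_pow, ← pow_add, Nat.sub_add_cancel hjJ.le]
            exact pow_le_pow_left₀ (by positivity) hJ2 d
          -- The place where `d ≥ 2` enters: the squared diameter `4 ^ j` is absorbed by the
          -- decreasing number of cubes, which leaves the summable factor `q ^ j`.
          have e2 : (4 : ℝ) ^ j ≤ (2 ^ j) ^ d := by
            rw [show (4 : ℝ) = 2 ^ 2 by norm_num, ← pow_mul, ← pow_mul]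
            refine pow_le_pow_right₀ (by norm_num) ?_
            rw [mul_comm]; exact Nat.mul_le_mul_left j hd
          calc (4 : ℝ) ^ (j + 1) * (2 ^ ((J - j) * d) * mr j)
              = 4 * (4 ^ j * (2 ^ ((J - j) * d) * δ ^ d)) * q ^ j := by
                simp only [hmr]; ring
            _ ≤ 4 * ((2 ^ j) ^ d * (2 ^ ((J - j) * d) * δ ^ d)) * q ^ j := by gcongr
            _ ≤ 4 * (4 * Λ) ^ d * q ^ j := by
                rw [show ((2 : ℝ) ^ j) ^ d * (2 ^ ((J - j) * d) * δ ^ d) =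
                  2 ^ ((J - j) * d) * (2 ^ j) ^ d * δ ^ d by ring]
                gcongr
      _ = ENNReal.ofReal (∑ j ∈ Finset.Ico J0 J, 4 * (4 * Λ) ^ d * q ^ j) :=
          (ENNReal.ofReal_sum_of_nonneg fun j _ => by positivity).symm
      _ ≤ ENNReal.ofReal (C1 * q ^ J0) := by
          refine ENNReal.ofReal_le_ofReal ?_
          rw [← Finset.mul_sum, hC1, div_mul_eq_mul_div, mul_div_assoc]
          exact mul_le_mul_of_nonneg_left (geom_sum_Ico_le_of_lt_one hq0.le hq1) (by positivity)
  calc _ ≤ ENNReal.ofReal (d * δ ^ 2) * (S + S) + ENNReal.ofReal (δ ^ 2) * S := add_le_add hcost hent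
    _ = ENNReal.ofReal (δ ^ 2) * (ENNReal.ofReal (2 * d + 1) * S) := by
        rw [mul_comm (d : ℝ), ENNReal.ofReal_mul (by positivity), ENNReal.ofReal_add (by positivity)
          (by norm_num), ENNReal.ofReal_mul (by norm_num), ENNReal.ofReal_one, ENNReal.ofReal_ofNat]
        ring
    _ ≤ _ := by
        refine mul_le_mul_right ?_ _
        rw [ENNReal.ofReal_mul (by positivity), mul_assoc]
        refine mul_le_mul_right (hSle.trans ?_) _
        rw [mul_add, ENNReal.ofReal_mul hC1pos.le]
        refine add_le_add ?_ ?_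
        · refine le_mul_of_one_le_left' ?_
          rw [ENNReal.one_le_ofReal]; linarith
        · refine mul_le_mul_left (ENNReal.ofReal_le_ofReal (by linarith)) _

end SelfCoupling

/-! ### Cyclical monotonicity of the optimal map and its potential. -/

section CyclicMonotonicity

variable {d : ℕ}

local notation "E" => EuclideanSpace ℝ (Fin d)

lemma Finset.sum_range_succ_eq_of_cycle {M : Type*} [AddCommMonoid M] (f : ℕ → M) (n : ℕ)
    (h : f n = f 0) : ∑ i ∈ Finset.range n, f (i + 1) = ∑ i ∈ Finset.range n, f i := by
  cases n with
  | zero => simp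
  | succ m => rw [Finset.sum_range_succ, h, ← Finset.sum_range_succ']

/-- A cyclic exchange of mass between the pieces `ν i ≤ l` does not lower the cost of an optimal
transport map. -/
lemma IsOTMinimiser.sum_lintegral_le {l mu : Measure E} [IsProbabilityMeasure l] {T : E → E}
    (hT : Continuous T) (hopt : IsOTMinimiser l mu (l.map (fun x => (x, T x))))
    (hfin : transportCost (l.map (fun x => (x, T x))) ≠ ∞)
    (n : ℕ) (ν : ℕ → Measure E) [∀ i, IsProbabilityMeasure (ν i)] (hcyc : ν n = ν 0)
    (s : ℝ≥0∞) (hs0 : s ≠ 0) (hs : s ≠ ∞) (hle : s • ∑ i ∈ Finset.range n, ν i ≤ l) :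
    ∑ i ∈ Finset.range n, ∫⁻ x, ENNReal.ofReal (‖x - T x‖ ^ 2) ∂(ν i) ≤
      ∑ i ∈ Finset.range n, ∫⁻ x, ∫⁻ y, ENNReal.ofReal (‖x - T y‖ ^ 2) ∂(ν i) ∂(ν (i + 1)) := by
  have hTm := hT.measurable
  set m := s • ∑ i ∈ Finset.range n, ν i with hm
  have : IsFiniteMeasure m := ⟨(hle Set.univ).trans_lt (measure_lt_top _ _)⟩
  set ρ := l - m with hρ
  have hl : l = ρ + m := (Measure.sub_add_cancel_of_le hle).symm
  have hg : Measurable (fun x : E => (x, T x)) := by fun_prop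
  -- The competitor sends the piece `ν (i + 1)` to the image of `ν i`. The marginals are unchanged
  -- because the pieces form a cycle.
  set π' : Measure (E × E) := ρ.map (fun x => (x, T x)) +
    s • ∑ i ∈ Finset.range n, (ν (i + 1)).prod ((ν i).map T) with hπ'
  have : ∀ i, IsProbabilityMeasure ((ν i).map T) := fun i =>
    Measure.isProbabilityMeasure_map hTm.aemeasurable
  have hmu : mu = l.map T := by
    rw [← hopt.1.2, Measure.snd_map_prodMk measurable_id']
  have hfstsum : ∀ (t : Finset ℕ) (f : ℕ → Measure (E × E)),
      (∑ i ∈ t, f i).map Prod.fst = ∑ i ∈ t, (f i).map Prod.fst := fun t f => by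
    have := map_sum (Measure.mapₗ (Prod.fst : E × E → E)) f t
    simpa [Measure.mapₗ_apply_of_measurable measurable_fst] using this
  have hsndsum : ∀ (t : Finset ℕ) (f : ℕ → Measure (E × E)),
      (∑ i ∈ t, f i).map Prod.snd = ∑ i ∈ t, (f i).map Prod.snd := fun t f => by
    have := map_sum (Measure.mapₗ (Prod.snd : E × E → E)) f t
    simpa [Measure.mapₗ_apply_of_measurable measurable_snd] using this
  have hTsum : ∀ (t : Finset ℕ) (f : ℕ → Measure E),
      (∑ i ∈ t, f i).map T = ∑ i ∈ t, (f i).map T := fun t f => by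
    have := map_sum (Measure.mapₗ T) f t
    simpa [Measure.mapₗ_apply_of_measurable hTm] using this
  have hmem : π' ∈ couplings l mu := by
    constructor
    · rw [hπ', Measure.fst, Measure.map_add _ _ measurable_fst, Measure.map_smul, hfstsum,
        Measure.map_map measurable_fst hg]
      have h1 : ∀ i, ((ν (i + 1)).prod ((ν i).map T)).map Prod.fst = ν (i + 1) := fun i =>
        Measure.fst_prod
      simp only [h1]
      rw [Finset.sum_range_succ_eq_of_cycle ν n hcyc, ← hm]
      conv_rhs => rw [hl]
      congr 1
      exact Measure.map_id
    · rw [hπ', Measure.snd, Measure.map_add _ _ measurable_snd, Measure.map_smul, hsndsum,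
        Measure.map_map measurable_snd hg]
      have h1 : ∀ i, ((ν (i + 1)).prod ((ν i).map T)).map Prod.snd = (ν i).map T := fun i =>
        Measure.snd_prod
      simp only [h1]
      rw [← hTsum, ← Measure.map_smul, ← hm, hmu]
      conv_rhs => rw [hl, Measure.map_add _ _ hTm]
      rfl
  have hc : Measurable (fun z : E × E => ENNReal.ofReal (‖z.1 - z.2‖ ^ 2)) := by fun_prop
  have hcT : Measurable (fun z : E => ENNReal.ofReal (‖z - T z‖ ^ 2)) := by fun_prop
  have hcTT : Measurable (fun z : E × E => ENNReal.ofReal (‖z.1 - T z.2‖ ^ 2)) := by fun_prop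
  have hmin := isMinOn_iff.1 hopt.2 π' hmem
  have e1 : transportCost (l.map (fun x => (x, T x))) =
      ∫⁻ x, ENNReal.ofReal (‖x - T x‖ ^ 2) ∂ρ +
        s * ∑ i ∈ Finset.range n, ∫⁻ x, ENNReal.ofReal (‖x - T x‖ ^ 2) ∂(ν i) := by
    rw [transportCost, lintegral_map hc hg]
    conv_lhs => rw [hl]
    rw [lintegral_add_measure, hm, lintegral_smul_measure, lintegral_finsetSum_measure]
    rfl
  have e2 : transportCost π' =
      ∫⁻ x, ENNReal.ofReal (‖x - T x‖ ^ 2) ∂ρ +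
        s * ∑ i ∈ Finset.range n,
          ∫⁻ x, ∫⁻ y, ENNReal.ofReal (‖x - T y‖ ^ 2) ∂(ν i) ∂(ν (i + 1)) := by
    rw [transportCost, hπ', lintegral_add_measure, lintegral_smul_measure,
      lintegral_finsetSum_measure, lintegral_map hc hg]
    congr 2
    refine Finset.sum_congr rfl fun i _ => ?_
    rw [lintegral_prod _ hc.aemeasurable]
    refine lintegral_congr fun x => ?_
    rw [lintegral_map (by fun_prop) hTm]
  rw [e1, e2] at hmin
  rw [e1] at hfin
  have h3 := (ENNReal.add_le_add_iff_left (ne_top_of_le_ne_top hfin le_self_add)).1 hmin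
  exact (ENNReal.mul_le_mul_iff_right hs0 hs).1 h3

lemma transportCost_map_ne_top {l : Measure E} [IsProbabilityMeasure l]
    (hK : IsCompact l.support) {T : E → E} (hT : Continuous T) :
    transportCost (l.map (fun x => (x, T x))) ≠ ∞ := by
  rw [transportCost, lintegral_map (by fun_prop) (by fun_prop)]
  obtain ⟨M, hM⟩ := hK.exists_bound_of_continuousOn (f := fun x => ‖x - T x‖ ^ 2)
    (by fun_prop)
  refine ne_top_of_le_ne_top (b := ∫⁻ _, ENNReal.ofReal M ∂l) (by simp) ?_
  refine lintegral_mono_ae ?_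
  filter_upwards [Measure.support_mem_ae (μ := l)] with x hx
  exact ENNReal.ofReal_le_ofReal ((le_abs_self _).trans (hM x hx))

/-- The graph of an optimal transport map is cyclically monotone. -/
lemma IsOTMinimiser.sum_sq_le {l mu : Measure E} [IsProbabilityMeasure l]
    (hK : IsCompact l.support) {T : E → E}
    (hT : Continuous T) (hopt : IsOTMinimiser l mu (l.map (fun x => (x, T x))))
    (n : ℕ) (x : ℕ → E) (hx : ∀ i, x i ∈ l.support) (hcyc : x n = x 0) :
    ∑ i ∈ Finset.range n, ‖x i - T (x i)‖ ^ 2 ≤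
      ∑ i ∈ Finset.range n, ‖x (i + 1) - T (x i)‖ ^ 2 := by
  rcases Nat.eq_zero_or_pos n with rfl | hn
  · simp
  refine le_of_forall_pos_le_add fun θ hθ => ?_
  set t := θ / (2 * n) with ht
  have hn' : (0 : ℝ) < n := by exact_mod_cast hn
  have ht0 : 0 < t := by positivity
  have hloc : ∀ i, ∃ r > 0, (∀ z ∈ Metric.ball (x i) r,
      ‖x i - T (x i)‖ ^ 2 - t ≤ ‖z - T z‖ ^ 2) ∧
      ∀ z ∈ Metric.ball (x (i + 1)) r, ∀ y ∈ Metric.ball (x i) r,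
        ‖z - T y‖ ^ 2 ≤ ‖x (i + 1) - T (x i)‖ ^ 2 + t := by
    intro i
    have c1 : Continuous fun z => ‖z - T z‖ ^ 2 := by fun_prop
    have c2 : Continuous fun q : E × E => ‖q.1 - T q.2‖ ^ 2 := by fun_prop
    obtain ⟨r1, hr1, h1⟩ := Metric.continuousAt_iff.1 (c1.continuousAt (x := x i)) t ht0
    obtain ⟨r2, hr2, h2⟩ := Metric.continuousAt_iff.1
      (c2.continuousAt (x := (x (i + 1), x i))) t ht0
    refine ⟨min r1 r2, lt_min hr1 hr2, fun z hz => ?_, fun z hz y hy => ?_⟩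
    · have := h1 (lt_of_lt_of_le (Metric.mem_ball.1 hz) (min_le_left _ _))
      rw [Real.dist_eq, abs_lt] at this
      linarith [this.1]
    · have : dist (z, y) (x (i + 1), x i) < r2 := by
        rw [Prod.dist_eq]
        exact max_lt (lt_of_lt_of_le (Metric.mem_ball.1 hz) (min_le_right _ _))
          (lt_of_lt_of_le (Metric.mem_ball.1 hy) (min_le_right _ _))
      have := h2 this
      rw [Real.dist_eq, abs_lt] at this
      linarith [this.2]
  choose r' hr' hr1' hr2' using hloc
  obtain ⟨r, hr, hrle⟩ : ∃ r > 0, ∀ i ∈ Finset.range n, r ≤ r' i := by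
    refine ⟨(Finset.range n).inf' ⟨0, by simpa using hn⟩ r', ?_, fun i hi => Finset.inf'_le _ hi⟩
    exact (Finset.lt_inf'_iff _).2 fun i _ => hr' i
  have hpos : ∀ i, l (Metric.ball (x i) r) ≠ 0 := fun i =>
    ((Measure.mem_support_iff_forall _).1 (hx i) _ (Metric.ball_mem_nhds _ hr)).ne'
  -- Points are replaced by normalised restrictions to small balls. The factor `S⁻¹` makes their sum
  -- fit below `l` even when balls overlap.
  set ν : ℕ → Measure E := fun i => ProbabilityTheory.cond l (Metric.ball (x i) r) with hν
  have : ∀ i, IsProbabilityMeasure (ν i) := fun i =>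
    ProbabilityTheory.cond_isProbabilityMeasure (hpos i)
  set S := ∑ i ∈ Finset.range n, (l (Metric.ball (x i) r))⁻¹ with hS
  have hS0 : S ≠ 0 := by
    rw [hS]
    intro h0
    have := Finset.sum_eq_zero_iff.1 h0 0 (by simpa using hn)
    simp at this
  have hStop : S ≠ ∞ := ENNReal.sum_ne_top.2 fun i _ => ENNReal.inv_ne_top.2 (hpos i)
  have hle : S⁻¹ • ∑ i ∈ Finset.range n, ν i ≤ l := by
    have h1 : ∑ i ∈ Finset.range n, ν i ≤ S • l := by
      rw [hS, Finset.sum_smul]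
      refine Finset.sum_le_sum fun i _ => ?_
      simp only [hν, ProbabilityTheory.cond]
      intro s
      simp only [Measure.smul_apply]
      gcongr
      exact Measure.restrict_le_self
    intro s
    have := h1 s
    simp only [Measure.smul_apply, smul_eq_mul] at this ⊢
    calc S⁻¹ * _ ≤ S⁻¹ * (S * l s) := by gcongr
      _ = l s := by rw [← mul_assoc, ENNReal.inv_mul_cancel hS0 hStop, one_mul]
  have key := hopt.sum_lintegral_le hT (transportCost_map_ne_top hK hT) n ν (by simp [hν, hcyc])
    S⁻¹ (ENNReal.inv_ne_zero.2 hStop) (ENNReal.inv_ne_top.2 hS0) hle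
  have hae : ∀ i, ∀ᵐ z ∂(ν i), z ∈ Metric.ball (x i) r := fun i =>
    ProbabilityTheory.ae_cond_mem measurableSet_ball
  have lo : ∀ i ∈ Finset.range n, ENNReal.ofReal (‖x i - T (x i)‖ ^ 2 - t) ≤
      ∫⁻ z, ENNReal.ofReal (‖z - T z‖ ^ 2) ∂(ν i) := by
    intro i hi
    calc _ = ∫⁻ _, ENNReal.ofReal (‖x i - T (x i)‖ ^ 2 - t) ∂(ν i) := by simp
      _ ≤ _ := by
        refine lintegral_mono_ae ?_
        filter_upwards [hae i] with z hz
        exact ENNReal.ofReal_le_ofReal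
          (hr1' i z (Metric.ball_subset_ball (hrle i hi) hz))
  have up : ∀ i ∈ Finset.range n,
      ∫⁻ z, ∫⁻ y, ENNReal.ofReal (‖z - T y‖ ^ 2) ∂(ν i) ∂(ν (i + 1)) ≤
      ENNReal.ofReal (‖x (i + 1) - T (x i)‖ ^ 2 + t) := by
    intro i hi
    calc _ ≤ ∫⁻ _, ∫⁻ _, ENNReal.ofReal (‖x (i + 1) - T (x i)‖ ^ 2 + t) ∂(ν i) ∂(ν (i + 1)) := by
          refine lintegral_mono_ae ?_
          filter_upwards [hae (i + 1)] with z hz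
          refine lintegral_mono_ae ?_
          filter_upwards [hae i] with y hy
          exact ENNReal.ofReal_le_ofReal
            (hr2' i z (Metric.ball_subset_ball (hrle i hi) hz) y
              (Metric.ball_subset_ball (hrle i hi) hy))
      _ = _ := by simp
  have h4 := ((Finset.sum_le_sum lo).trans key).trans (Finset.sum_le_sum up)
  rw [← ENNReal.ofReal_sum_of_nonneg (fun i _ => add_nonneg (sq_nonneg _) ht0.le)] at h4
  have h5 : ENNReal.ofReal (∑ i ∈ Finset.range n, (‖x i - T (x i)‖ ^ 2 - t)) ≤
      ∑ i ∈ Finset.range n, ENNReal.ofReal (‖x i - T (x i)‖ ^ 2 - t) :=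
    Finset.le_sum_of_subadditive _ ENNReal.ofReal_zero.le (fun a b => ENNReal.ofReal_add_le) _ _
  have h6 := (ENNReal.ofReal_le_ofReal_iff
    (Finset.sum_nonneg fun i _ => add_nonneg (sq_nonneg _) ht0.le)).1 (h5.trans h4)
  rw [Finset.sum_sub_distrib, Finset.sum_add_distrib] at h6
  simp only [Finset.sum_const, Finset.card_range, nsmul_eq_mul] at h6
  have : (n : ℝ) * t = θ / 2 := by rw [ht]; field_simp
  linarith

/-- Expanding the squares, the terms `‖x (i + 1)‖ ^ 2 - ‖x i‖ ^ 2` telescope to zero around the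
cycle. -/
lemma IsOTMinimiser.sum_inner_le {l mu : Measure E} [IsProbabilityMeasure l]
    (hK : IsCompact l.support) {T : E → E}
    (hT : Continuous T) (hopt : IsOTMinimiser l mu (l.map (fun x => (x, T x))))
    (n : ℕ) (x : ℕ → E) (hx : ∀ i, x i ∈ l.support) (hcyc : x n = x 0) :
    ∑ i ∈ Finset.range n, inner ℝ (T (x i)) (x (i + 1) - x i) ≤ 0 := by
  have h := hopt.sum_sq_le hK hT n x hx hcyc
  have e : ∀ i, inner ℝ (T (x i)) (x (i + 1) - x i) = (‖x i - T (x i)‖ ^ 2 -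
      ‖x (i + 1) - T (x i)‖ ^ 2 + (‖x (i + 1)‖ ^ 2 - ‖x i‖ ^ 2)) / 2 := by
    intro i
    rw [norm_sub_sq_real, norm_sub_sq_real, inner_sub_right, real_inner_comm (x i),
      real_inner_comm (x (i + 1))]
    ring
  simp only [e]
  rw [← Finset.sum_div, Finset.sum_add_distrib, Finset.sum_sub_distrib,
    Finset.sum_range_sub (fun i => ‖x i‖ ^ 2), hcyc]
  linarith

/-- Rockafellar's potential: a cyclically monotone map is a selection of a subdifferential. -/
lemma exists_potential_of_cyclicallyMonotone {K : Set E} (hne : K.Nonempty) {T : E → E}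
    (hcyc : ∀ (n : ℕ) (x : ℕ → E), (∀ i, x i ∈ K) → x n = x 0 →
      ∑ i ∈ Finset.range n, inner ℝ (T (x i)) (x (i + 1) - x i) ≤ 0) :
    ∃ φ : E → ℝ, ∀ x ∈ K, ∀ z ∈ K, φ x + inner ℝ (T x) (z - x) ≤ φ z := by
  obtain ⟨x0, hx0⟩ := hne
  let S : E → Set ℝ := fun z => {s | ∃ (n : ℕ) (x : ℕ → E), (∀ i, x i ∈ K) ∧ x 0 = x0 ∧ x n = z ∧
    s = ∑ i ∈ Finset.range n, inner ℝ (T (x i)) (x (i + 1) - x i)}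
  have happ : ∀ z ∈ K, ∀ w ∈ K, ∀ s ∈ S z, s + inner ℝ (T z) (w - z) ∈ S w := by
    rintro z hz w hw s ⟨n, x, hx, h0, hn, rfl⟩
    refine ⟨n + 1, Function.update x (n + 1) w, ?_, ?_, ?_, ?_⟩
    · intro i
      rcases eq_or_ne i (n + 1) with rfl | h
      · simpa using hw
      · simpa [Function.update_of_ne h] using hx i
    · simpa using h0
    · simp
    · rw [Finset.sum_range_succ]
      congr 1
      · refine Finset.sum_congr rfl fun i hi => ?_
        have := Finset.mem_range.1 hi
        rw [Function.update_of_ne (by omega), Function.update_of_ne (by omega)]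
      · rw [Function.update_self, Function.update_of_ne (by omega), hn]
  have hnonempty : ∀ z ∈ K, (S z).Nonempty := by
    intro z hz
    refine ⟨_, happ x0 hx0 z hz 0 ⟨0, fun _ => x0, fun _ => hx0, rfl, rfl, by simp⟩⟩
  have hb : ∀ z ∈ K, BddAbove (S z) := by
    -- Closing a chain from `x0` to `z` by returning to `x0` bounds its value, so the supremum
    -- defining the potential is finite.
    intro z hz
    refine ⟨- inner ℝ (T z) (x0 - z), fun s hs => ?_⟩
    obtain ⟨n, x, hx, h0, hn, hs'⟩ := happ z hz x0 hx0 s hs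
    have := hcyc n x hx (hn.trans h0.symm)
    linarith
  refine ⟨fun z => sSup (S z), fun x hx z hz => ?_⟩
  rw [← le_sub_iff_add_le]
  refine csSup_le (hnonempty x hx) fun s hs => ?_
  rw [le_sub_iff_add_le]
  exact le_csSup (hb z hz) (happ x hx z hz s hs)

/-- The Bregman gap `φ x - φ z - ⟪T z, x - z⟫` of a potential. -/
noncomputable def bregman (φ : E → ℝ) (T : E → E) (x z : E) : ℝ :=
  φ x - φ z - inner ℝ (T z) (x - z)

lemma bregman_add_swap (φ : E → ℝ) (T : E → E) (x z : E) :
    bregman φ T x z + bregman φ T z x = inner ℝ (x - z) (T x - T z) := by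
  simp only [bregman, inner_sub_left, inner_sub_right, real_inner_comm]
  ring

/-- Along a chain, the Bregman gap dominates the accumulated increments of `T`. -/
lemma sum_inner_le_bregman {K : Set E} {φ : E → ℝ} {T : E → E}
    (hφ : ∀ x ∈ K, ∀ z ∈ K, 0 ≤ bregman φ T x z) (n : ℕ) (w : ℕ → E) (hw : ∀ i, w i ∈ K) :
    ∑ i ∈ Finset.range n, inner ℝ (T (w i) - T (w 0)) (w (i + 1) - w i) ≤
      bregman φ T (w n) (w 0) := by
  have h : ∀ i, inner ℝ (T (w i) - T (w 0)) (w (i + 1) - w i) ≤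
      (φ (w (i + 1)) - inner ℝ (T (w 0)) (w (i + 1))) - (φ (w i) - inner ℝ (T (w 0)) (w i)) := by
    intro i
    have := hφ _ (hw (i + 1)) _ (hw i)
    simp only [bregman, inner_sub_left, inner_sub_right] at this ⊢
    linarith
  refine (Finset.sum_le_sum fun i _ => h i).trans ?_
  rw [Finset.sum_range_sub (fun i => φ (w i) - inner ℝ (T (w 0)) (w i))]
  simp only [bregman, inner_sub_right]
  linarith

/-- The continuous potential of a Lipschitz optimal transport map. -/
lemma IsOTMinimiser.exists_potential {l mu : Measure E} [IsProbabilityMeasure l]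
    (hK : IsCompact l.support) {L : ℝ≥0} {T : E → E}
    (hT : LipschitzWith L T) (hopt : IsOTMinimiser l mu (l.map (fun x => (x, T x)))) :
    ∃ φ : E → ℝ, Continuous φ ∧ ∀ x ∈ l.support, ∀ z ∈ l.support, 0 ≤ bregman φ T x z := by
  have hne : l.support.Nonempty := Measure.nonempty_support (IsProbabilityMeasure.ne_zero l)
  obtain ⟨φ, hφ⟩ := exists_potential_of_cyclicallyMonotone hne
    (fun n x hx h => hopt.sum_inner_le hK hT.continuous n x hx h)
  obtain ⟨M, hM⟩ := hK.exists_bound_of_continuousOn hT.continuous.continuousOn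
  -- `T` is bounded on the compact support, so a function with subgradients `T x` there is Lipschitz
  -- on it and extends continuously.
  have hlip : LipschitzOnWith (Real.toNNReal M) φ l.support := by
    refine LipschitzOnWith.of_le_add_mul _ fun x hx z hz => ?_
    have h1 := hφ x hx z hz
    have h2 : inner ℝ (T x) (x - z) ≤ M * dist x z := by
      refine (real_inner_le_norm _ _).trans ?_
      rw [dist_eq_norm]
      gcongr
      exact hM x hx
    have h3 : M * dist x z ≤ (Real.toNNReal M : ℝ) * dist x z := by
      gcongr
      exact Real.le_coe_toNNReal M
    have h4 : inner ℝ (T x) (z - x) = - inner ℝ (T x) (x - z) := by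
      rw [← inner_neg_right, neg_sub]
    linarith
  obtain ⟨ψ, hψ, heq⟩ := hlip.extend_real
  refine ⟨ψ, hψ.continuous, fun x hx z hz => ?_⟩
  rw [bregman, ← heq hx, ← heq hz]
  linarith [hφ z hz x hx]

end CyclicMonotonicity

/-! ### Almost symmetry of the Bregman gap near almost every point. -/

section AlmostSymmetry

variable {d : ℕ}

local notation "E" => EuclideanSpace ℝ (Fin d)

/-- Every small displacement `u` from `z` is approximated by points of `K` along which `T` has the
linearisation `A`. -/
def HasDenseDerivAt (K : Set E) (T : E → E) (A : E →L[ℝ] E) (z : E) : Prop :=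
  ∀ η : ℝ, 0 < η → ∃ r0 : ℝ, 0 < r0 ∧ ∀ u : E, ‖u‖ ≤ r0 →
    ∃ k ∈ K, ‖k - z - u‖ ≤ η * ‖u‖ ∧ ‖T k - T z - A u‖ ≤ η * ‖u‖

/-- `K` meets every ball of relative radius `η` around points close to `z`. -/
def IsDenselyAccessible (K : Set E) (z : E) : Prop :=
  ∀ η : ℝ, 0 < η → ∃ r0 : ℝ, 0 < r0 ∧ ∀ u : E, ‖u‖ ≤ r0 → ∃ k ∈ K, ‖k - z - u‖ ≤ η * ‖u‖

lemma HasFDerivAt.exists_norm_le {T : E → E} {A : E →L[ℝ] E} {z : E} (hA : HasFDerivAt T A z)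
    {η : ℝ} (hη : 0 < η) :
    ∃ r : ℝ, 0 < r ∧ ∀ x, ‖x - z‖ ≤ r → ‖T x - T z - A (x - z)‖ ≤ η * ‖x - z‖ := by
  have h := (hasFDerivAt_iff_isLittleO.1 hA).def hη
  obtain ⟨r, hr, h⟩ := Metric.eventually_nhds_iff.1 h
  refine ⟨r / 2, by positivity, fun x hx => h ?_⟩
  rw [dist_eq_norm]
  linarith

lemma HasFDerivAt.hasDenseDerivAt {K : Set E} {T : E → E} {A : E →L[ℝ] E} {z : E}
    (hA : HasFDerivAt T A z) (hK : IsDenselyAccessible K z) : HasDenseDerivAt K T A z := by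
  intro η hη
  set η' := min 1 (η / (2 + ‖A‖)) with hη'
  have h0 : 0 < η' := by positivity
  have h1 : η' ≤ 1 := min_le_left _ _
  have h2 : η' * (2 + ‖A‖) ≤ η := by
    rw [← le_div_iff₀ (by positivity)]
    exact min_le_right _ _
  obtain ⟨r1, hr1, H1⟩ := hK η' h0
  obtain ⟨r2, hr2, H2⟩ := hA.exists_norm_le h0
  refine ⟨min r1 (r2 / 2), by positivity, fun u hu => ?_⟩
  obtain ⟨k, hk, hku⟩ := H1 u (hu.trans (min_le_left _ _))
  have hu2 : ‖u‖ ≤ r2 / 2 := hu.trans (min_le_right _ _)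
  have hkz : ‖k - z‖ ≤ 2 * ‖u‖ := by
    calc ‖k - z‖ = ‖(k - z - u) + u‖ := by rw [sub_add_cancel]
      _ ≤ η' * ‖u‖ + ‖u‖ := (norm_add_le _ _).trans (by gcongr)
      _ ≤ 1 * ‖u‖ + ‖u‖ := by gcongr
      _ = _ := by ring
  refine ⟨k, hk, hku.trans ?_, ?_⟩
  · gcongr
    nlinarith [norm_nonneg A]
  · have e : T k - T z - A u = (T k - T z - A (k - z)) + A (k - z - u) := by
      rw [map_sub A (k - z) u]; abel
    rw [e]
    calc _ ≤ η' * ‖k - z‖ + ‖A‖ * ‖k - z - u‖ :=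
          (norm_add_le _ _).trans (add_le_add (H2 k (by linarith)) (A.le_opNorm _))
      _ ≤ η' * (2 * ‖u‖) + ‖A‖ * (η' * ‖u‖) := by gcongr
      _ = η' * (2 + ‖A‖) * ‖u‖ := by ring
      _ ≤ _ := by gcongr

/-- The blow-up of three-point cyclical monotonicity. -/
lemma HasDenseDerivAt.inner_le {K : Set E} {T : E → E} {A : E →L[ℝ] E} {z : E} {φ : E → ℝ}
    (h : HasDenseDerivAt K T A z) (hz : z ∈ K) (hφ : ∀ x ∈ K, ∀ y ∈ K, 0 ≤ bregman φ T x y)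
    (u v : E) : inner ℝ (A u) v ≤ inner ℝ (A u) u + inner ℝ (A v) v := by
  have key : ∀ m : ℕ, ∃ a1 b1 a2 b2 : E, ‖b1 - u‖ ≤ 1 / ((m : ℝ) + 1) * ‖u‖ ∧
      ‖a1 - A u‖ ≤ 1 / ((m : ℝ) + 1) * ‖u‖ ∧ ‖b2 - v‖ ≤ 1 / ((m : ℝ) + 1) * ‖v‖ ∧
      ‖a2 - A v‖ ≤ 1 / ((m : ℝ) + 1) * ‖v‖ ∧
      inner ℝ a1 (b2 - b1) ≤ inner ℝ a2 b2 := by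
    intro m
    obtain ⟨r, hr, H⟩ := h (1 / ((m : ℝ) + 1)) (by positivity)
    set t := r / (‖u‖ + ‖v‖ + 1) with ht
    have ht0 : 0 < t := by positivity
    have hsz : ∀ w : E, ‖w‖ ≤ ‖u‖ + ‖v‖ → ‖t • w‖ ≤ r := by
      intro w hw
      rw [norm_smul, Real.norm_of_nonneg ht0.le, ht,
        div_mul_eq_mul_div, div_le_iff₀ (by positivity)]
      gcongr
      linarith
    obtain ⟨k1, hk1, e1, f1⟩ := H (t • u) (hsz u (by linarith [norm_nonneg v]))
    obtain ⟨k2, hk2, e2, f2⟩ := H (t • v) (hsz v (by linarith [norm_nonneg u]))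
    have hscale : ∀ (q w : E) , ‖q - t • w‖ ≤ 1 / ((m : ℝ) + 1) * ‖t • w‖ →
        ‖t⁻¹ • q - w‖ ≤ 1 / ((m : ℝ) + 1) * ‖w‖ := by
      intro q w hq
      have : t⁻¹ • q - w = t⁻¹ • (q - t • w) := by
        rw [smul_sub, smul_smul, inv_mul_cancel₀ ht0.ne', one_smul]
      rw [this, norm_smul, norm_inv, Real.norm_of_nonneg ht0.le, inv_mul_le_iff₀ ht0]
      rw [norm_smul, Real.norm_of_nonneg ht0.le] at hq
      linarith
    have hscale' : ∀ (q w : E) , ‖q - A (t • w)‖ ≤ 1 / ((m : ℝ) + 1) * ‖t • w‖ →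
        ‖t⁻¹ • q - A w‖ ≤ 1 / ((m : ℝ) + 1) * ‖w‖ := by
      intro q w hq
      have : t⁻¹ • q - A w = t⁻¹ • (q - A (t • w)) := by
        rw [smul_sub, map_smul, smul_smul, inv_mul_cancel₀ ht0.ne', one_smul]
      rw [this, norm_smul, norm_inv, Real.norm_of_nonneg ht0.le, inv_mul_le_iff₀ ht0]
      rw [norm_smul, Real.norm_of_nonneg ht0.le] at hq
      linarith
    refine ⟨t⁻¹ • (T k1 - T z), t⁻¹ • (k1 - z), t⁻¹ • (T k2 - T z), t⁻¹ • (k2 - z),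
      hscale _ _ e1, hscale' _ _ f1, hscale _ _ e2, hscale' _ _ f2, ?_⟩
    rw [← smul_sub, inner_smul_left, inner_smul_right, inner_smul_left, inner_smul_right]
    simp only [conj_trivial]
    -- The cycle `z`, `k1`, `k2`: adding the three gaps eliminates `φ`. Two independent
    -- displacements are compared, which gives more than monotonicity of `A`.
    have h1 := hφ _ hk2 _ hk1
    have h2 := hφ _ hz _ hk2
    have h3 := hφ _ hk1 _ hz
    simp only [bregman] at h1 h2 h3
    have : inner ℝ (T k1 - T z) (k2 - z - (k1 - z)) ≤ inner ℝ (T k2 - T z) (k2 - z) := by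
      simp only [inner_sub_left, inner_sub_right] at *
      linarith
    gcongr
  choose a1 b1 a2 b2 hb1 ha1 hb2 ha2 hle using key
  have lim : ∀ (q : ℕ → E) (w w' : E), (∀ m : ℕ, ‖q m - w‖ ≤ 1 / ((m : ℝ) + 1) * ‖w'‖) →
      Filter.Tendsto q Filter.atTop (nhds w) := by
    intro q w w' hq
    rw [tendsto_iff_norm_sub_tendsto_zero]
    refine squeeze_zero (fun _ => norm_nonneg _) hq ?_
    simpa using tendsto_one_div_add_atTop_nhds_zero_nat.mul_const ‖w'‖
  have t1 := lim _ _ _ ha1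
  have t2 := lim _ _ _ hb1
  have t3 := lim _ _ _ ha2
  have t4 := lim _ _ _ hb2
  have := le_of_tendsto_of_tendsto' (t1.inner (𝕜 := ℝ) (t4.sub t2)) (t3.inner (𝕜 := ℝ) t4) hle
  rw [inner_sub_right] at this
  linarith

/-- If `⟪A v, v⟫ = 0`, apply the blown-up inequality to `u` with `A u = v` and to `t • v`: then `t *
‖v‖ ^ 2 ≤ ⟪A u, u⟫` for all `t`, so `v = 0`. Compactness of the sphere makes positivity uniform.
Symmetry of `A` is not needed. -/
lemma HasDenseDerivAt.exists_coercive {K : Set E} {T : E → E} {A : E →L[ℝ] E} {z : E} {φ : E → ℝ}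
    (h : HasDenseDerivAt K T A z) (hz : z ∈ K) (hφ : ∀ x ∈ K, ∀ y ∈ K, 0 ≤ bregman φ T x y)
    (hA : Function.Surjective A) :
    ∃ c : ℝ, 0 < c ∧ ∀ v, c * ‖v‖ ^ 2 ≤ inner ℝ (A v) v := by
  have hle := h.inner_le hz hφ
  have hpos : ∀ v, v ≠ 0 → 0 < inner ℝ (A v) v := by
    intro v hv
    have h0 : 0 ≤ inner ℝ (A v) v := by simpa using hle 0 v
    refine lt_of_le_of_ne h0 fun heq => hv ?_
    obtain ⟨u, hu⟩ := hA v
    have h1 : ∀ t : ℝ, t * ‖v‖ ^ 2 ≤ inner ℝ (A u) u := by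
      intro t
      have := hle u (t • v)
      rw [map_smul, inner_smul_right, inner_smul_right, inner_smul_left, ← heq, hu,
        real_inner_self_eq_norm_sq] at this
      simpa [hu] using this
    by_contra hne
    have hv2 : 0 < ‖v‖ ^ 2 := by positivity
    have := h1 ((inner ℝ (A u) u + 1) / ‖v‖ ^ 2)
    rw [div_mul_cancel₀ _ hv2.ne'] at this
    linarith
  rcases subsingleton_or_nontrivial E with hs | hs
  · exact ⟨1, one_pos, fun v => by simp [Subsingleton.elim v 0]⟩
  obtain ⟨v0, hv0, hmin⟩ := (isCompact_sphere (0 : E) 1).exists_isMinOn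
    (NormedSpace.sphere_nonempty.2 zero_le_one) (f := fun v => inner ℝ (A v) v)
    (by fun_prop)
  have hv0' : ‖v0‖ = 1 := by simpa using hv0
  refine ⟨inner ℝ (A v0) v0, hpos v0 (fun h => by simp [h] at hv0'), fun v => ?_⟩
  rcases eq_or_ne v 0 with rfl | hv
  · simp
  have hnv : 0 < ‖v‖ := norm_pos_iff.2 hv
  have := isMinOn_iff.1 hmin (‖v‖⁻¹ • v) (by simp [norm_smul, hnv.ne'])
  simp only [map_smul, inner_smul_left, inner_smul_right, conj_trivial] at this
  calc inner ℝ (A v0) v0 * ‖v‖ ^ 2 ≤ ‖v‖⁻¹ * (‖v‖⁻¹ * inner ℝ (A v) v) * ‖v‖ ^ 2 := by gcongr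
    _ = _ := by field_simp

lemma inner_ge_of_norm_sub_le {a b α β : E} {M N s t : ℝ} (ha : ‖a‖ ≤ M) (hb : ‖b‖ ≤ N)
    (hα : ‖α - a‖ ≤ s) (hβ : ‖β - b‖ ≤ t) :
    inner ℝ a b - M * t - s * (N + t) ≤ inner ℝ α β := by
  have hs : 0 ≤ s := (norm_nonneg _).trans hα
  have hM : 0 ≤ M := (norm_nonneg _).trans ha
  have e : inner ℝ α β = inner ℝ a b + inner ℝ a (β - b) + inner ℝ (α - a) β := by
    simp only [inner_sub_left, inner_sub_right]; ring
  have h1 : -(M * t) ≤ inner ℝ a (β - b) := by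
    have := (abs_le.1 (abs_real_inner_le_norm a (β - b))).1
    have : ‖a‖ * ‖β - b‖ ≤ M * t := by gcongr
    linarith
  have h2 : -(s * (N + t)) ≤ inner ℝ (α - a) β := by
    have h3 := (abs_le.1 (abs_real_inner_le_norm (α - a) β)).1
    have h4 : ‖β‖ ≤ N + t := by
      calc ‖β‖ = ‖b + (β - b)‖ := by rw [add_sub_cancel]
        _ ≤ _ := (norm_add_le _ _).trans (by gcongr)
    have : ‖α - a‖ * ‖β‖ ≤ s * (N + t) := by gcongr
    linarith
  linarith

/-- A two-step chain suffices: with `k` in `K` close to `z + r • e`, where `e` points towards `x`,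
the gap is at least `⟪T k - T z, x - k⟫`, which is close to `r * (‖x - z‖ - r) * ⟪A e, e⟫`. Small
gaps therefore force `x` near `z`. -/
lemma HasDenseDerivAt.le_bregman_of_far {K : Set E} {T : E → E} {A : E →L[ℝ] E} {z : E}
    {φ : E → ℝ} (h : HasDenseDerivAt K T A z) (hz : z ∈ K)
    (hφ : ∀ x ∈ K, ∀ y ∈ K, 0 ≤ bregman φ T x y) {c : ℝ} (hc : 0 < c)
    (hA : ∀ v, c * ‖v‖ ^ 2 ≤ inner ℝ (A v) v) {r1 : ℝ} (hr1 : 0 < r1) :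
    ∃ s : ℝ, 0 < s ∧ ∀ x ∈ K, r1 < ‖x - z‖ → s ≤ bregman φ T x z := by
  set η := min 1 (c / (4 * (2 + ‖A‖))) with hη
  have h0 : 0 < η := by positivity
  have h1 : η ≤ 1 := min_le_left _ _
  have h2 : η * (4 * (2 + ‖A‖)) ≤ c := by
    rw [← le_div_iff₀ (by positivity)]
    exact min_le_right _ _
  obtain ⟨r2, hr2, H⟩ := h η h0
  set r := min (r1 / 2) r2 with hr
  have hr0 : 0 < r := by positivity
  refine ⟨r * r * c / 2, by positivity, fun x hx hxz => ?_⟩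
  set ζ := x - z with hζ
  set N := ‖ζ‖ with hN
  have hN0 : 0 < N := hr1.trans hxz
  have hNr : 2 * r ≤ N := by
    have : r ≤ r1 / 2 := min_le_left _ _
    linarith
  set e := N⁻¹ • ζ with he
  have hne : ‖e‖ = 1 := by
    rw [he, norm_smul, norm_inv, Real.norm_of_nonneg hN0.le, ← hN, inv_mul_cancel₀ hN0.ne']
  have hζe : ζ = N • e := by rw [he, smul_smul, mul_inv_cancel₀ hN0.ne', one_smul]
  have hnr : ‖r • e‖ = r := by rw [norm_smul, hne, mul_one, Real.norm_of_nonneg hr0.le]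
  obtain ⟨k, hk, e1, e2⟩ := H (r • e) (by rw [hnr]; exact min_le_right _ _)
  rw [hnr] at e1 e2
  have hb := hφ _ hx _ hk
  have hb' := hφ _ hk _ hz
  have hsum : inner ℝ (T k - T z) (x - k) ≤ bregman φ T x z := by
    simp only [bregman, inner_sub_left, inner_sub_right] at *
    linarith
  refine le_trans ?_ hsum
  have hAe : ‖A (r • e)‖ ≤ ‖A‖ * r := (A.le_opNorm _).trans (by rw [hnr])
  have hbe : ‖(N - r) • e‖ ≤ N - r := by
    rw [norm_smul, hne, mul_one, Real.norm_of_nonneg (by linarith)]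
  have hβ : ‖(x - k) - (N - r) • e‖ ≤ η * r := by
    have : (x - k) - (N - r) • e = -(k - z - r • e) := by
      rw [sub_smul, ← hζe, hζ]; abel
    rwa [this, norm_neg]
  have := inner_ge_of_norm_sub_le hAe hbe e2 hβ
  refine le_trans ?_ this
  rw [map_smul, inner_smul_left, inner_smul_right]
  simp only [conj_trivial]
  have hQ : c ≤ inner ℝ (A e) e := by simpa [hne] using hA e
  have hQ' : r * ((N - r) * c) ≤ r * ((N - r) * inner ℝ (A e) e) := by
    have : 0 ≤ N - r := by linarith
    gcongr
  refine le_trans ?_ (sub_le_sub_right (sub_le_sub_right hQ' _) _)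
  have hA0 := norm_nonneg A
  have h3 : η * r ≤ r := by nlinarith
  have h4 : η * r * (N - r + η * r) ≤ η * r * N := by gcongr; linarith
  have h5 : ‖A‖ * r * (η * r) ≤ ‖A‖ * r * η * N := by
    have : r ≤ N := by linarith
    calc _ = ‖A‖ * r * η * r := by ring
      _ ≤ _ := by gcongr
  have h6 : r * N * (η * (2 + ‖A‖)) ≤ r * N * (c / 4) := by
    gcongr; linarith
  have h8 : 0 ≤ η * r * N := by positivity
  have h7 : r * ((N / 2) * c) ≤ r * ((N - r) * c) := by
    gcongr; linarith
  have h9 : r * (2 * r) * c ≤ r * N * c := by gcongr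
  nlinarith

/-- A Riemann sum for `∫ t ⟪A ζ, ζ⟫ dt` over `[0, 1]` along the segment from `z` to `x`, whose
interior division points are replaced by nearby points of the possibly nonconvex `K`. The factor `(1
- 1 / n) / 2` is `(0 + ... + (n - 1)) / n ^ 2`. -/
lemma HasDenseDerivAt.half_inner_le_bregman {K : Set E} {T : E → E} {A : E →L[ℝ] E} {z : E}
    {φ : E → ℝ} (h : HasDenseDerivAt K T A z) (hT : HasFDerivAt T A z) (hz : z ∈ K)
    (hφ : ∀ x ∈ K, ∀ y ∈ K, 0 ≤ bregman φ T x y) (n : ℕ) (hn : 0 < n) {η : ℝ} (hη : 0 < η)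
    (hη1 : η ≤ 1) :
    ∃ r : ℝ, 0 < r ∧ ∀ x ∈ K, ‖x - z‖ ≤ r →
      (1 - 1 / n) / 2 * inner ℝ (A (x - z)) (x - z) - n * ((2 * ‖A‖ + 3) * η) * ‖x - z‖ ^ 2 ≤
        bregman φ T x z := by
  obtain ⟨r1, hr1, H1⟩ := h η hη
  obtain ⟨r2, hr2, H2⟩ := hT.exists_norm_le hη
  refine ⟨min r1 r2, by positivity, fun x hx hxz => ?_⟩
  have hx1 := hxz.trans (min_le_left _ _)
  have hx2 := hxz.trans (min_le_right _ _)
  set ζ := x - z with hζ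
  have hn' : (0 : ℝ) < n := by exact_mod_cast hn
  have hfrac : ∀ i : ℕ, i ≤ n → (i : ℝ) / n ≤ 1 := fun i hi => by
    rw [div_le_one hn']; exact_mod_cast hi
  have hsm : ∀ i : ℕ, i ≤ n → ‖((i : ℝ) / n) • ζ‖ ≤ ‖ζ‖ := fun i hi => by
    rw [norm_smul, Real.norm_of_nonneg (by positivity)]
    exact mul_le_of_le_one_left (norm_nonneg _) (hfrac i hi)
  have hw : ∀ i : ℕ, ∃ w ∈ K, (i = 0 → w = z) ∧ (i = n → w = x) ∧ (i ≤ n →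
      ‖w - z - ((i : ℝ) / n) • ζ‖ ≤ η * ‖ζ‖ ∧
      ‖T w - T z - A (((i : ℝ) / n) • ζ)‖ ≤ η * ‖ζ‖) := by
    intro i
    rcases Nat.eq_zero_or_pos i with rfl | hi
    · refine ⟨z, hz, fun _ => rfl, fun h => by omega, fun _ => ?_⟩
      simp only [sub_self, Nat.cast_zero, zero_div, zero_smul, map_zero, norm_zero]
      exact ⟨by positivity, by positivity⟩
    rcases eq_or_ne i n with rfl | hin
    · refine ⟨x, hx, fun h => by omega, fun _ => rfl, fun _ => ?_⟩
      rw [div_self hn'.ne', one_smul]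
      refine ⟨by simp [hζ]; positivity, H2 x hx2⟩
    rcases lt_or_ge n i with hlt | hle
    · exact ⟨z, hz, fun h => by omega, fun h => by omega, fun h => by omega⟩
    · obtain ⟨k, hk, e1, e2⟩ := H1 (((i : ℝ) / n) • ζ) ((hsm i hle).trans hx1)
      have := hsm i hle
      refine ⟨k, hk, fun h => by omega, fun h => by omega, fun _ => ⟨e1.trans ?_, e2.trans ?_⟩⟩ <;>
        gcongr
  choose w hwK hw0 hwn hwc using hw
  have hchain := sum_inner_le_bregman hφ n w hwK
  rw [hwn n rfl, hw0 0 rfl] at hchain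
  refine le_trans ?_ hchain
  have hterm : ∀ i ∈ Finset.range n,
      (i : ℝ) * (inner ℝ (A ζ) ζ / n ^ 2) - (2 * ‖A‖ + 3) * η * ‖ζ‖ ^ 2 ≤
        inner ℝ (T (w i) - T z) (w (i + 1) - w i) := by
    intro i hi
    have hi' := Finset.mem_range.1 hi
    obtain ⟨p1, p2⟩ := hwc i hi'.le
    obtain ⟨p3, -⟩ := hwc (i + 1) hi'
    have hAi : ‖A (((i : ℝ) / n) • ζ)‖ ≤ ‖A‖ * ‖ζ‖ :=
      (A.le_opNorm _).trans (by gcongr; exact hsm i hi'.le)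
    have hb : ‖((1 : ℝ) / n) • ζ‖ ≤ ‖ζ‖ := by simpa using hsm 1 hn
    have hβ : ‖(w (i + 1) - w i) - ((1 : ℝ) / n) • ζ‖ ≤ 2 * η * ‖ζ‖ := by
      have : (w (i + 1) - w i) - ((1 : ℝ) / n) • ζ =
          (w (i + 1) - z - (((i + 1 : ℕ) : ℝ) / n) • ζ) - (w i - z - ((i : ℝ) / n) • ζ) := by
        push_cast
        rw [add_div, add_smul]; abel
      rw [this]
      refine (norm_sub_le _ _).trans ?_
      linarith
    refine le_trans ?_ (inner_ge_of_norm_sub_le hAi hb p2 hβ)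
    rw [map_smul, inner_smul_left, inner_smul_right]
    simp only [conj_trivial]
    have e : (i : ℝ) / n * (1 / n * inner ℝ (A ζ) ζ) = (i : ℝ) * (inner ℝ (A ζ) ζ / n ^ 2) := by
      field_simp
    rw [e]
    have : η * ‖ζ‖ * (‖ζ‖ + 2 * η * ‖ζ‖) ≤ η * ‖ζ‖ * (‖ζ‖ + 2 * 1 * ‖ζ‖) := by gcongr
    nlinarith
  refine le_trans ?_ (Finset.sum_le_sum hterm)
  rw [Finset.sum_sub_distrib, ← Finset.sum_mul, ← Nat.cast_sum]
  have hs : ((∑ i ∈ Finset.range n, i : ℕ) : ℝ) = n * (n - 1) / 2 := by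
    have := Finset.sum_range_id_mul_two n
    have h2 : ((∑ i ∈ Finset.range n, i : ℕ) : ℝ) * 2 = n * (n - 1) := by
      rw [← Nat.cast_pred hn]; exact_mod_cast this
    linarith
  rw [hs]
  simp only [Finset.sum_const, Finset.card_range, nsmul_eq_mul]
  apply le_of_eq
  field_simp

/-- The two gaps add up to `⟪x - z, T x - T z⟫`, which is nearly `⟪A (x - z), x - z⟫`, and one of
them is at least nearly half of this. The other is then at most nearly half. Coercivity lets errors
in `‖x - z‖ ^ 2` be absorbed. -/
lemma HasDenseDerivAt.bregman_swap_le_of_near {K : Set E} {T : E → E} {A : E →L[ℝ] E} {z : E}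
    {φ : E → ℝ} (h : HasDenseDerivAt K T A z) (hT : HasFDerivAt T A z) (hz : z ∈ K)
    (hφ : ∀ x ∈ K, ∀ y ∈ K, 0 ≤ bregman φ T x y) {c : ℝ} (hc : 0 < c)
    (hA : ∀ v, c * ‖v‖ ^ 2 ≤ inner ℝ (A v) v) {η : ℝ} (hη : 0 < η) (hη1 : η ≤ 1) :
    ∃ r : ℝ, 0 < r ∧ ∀ x ∈ K, ‖x - z‖ ≤ r →
      bregman φ T z x ≤ (1 + η) * bregman φ T x z := by
  obtain ⟨n, hn⟩ := exists_nat_gt (8 / η)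
  have hn0 : (0 : ℝ) < n := lt_trans (by positivity) hn
  have hn1 : 0 < n := by exact_mod_cast hn0
  have hnη : 1 / (n : ℝ) ≤ η / 8 := by
    rw [div_lt_iff₀ hη] at hn
    rw [div_le_iff₀ hn0]
    linarith
  set C := n * (2 * ‖A‖ + 3) with hC
  have hC0 : 0 < C := by positivity
  set θ := min 1 (η * c / (4 * (3 * C + 1))) with hθ
  have hθ0 : 0 < θ := by positivity
  have hθ1 : θ ≤ 1 := min_le_left _ _
  have hθ2 : θ * (4 * (3 * C + 1)) ≤ η * c := by
    rw [← le_div_iff₀ (by positivity)]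
    exact min_le_right _ _
  obtain ⟨r1, hr1, H1⟩ := h.half_inner_le_bregman hT hz hφ n hn1 hθ0 hθ1
  obtain ⟨r2, hr2, H2⟩ := hT.exists_norm_le hθ0
  refine ⟨min r1 r2, by positivity, fun x hx hxz => ?_⟩
  have B := H1 x hx (hxz.trans (min_le_left _ _))
  have B2 := H2 x (hxz.trans (min_le_right _ _))
  have hQ := hA (x - z)
  set Q := inner ℝ (A (x - z)) (x - z) with hQd
  set N := ‖x - z‖ ^ 2 with hN
  have hN0 : 0 ≤ N := sq_nonneg _
  have hsum := bregman_add_swap φ T x z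
  have hup : inner ℝ (x - z) (T x - T z) ≤ Q + θ * N := by
    have e : inner ℝ (x - z) (T x - T z) = Q + inner ℝ (x - z) (T x - T z - A (x - z)) := by
      rw [inner_sub_right (x - z) (T x - T z), hQd, real_inner_comm (x - z) (A (x - z))]
      ring
    rw [e]
    gcongr
    calc _ ≤ ‖x - z‖ * ‖T x - T z - A (x - z)‖ := real_inner_le_norm _ _
      _ ≤ ‖x - z‖ * (θ * ‖x - z‖) := by gcongr
      _ = _ := by rw [hN]; ring
  have hB' : (1 - η / 8) / 2 * Q - C * θ * N ≤ bregman φ T x z := by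
    refine le_trans ?_ B
    have hQ0 : 0 ≤ Q := le_trans (by positivity) hQ
    have h3 : (1 - η / 8) / 2 * Q ≤ (1 - 1 / (n : ℝ)) / 2 * Q := by gcongr
    have h4 : C * θ * N = n * ((2 * ‖A‖ + 3) * θ) * N := by rw [hC]; ring
    linarith
  have h5 : (2 + η) * ((1 - η / 8) / 2 * Q - C * θ * N) ≤ (2 + η) * bregman φ T x z := by gcongr
  have h6 : Q + θ * N ≤ (2 + η) * ((1 - η / 8) / 2 * Q - C * θ * N) := by
    have hQ0 : 0 ≤ Q := le_trans (by positivity) hQ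
    have h7 : θ * (4 * (3 * C + 1)) * N ≤ η * c * N := by gcongr
    have h8 : η * (c * N) ≤ η * Q := by gcongr
    have h9 : η * (C * θ * N) ≤ 1 * (C * θ * N) := by gcongr
    have h10 : η * η * Q ≤ 1 * η * Q := by gcongr
    nlinarith
  linarith

/-- Near a.e. point the Bregman gap is almost symmetric. -/
lemma exists_bregman_swap_le {K : Set E} {T : E → E} {A : E →L[ℝ] E} {z : E}
    {φ : E → ℝ} (hK : IsDenselyAccessible K z) (hT : HasFDerivAt T A z)
    (hA : Function.Surjective A) (hz : z ∈ K)
    (hφ : ∀ x ∈ K, ∀ y ∈ K, 0 ≤ bregman φ T x y) {η : ℝ} (hη : 0 < η) :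
    ∃ s : ℝ, 0 < s ∧ ∀ x ∈ K, bregman φ T x z < s →
      bregman φ T z x ≤ (1 + η) * bregman φ T x z := by
  have h := hT.hasDenseDerivAt hK
  obtain ⟨c, hc, hcA⟩ := h.exists_coercive hz hφ hA
  obtain ⟨r, hr, H⟩ := h.bregman_swap_le_of_near hT hz hφ hc hcA (η := min η 1)
    (by positivity) (min_le_right _ _)
  obtain ⟨s, hs, H2⟩ := h.le_bregman_of_far hz hφ hc hcA hr
  refine ⟨s, hs, fun x hx hlt => ?_⟩
  have hn : ‖x - z‖ ≤ r := by
    by_contra hcon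
    exact absurd (H2 x hx (not_le.1 hcon)) (not_le.2 hlt)
  refine (H x hx hn).trans ?_
  have := hφ x hx z hz
  gcongr
  exact min_le_left _ _

/-- This holds at Lebesgue density points: a ball of radius `θ * ‖u‖` around `z + u` missed by `K`
takes the fraction `(θ / 2) ^ d` out of the ball of radius `2 * ‖u‖` around `z`. -/
lemma ae_isDenselyAccessible {K : Set E} :
    ∀ᵐ z ∂(volume.restrict K), z ∈ K → IsDenselyAccessible K z := by
  filter_upwards [Besicovitch.ae_tendsto_measure_inter_div (volume : Measure E) K] with z hz hzK
  intro η hη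
  by_contra hcon
  push Not at hcon
  set θ := min η 1 with hθ
  have hθ0 : 0 < θ := by positivity
  set q : ℝ := 1 - (θ / 2) ^ d with hq
  have hq1 : q < 1 := by have : 0 < (θ / 2) ^ d := by positivity
                         linarith
  have hq0 : 0 ≤ q := by
    have : (θ / 2) ^ d ≤ 1 := pow_le_one₀ (by positivity) (by linarith [min_le_right η 1])
    linarith
  have hev : ∀ᶠ r in nhdsWithin (0 : ℝ) (Set.Ioi 0), ENNReal.ofReal q <
      volume (K ∩ Metric.closedBall z r) / volume (Metric.closedBall z r) := by
    refine hz.eventually_const_lt ?_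
    rw [← ENNReal.ofReal_one]
    exact (ENNReal.ofReal_lt_ofReal_iff one_pos).2 hq1
  obtain ⟨r0, hr0, hlt⟩ := (mem_nhdsGT_iff_exists_Ioo_subset).1 hev
  have hr0' : 0 < r0 := hr0
  obtain ⟨u, hu, hno⟩ := hcon (r0 / 4) (by positivity)
  have hu0 : 0 < ‖u‖ := by
    rw [norm_pos_iff]
    rintro rfl
    have := hno z hzK
    simp at this
  set ρ := ‖u‖ with hρ
  have h2 := hlt (show 2 * ρ ∈ Set.Ioo 0 r0 from ⟨by positivity, by linarith⟩)
  simp only [Set.mem_ofPred_eq] at h2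
  have hdisj : Disjoint (K ∩ Metric.closedBall z (2 * ρ)) (Metric.ball (z + u) (θ * ρ)) := by
    rw [Set.disjoint_left]
    rintro k ⟨hk, -⟩ hkb
    have h3 := hno k hk
    rw [Metric.mem_ball, dist_eq_norm, ← sub_sub] at hkb
    have : θ * ρ ≤ η * ρ := by gcongr; exact min_le_left _ _
    linarith
  have hsub : (K ∩ Metric.closedBall z (2 * ρ)) ∪ Metric.ball (z + u) (θ * ρ) ⊆
      Metric.closedBall z (2 * ρ) := by
    refine Set.union_subset Set.inter_subset_right fun k hk => ?_
    rw [Metric.mem_ball, dist_eq_norm] at hk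
    rw [Metric.mem_closedBall, dist_eq_norm]
    have h4 : ‖k - z‖ ≤ ‖k - (z + u)‖ + ρ := by
      calc ‖k - z‖ = ‖(k - (z + u)) + u‖ := by congr 1; abel
        _ ≤ _ := norm_add_le _ _
    have : θ * ρ ≤ 1 * ρ := by gcongr; exact min_le_right _ _
    linarith
  have hmeas := measure_mono (μ := (volume : Measure E)) hsub
  rw [measure_union hdisj measurableSet_ball,
    Measure.addHaar_ball_of_pos _ _ (by positivity)] at hmeas
  have hcb : volume (Metric.closedBall z (2 * ρ)) =
      ENNReal.ofReal ((2 * ρ) ^ d) * volume (Metric.ball (0 : E) 1) := by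
    rw [Measure.addHaar_closedBall _ _ (by positivity)]
    simp
  rw [ENNReal.lt_div_iff_mul_lt (Or.inl (by
      rw [hcb]; exact mul_ne_zero (by simpa using by positivity)
        (Metric.measure_ball_pos _ _ one_pos).ne')) (Or.inl (measure_closedBall_lt_top).ne)] at h2
  have h5 : ENNReal.ofReal q * volume (Metric.closedBall z (2 * ρ)) +
      ENNReal.ofReal ((θ * ρ) ^ d) * volume (Metric.ball (0 : E) 1) <
      volume (Metric.closedBall z (2 * ρ)) := by
    refine lt_of_lt_of_le (ENNReal.add_lt_add_right ?_ h2) ?_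
    · exact ENNReal.mul_ne_top ENNReal.ofReal_ne_top measure_ball_lt_top.ne
    · simpa using hmeas
  rw [hcb, ← mul_assoc, ← ENNReal.ofReal_mul hq0, ← add_mul, ← ENNReal.ofReal_add (by positivity)
    (by positivity)] at h5
  have : q * (2 * ρ) ^ d + (θ * ρ) ^ d = (2 * ρ) ^ d := by
    rw [hq, sub_mul, ← mul_pow, show θ / 2 * (2 * ρ) = θ * ρ by ring]
    ring
  rw [this] at h5
  exact lt_irrefl _ h5

/-- Outside a set of small mass, the Bregman gap of a Lipschitz optimal map is almost symmetric
wherever it is small. -/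
lemma IsOTMinimiser.exists_almost_symmetric {l mu : Measure E} [IsProbabilityMeasure l]
    (hl : l ≪ volume) (hmu : mu ≪ volume) {L : ℝ≥0} {T : E → E}
    (hT : LipschitzWith L T) (hopt : IsOTMinimiser l mu (l.map (fun x => (x, T x))))
    {φ : E → ℝ} (hφc : Continuous φ)
    (hφ : ∀ x ∈ l.support, ∀ z ∈ l.support, 0 ≤ bregman φ T x z)
    {η : ℝ} (hη : 0 < η) {θ : ℝ≥0∞} (hθ : 0 < θ) :
    ∃ s : ℝ, 0 < s ∧ ∃ U : Set E, MeasurableSet U ∧ l Uᶜ < θ ∧ ∀ z ∈ U, ∀ x ∈ l.support,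
      bregman φ T x z < s → bregman φ T z x ≤ (1 + η) * bregman φ T x z := by
  set K := l.support with hKdef
  have hKc : IsClosed K := Measure.isClosed_support
  have hmap : mu = l.map T := by
    rw [← hopt.1.2, Measure.snd_map_prodMk measurable_id']
  have h1 : ∀ᵐ z ∂l, DifferentiableAt ℝ T z := hl.ae_le hT.ae_differentiableAt
  have h2 : ∀ᵐ z ∂l, z ∈ K := Measure.support_mem_ae
  have h3 : ∀ᵐ z ∂l, z ∈ K → IsDenselyAccessible K z := by
    have h := ae_isDenselyAccessible (K := K)
    rw [ae_restrict_iff' hKc.measurableSet] at h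
    filter_upwards [hl.ae_le h] with z hz hzK using hz hzK hzK
  -- The image of the points with singular derivative is Lebesgue null, hence `mu`-null, and `mu` is
  -- the image of `l`.
  have h4 : ∀ᵐ z ∂l, ¬ (DifferentiableAt ℝ T z ∧ (fderiv ℝ T z).det = 0) := by
    set N := {z | DifferentiableAt ℝ T z ∧ (fderiv ℝ T z).det = 0} with hN
    have hv : volume (T '' N) = 0 := addHaar_image_eq_zero_of_det_fderivWithin_eq_zero _
      (fun z hz => hz.1.hasFDerivAt.hasFDerivWithinAt) fun z hz => hz.2
    have h5 := hmu hv
    rw [hmap] at h5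
    have h6 := Measure.preimage_null_of_map_null hT.continuous.measurable.aemeasurable h5
    filter_upwards [compl_mem_ae_iff.2 h6] with z hz hzN
    exact hz ⟨z, hzN, rfl⟩
  have hgood : ∀ᵐ z ∂l, ∃ s : ℝ, 0 < s ∧ ∀ x ∈ K, bregman φ T x z < s →
      bregman φ T z x ≤ (1 + η) * bregman φ T x z := by
    filter_upwards [h1, h2, h3, h4] with z z1 z2 z3 z4
    have hdet : (fderiv ℝ T z).det ≠ 0 := fun h => z4 ⟨z1, h⟩
    refine exists_bregman_swap_le (z3 z2) z1.hasFDerivAt ?_ z2 hφ hη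
    have : (fderiv ℝ T z : E →ₗ[ℝ] E).det ≠ 0 := hdet
    have hu := LinearMap.isUnit_iff_isUnit_det _ |>.2 (isUnit_iff_ne_zero.2 this)
    exact ((Module.End.isUnit_iff _).1 hu).2
  -- The threshold `s` depends on `z`. These closed sets, where `1 / (k + 1)` works, increase to a
  -- set of full measure, so one of them leaves out little mass.
  set U : ℕ → Set E := fun k => ⋂ x ∈ K, {z | 1 / ((k : ℝ) + 1) ≤ bregman φ T x z} ∪
    {z | bregman φ T z x ≤ (1 + η) * bregman φ T x z} with hU
  have hTc := hT.continuous
  have hUc : ∀ k, IsClosed (U k) := fun k => isClosed_biInter fun x _ => by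
    have c1 : Continuous fun z => bregman φ T x z := by unfold bregman; fun_prop
    have c2 : Continuous fun z => bregman φ T z x := by unfold bregman; fun_prop
    exact (isClosed_le continuous_const c1).union (isClosed_le c2 (c1.const_mul _))
  have hUm : Monotone U := by
    intro k m hkm z hz
    simp only [hU, Set.mem_iInter] at hz ⊢
    intro x hx
    rcases hz x hx with h | h
    · refine Or.inl (le_trans ?_ (show 1 / ((k : ℝ) + 1) ≤ bregman φ T x z from h))
      exact one_div_le_one_div_of_le (by positivity) (by gcongr)
    · exact Or.inr h
  have hlim : Filter.Tendsto (fun k => l (U k)ᶜ) Filter.atTop (nhds (l (⋂ k, (U k)ᶜ))) :=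
    tendsto_measure_iInter_atTop (fun k => (hUc k).measurableSet.compl.nullMeasurableSet)
      (fun k m hkm => Set.compl_subset_compl.2 (hUm hkm)) ⟨0, measure_ne_top _ _⟩
  have hz0 : l (⋂ k, (U k)ᶜ) = 0 := by
    refine measure_mono_null ?_ hgood
    intro z hz
    simp only [Set.mem_iInter, Set.mem_compl_iff] at hz ⊢
    rintro ⟨s, hs, h⟩
    obtain ⟨k, hk⟩ := exists_nat_one_div_lt hs
    refine hz k ?_
    simp only [hU, Set.mem_iInter]
    intro x hx
    rcases lt_or_ge (bregman φ T x z) s with hlt | hge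
    · exact Or.inr (h x hx hlt)
    · exact Or.inl (hk.le.trans hge)
  rw [hz0] at hlim
  obtain ⟨k, hk⟩ := (hlim.eventually_lt_const hθ).exists
  refine ⟨1 / ((k : ℝ) + 1), by positivity, U k, (hUc k).measurableSet, hk, fun z hz x hx hlt => ?_⟩
  simp only [hU, Set.mem_iInter] at hz
  rcases hz x hx with h | h
  · exact absurd h (not_le.2 hlt)
  · exact h

end AlmostSymmetry

/-! ### From regularised couplings to minimal kernels on the source space. -/

section Lift

variable {d : ℕ}

local notation "E" => EuclideanSpace ℝ (Fin d)

lemma regularisedCost_polyReg_eq {p ε : ℝ} (hp : 1 < p) {lam mu : Measure E}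
    [IsProbabilityMeasure lam] [IsProbabilityMeasure mu] {π : Measure (E × E)} [IsFiniteMeasure π]
    (hac : π ≪ lam.prod mu)
    (hS : ∫⁻ q, (π.rnDeriv (lam.prod mu) q) ^ p ∂(lam.prod mu) ≠ ∞) (ht : transportCost π ≠ ∞) :
    regularisedCost (polyReg p) ε lam mu π =
      (((transportCost π).toReal + ε ^ 2 / (p - 1) *
        ((∫⁻ q, (π.rnDeriv (lam.prod mu) q) ^ p ∂(lam.prod mu)).toReal - 1) : ℝ) : EReal) := by
  have hp0 : 0 < p := by linarith
  have hp1 : p - 1 ≠ 0 := by linarith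
  have hm : Measurable fun q => (π.rnDeriv (lam.prod mu) q) ^ p :=
    (Measure.measurable_rnDeriv _ _).pow_const p
  have hint := integrable_toReal_of_lintegral_ne_top hm.aemeasurable hS
  have hfun : (fun q => polyReg p (π.rnDeriv (lam.prod mu) q).toReal) =
      fun q => (((π.rnDeriv (lam.prod mu) q) ^ p).toReal - 1) / (p - 1) := by
    funext q
    rw [polyReg, abs_of_nonneg ENNReal.toReal_nonneg, ENNReal.toReal_rpow]
  have hI : Integrable (fun q => polyReg p (π.rnDeriv (lam.prod mu) q).toReal) (lam.prod mu) := by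
    rw [hfun]
    exact (hint.sub (integrable_const 1)).div_const _
  rw [regularisedCost, if_pos ⟨hac, hI⟩, hfun, integral_div, integral_sub hint (integrable_const 1),
    integral_toReal hm.aemeasurable (ae_lt_top hm hS)]
  have e : (transportCost π : EReal) = (((transportCost π).toReal : ℝ) : EReal) := by
    conv_lhs => rw [← ENNReal.ofReal_toReal ht]
    rw [EReal.coe_ennreal_ofReal, max_eq_left ENNReal.toReal_nonneg]
  rw [e, ← EReal.coe_add]
  congr 2
  simp only [integral_const, probReal_univ, smul_eq_mul, mul_one]
  field_simp

lemma ne_top_of_regularisedCost_ne_top {p ε : ℝ} (hp : 1 < p) {lam mu : Measure E}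
    [IsProbabilityMeasure lam] [IsProbabilityMeasure mu] {π : Measure (E × E)} [IsFiniteMeasure π]
    (h : regularisedCost (polyReg p) ε lam mu π ≠ ⊤) :
    π ≪ lam.prod mu ∧ ∫⁻ q, (π.rnDeriv (lam.prod mu) q) ^ p ∂(lam.prod mu) ≠ ∞ ∧
      transportCost π ≠ ∞ := by
  have hp0 : 0 < p := by linarith
  have hp1 : p - 1 ≠ 0 := by linarith
  have hcond : π ≪ lam.prod mu ∧
      Integrable (fun q => polyReg p (π.rnDeriv (lam.prod mu) q).toReal) (lam.prod mu) := by
    by_contra hcon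
    exact h (if_neg hcon)
  refine ⟨hcond.1, ?_, ?_⟩
  · have hfun : (fun q => ((π.rnDeriv (lam.prod mu) q) ^ p).toReal) =
        fun q => (p - 1) * polyReg p (π.rnDeriv (lam.prod mu) q).toReal + 1 := by
      funext q
      rw [polyReg, abs_of_nonneg ENNReal.toReal_nonneg, ENNReal.toReal_rpow]
      field_simp
      ring
    have hI : Integrable (fun q => ((π.rnDeriv (lam.prod mu) q) ^ p).toReal) (lam.prod mu) := by
      rw [hfun]
      exact (hcond.2.const_mul _).add (integrable_const 1)
    have h2 := hI.lintegral_lt_top.ne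
    refine ne_of_eq_of_ne (lintegral_congr_ae ?_) h2
    filter_upwards [Measure.rnDeriv_ne_top π (lam.prod mu)] with q hq
    rw [ENNReal.ofReal_toReal (ENNReal.rpow_ne_top_of_nonneg hp0.le hq)]
  · intro ht
    apply h
    rw [regularisedCost, if_pos hcond, ht, EReal.coe_ennreal_top, EReal.top_add_coe]

/-- The product coupling has finite cost by compactness, so the minimal value is finite. The
constant `-1` in `polyReg` then cancels from both sides, and minimality can be stated with values in
`[0, ∞]`. -/
lemma IsROTMinimiser.energy_le {p ε : ℝ} (hp : 1 < p) (hε : 0 < ε) {lam mu : Measure E}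
    [IsProbabilityMeasure lam] [IsProbabilityMeasure mu] (hlam : IsCompact lam.support)
    (hmu : IsCompact mu.support) {π : Measure (E × E)}
    (h : IsROTMinimiser (polyReg p) ε lam mu π) :
    π ≪ lam.prod mu ∧ ∫⁻ q, (π.rnDeriv (lam.prod mu) q) ^ p ∂(lam.prod mu) ≠ ∞ ∧
      transportCost π ≠ ∞ ∧ ∀ π' ∈ couplings lam mu, π' ≪ lam.prod mu →
      transportCost π + ENNReal.ofReal (ε ^ 2 / (p - 1)) *
        ∫⁻ q, (π.rnDeriv (lam.prod mu) q) ^ p ∂(lam.prod mu) ≤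
      transportCost π' + ENNReal.ofReal (ε ^ 2 / (p - 1)) *
        ∫⁻ q, (π'.rnDeriv (lam.prod mu) q) ^ p ∂(lam.prod mu) := by
  have hp0 : 0 < p - 1 := by linarith
  have hfinm : ∀ π' ∈ couplings lam mu, IsFiniteMeasure π' := fun π' hπ' => ⟨by
    have : π'.fst Set.univ = 1 := by rw [hπ'.1]; simp
    rw [Measure.fst_univ] at this
    simp [this]⟩
  have := hfinm π h.1
  have hmin := isMinOn_iff.1 h.2
  have hPt : transportCost (lam.prod mu) ≠ ∞ := by
    obtain ⟨M, hM⟩ := (hlam.prod hmu).exists_bound_of_continuousOn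
      (f := fun q : E × E => ‖q.1 - q.2‖ ^ 2) (by fun_prop)
    rw [transportCost, lintegral_prod _ (by fun_prop)]
    refine ne_top_of_le_ne_top (b := ∫⁻ _, ∫⁻ _, ENNReal.ofReal M ∂mu ∂lam) (by simp) ?_
    refine lintegral_mono_ae ?_
    filter_upwards [Measure.support_mem_ae (μ := lam)] with x hx
    refine lintegral_mono_ae ?_
    filter_upwards [Measure.support_mem_ae (μ := mu)] with y hy
    exact ENNReal.ofReal_le_ofReal ((le_abs_self _).trans (hM (x, y) ⟨hx, hy⟩))
  have hPS : ∫⁻ q, ((lam.prod mu).rnDeriv (lam.prod mu) q) ^ p ∂(lam.prod mu) ≠ ∞ := by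
    have : ∫⁻ q, ((lam.prod mu).rnDeriv (lam.prod mu) q) ^ p ∂(lam.prod mu) =
        ∫⁻ _, 1 ∂(lam.prod mu) := by
      refine lintegral_congr_ae ?_
      filter_upwards [Measure.rnDeriv_self (lam.prod mu)] with q hq
      rw [hq, ENNReal.one_rpow]
    rw [this]
    simp
  have hne : regularisedCost (polyReg p) ε lam mu π ≠ ⊤ := by
    have h1 := hmin (lam.prod mu) ⟨Measure.fst_prod, Measure.snd_prod⟩
    rw [regularisedCost_polyReg_eq hp Measure.AbsolutelyContinuous.rfl hPS hPt] at h1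
    exact ne_top_of_le_ne_top (EReal.coe_ne_top _) h1
  obtain ⟨hac, hS, ht⟩ := ne_top_of_regularisedCost_ne_top hp hne
  refine ⟨hac, hS, ht, fun π' hπ' hac' => ?_⟩
  have := hfinm π' hπ'
  rcases eq_or_ne (transportCost π') ∞ with ht' | ht'
  · simp [ht']
  have ha0 : 0 < ε ^ 2 / (p - 1) := by positivity
  rcases eq_or_ne (∫⁻ q, (π'.rnDeriv (lam.prod mu) q) ^ p ∂(lam.prod mu)) ∞ with hS' | hS'
  · rw [hS', ENNReal.mul_top (by simpa using ha0)]
    simp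
  have h1 := hmin π' hπ'
  rw [regularisedCost_polyReg_eq hp hac hS ht, regularisedCost_polyReg_eq hp hac' hS' ht',
    EReal.coe_le_coe_iff] at h1
  rw [← ENNReal.ofReal_toReal hS, ← ENNReal.ofReal_toReal hS', ← ENNReal.ofReal_toReal ht,
    ← ENNReal.ofReal_toReal ht', ← ENNReal.ofReal_mul ha0.le, ← ENNReal.ofReal_mul ha0.le,
    ← ENNReal.ofReal_add ENNReal.toReal_nonneg (by positivity),
    ← ENNReal.ofReal_add ENNReal.toReal_nonneg (by positivity)]
  refine ENNReal.ofReal_le_ofReal ?_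
  linarith

/-- Pushing forward does not increase the `L^p` norm of the density. -/
lemma lintegral_rnDeriv_map_rpow_le {X Y : Type*} [MeasurableSpace X] [MeasurableSpace Y]
    {m : Measure X} [IsFiniteMeasure m] {F : X → Y} (hF : Measurable F) {σ : X → ℝ≥0∞}
    (hσ : Measurable σ) [IsFiniteMeasure (m.withDensity σ)] {p : ℝ} (hp : 1 < p) :
    ∫⁻ y, (((m.withDensity σ).map F).rnDeriv (m.map F) y) ^ p ∂(m.map F) ≤ ∫⁻ x, σ x ^ p ∂m := by
  set ρ := ((m.withDensity σ).map F).rnDeriv (m.map F) with hρ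
  have hρm : Measurable ρ := Measure.measurable_rnDeriv _ _
  have hac : (m.withDensity σ).map F ≪ m.map F := (withDensity_absolutelyContinuous m σ).map hF
  have hp0 : 0 < p := by linarith
  set q := p / (p - 1) with hq
  have hpq : p.HolderConjugate q := Real.HolderConjugate.conjExponent hp
  -- Testing with `ρ ^ (p - 1)` and Young's inequality give `I ≤ (∫ σ ^ p) / p + I / q`. Truncation
  -- at `n` makes `I` finite, so it can be absorbed.
  have hbd : ∀ n : ℕ, ∫⁻ y, (min (ρ y) n) ^ p ∂(m.map F) ≤ ∫⁻ x, σ x ^ p ∂m := by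
    intro n
    set I := ∫⁻ y, (min (ρ y) n) ^ p ∂(m.map F) with hI
    have hIfin : I ≠ ∞ := by
      refine ne_top_of_le_ne_top (b := ∫⁻ _, (n : ℝ≥0∞) ^ p ∂(m.map F)) ?_ ?_
      · rw [lintegral_const]
        exact ENNReal.mul_ne_top (ENNReal.rpow_ne_top_of_nonneg hp0.le (by simp))
          (measure_ne_top _ _)
      · exact lintegral_mono fun y => ENNReal.rpow_le_rpow (min_le_right _ _) hp0.le
    have hg : Measurable fun y => (min (ρ y) n) ^ (p - 1) :=
      (hρm.min measurable_const).pow_const _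
    have h1 : I ≤ ∫⁻ x, σ x * (min (ρ (F x)) n) ^ (p - 1) ∂m := by
      calc I ≤ ∫⁻ y, ρ y * (min (ρ y) n) ^ (p - 1) ∂(m.map F) := by
            refine lintegral_mono fun y => ?_
            rcases eq_or_ne (min (ρ y) n) 0 with h0 | h0
            · simp [h0, hp0]
            calc (min (ρ y) n) ^ p = (min (ρ y) n) ^ (1 + (p - 1)) := by congr 1; ring
              _ = min (ρ y) n * (min (ρ y) n) ^ (p - 1) := by
                rw [ENNReal.rpow_add_of_nonneg _ _ zero_le_one (by linarith), ENNReal.rpow_one]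
              _ ≤ _ := by gcongr; exact min_le_left _ _
        _ = ∫⁻ y, (min (ρ y) n) ^ (p - 1) ∂((m.map F).withDensity ρ) := by
            rw [lintegral_withDensity_eq_lintegral_mul _ hρm hg]
            rfl
        _ = ∫⁻ x, (min (ρ (F x)) n) ^ (p - 1) ∂(m.withDensity σ) := by
            rw [Measure.withDensity_rnDeriv_eq _ _ hac, lintegral_map hg hF]
        _ = _ := by
            exact lintegral_withDensity_eq_lintegral_mul _ hσ (hg.comp hF)
    have h2 : ∫⁻ x, σ x * (min (ρ (F x)) n) ^ (p - 1) ∂m ≤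
        (∫⁻ x, σ x ^ p ∂m) / ENNReal.ofReal p + I / ENNReal.ofReal q := by
      calc _ ≤ ∫⁻ x, (σ x ^ p / ENNReal.ofReal p +
              (min (ρ (F x)) n) ^ p / ENNReal.ofReal q) ∂m := by
            refine lintegral_mono fun x => (ENNReal.young_inequality _ _ hpq).trans_eq ?_
            rw [← ENNReal.rpow_mul, hq, mul_div_cancel₀ _ (by linarith)]
        _ = _ := by
            simp only [div_eq_mul_inv]
            rw [lintegral_add_left (by fun_prop), lintegral_mul_const _ (by fun_prop),
              lintegral_mul_const _ (by fun_prop), hI,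
              lintegral_map (by fun_prop) hF]
    have h3 : I / ENNReal.ofReal p + I / ENNReal.ofReal q = I := by
      rw [div_eq_mul_inv, div_eq_mul_inv, ← mul_add, ← ENNReal.ofReal_inv_of_pos hpq.pos,
        ← ENNReal.ofReal_inv_of_pos hpq.symm.pos, ← ENNReal.ofReal_add hpq.inv_nonneg
        hpq.symm.inv_nonneg, hpq.inv_add_inv_eq_one]
      simp
    have h4 := h1.trans h2
    nth_rewrite 1 [← h3] at h4
    have hq0 : ENNReal.ofReal q ≠ 0 := by simpa using hpq.symm.pos
    have hpp0 : ENNReal.ofReal p ≠ 0 := by simpa using hpq.pos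
    have h5 := (ENNReal.add_le_add_iff_right (ENNReal.div_ne_top hIfin hq0)).1 h4
    rwa [ENNReal.div_le_iff hpp0 ENNReal.ofReal_ne_top,
      ENNReal.div_mul_cancel hpp0 ENNReal.ofReal_ne_top] at h5
  have hlim : ∀ y, Filter.Tendsto (fun n : ℕ => (min (ρ y) n) ^ p) Filter.atTop
      (nhds (ρ y ^ p)) := by
    intro y
    refine (ENNReal.continuous_rpow_const.tendsto _).comp ?_
    have : Filter.Tendsto (fun n : ℕ => min (ρ y) (n : ℝ≥0∞)) Filter.atTop
        (nhds (min (ρ y) ∞)) := tendsto_const_nhds.min ENNReal.tendsto_nat_nhds_top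
    simpa using this
  refine le_of_tendsto' (lintegral_tendsto_of_tendsto_of_monotone
    (fun n => ((hρm.min measurable_const).pow_const p).aemeasurable) ?_
    (Filter.Eventually.of_forall hlim)) hbd
  refine Filter.Eventually.of_forall fun y n k hnk => ?_
  dsimp only
  gcongr

lemma ae_lintegral_right_eq_one {X Y : Type*} [MeasurableSpace X] [MeasurableSpace Y]
    {l : Measure X} [IsProbabilityMeasure l] {m : Measure Y} [IsProbabilityMeasure m]
    {ρ : X × Y → ℝ≥0∞} (hρ : Measurable ρ) (h : ((l.prod m).withDensity ρ).fst = l) :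
    ∀ᵐ x ∂l, ∫⁻ y, ρ (x, y) ∂m = 1 := by
  refine ae_eq_of_forall_setLIntegral_eq_of_sigmaFinite (by fun_prop) measurable_const
    fun s hs _ => ?_
  have h1 : ((l.prod m).withDensity ρ).fst s = l s := by rw [h]
  rw [Measure.fst_apply hs, withDensity_apply _ (measurable_fst hs), ← Set.prod_univ,
    ← Measure.prod_restrict, Measure.restrict_univ, lintegral_prod _ hρ.aemeasurable] at h1
  rw [h1]
  simp

lemma ae_lintegral_left_eq_one {X Y : Type*} [MeasurableSpace X] [MeasurableSpace Y]
    {l : Measure X} [IsProbabilityMeasure l] {m : Measure Y} [IsProbabilityMeasure m]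
    {ρ : X × Y → ℝ≥0∞} (hρ : Measurable ρ) (h : ((l.prod m).withDensity ρ).snd = m) :
    ∀ᵐ y ∂m, ∫⁻ x, ρ (x, y) ∂l = 1 := by
  refine ae_eq_of_forall_setLIntegral_eq_of_sigmaFinite (by fun_prop) measurable_const
    fun s hs _ => ?_
  have h1 : ((l.prod m).withDensity ρ).snd s = m s := by rw [h]
  rw [Measure.snd_apply hs, withDensity_apply _ (measurable_snd hs), ← Set.univ_prod,
    ← Measure.prod_restrict, Measure.restrict_univ, lintegral_prod_symm _ hρ.aemeasurable] at h1
  rw [h1]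
  simp

/-- For kernels with marginals `l`, transport cost and Bregman cost differ by a constant. -/
lemma exists_cost_add_eq {l : Measure E} [IsProbabilityMeasure l]
    (hl : IsCompact l.support) {T : E → E} (hT : Continuous T) {φ : E → ℝ} (hφc : Continuous φ)
    (hφ : ∀ x ∈ l.support, ∀ z ∈ l.support, 0 ≤ bregman φ T x z) :
    ∃ M N : ℝ≥0∞, M ≠ ∞ ∧ N ≠ ∞ ∧ ∀ σ, IsKernelDensity l 1 σ →
      ∫⁻ x, ∫⁻ z, ENNReal.ofReal (‖x - T z‖ ^ 2) * σ (x, z) ∂l ∂l + M =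
      N + 2 * ∫⁻ x, ∫⁻ z, ENNReal.ofReal (bregman φ T x z) * σ (x, z) ∂l ∂l := by
  -- The identity `‖x - T z‖ ^ 2 = A x + B z + 2 * bregman φ T x z`. The one-variable terms
  -- integrate to constants by the marginal conditions; `M1` and `M2` only shift them to be
  -- nonnegative.
  set A : E → ℝ := fun x => ‖x‖ ^ 2 - 2 * φ x with hA
  set B : E → ℝ := fun z => ‖T z‖ ^ 2 + 2 * φ z - 2 * inner ℝ z (T z) with hB
  have hAc : Continuous A := by fun_prop
  have hBc : Continuous B := by fun_prop
  obtain ⟨M1, hM1⟩ := hl.exists_bound_of_continuousOn hAc.continuousOn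
  obtain ⟨M2, hM2⟩ := hl.exists_bound_of_continuousOn hBc.continuousOn
  obtain ⟨x0, hx0⟩ := Measure.nonempty_support (IsProbabilityMeasure.ne_zero l)
  have hM10 : 0 ≤ M1 := (norm_nonneg _).trans (hM1 x0 hx0)
  have hM20 : 0 ≤ M2 := (norm_nonneg _).trans (hM2 x0 hx0)
  have hbm : Measurable fun q : E × E => bregman φ T q.1 q.2 := by
    unfold bregman
    have : Continuous fun q : E × E => φ q.1 - φ q.2 - inner ℝ (T q.2) (q.1 - q.2) := by fun_prop
    exact this.measurable
  have hTm := hT.measurable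
  refine ⟨ENNReal.ofReal (M1 + M2), ∫⁻ x, ENNReal.ofReal (A x + M1) ∂l +
    ∫⁻ z, ENNReal.ofReal (B z + M2) ∂l, ENNReal.ofReal_ne_top, ?_, fun σ hσ => ?_⟩
  · have hfin : ∀ (G : E → ℝ) (M : ℝ), (∀ x ∈ l.support, ‖G x‖ ≤ M) →
        ∫⁻ x, ENNReal.ofReal (G x + M) ∂l ≠ ∞ := by
      intro G M hG
      refine ne_top_of_le_ne_top (b := ∫⁻ _, ENNReal.ofReal (M + M) ∂l) (by simp) ?_
      refine lintegral_mono_ae ?_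
      filter_upwards [Measure.support_mem_ae (μ := l)] with x hx
      refine ENNReal.ofReal_le_ofReal ?_
      have := (le_abs_self _).trans (hG x hx)
      linarith
    exact ENNReal.add_ne_top.2 ⟨hfin A M1 hM1, hfin B M2 hM2⟩
  · have hσm := hσ.meas
    have hpt : ∀ x ∈ l.support, ∀ z ∈ l.support,
        ENNReal.ofReal (‖x - T z‖ ^ 2) * σ (x, z) + ENNReal.ofReal (M1 + M2) * σ (x, z) =
        ENNReal.ofReal (A x + M1) * σ (x, z) + ENNReal.ofReal (B z + M2) * σ (x, z) +
        2 * (ENNReal.ofReal (bregman φ T x z) * σ (x, z)) := by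
      intro x hx z hz
      have hA0 : 0 ≤ A x + M1 := by
        have := (abs_le.1 (hM1 x hx)).1
        linarith
      have hB0 : 0 ≤ B z + M2 := by
        have := (abs_le.1 (hM2 z hz)).1
        linarith
      have hb := hφ x hx z hz
      have h2 : (2 : ℝ≥0∞) * ENNReal.ofReal (bregman φ T x z) =
          ENNReal.ofReal (2 * bregman φ T x z) := by
        rw [ENNReal.ofReal_mul (by norm_num), ENNReal.ofReal_ofNat]
      rw [← mul_assoc, ← add_mul, ← add_mul, ← add_mul, h2,
        ← ENNReal.ofReal_add (by positivity) (by positivity),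
        ← ENNReal.ofReal_add hA0 hB0, ← ENNReal.ofReal_add (by positivity) (by positivity)]
      congr 2
      simp only [hA, hB, bregman]
      rw [norm_sub_sq_real, inner_sub_right, real_inner_comm (T z) x, real_inner_comm (T z) z]
      ring
    have hone : ∫⁻ x, ∫⁻ z, σ (x, z) ∂l ∂l = 1 := by rw [hσ.lintegral_eq]; simp
    have e1 : ∫⁻ x, ∫⁻ z, ENNReal.ofReal (A x + M1) * σ (x, z) ∂l ∂l =
        ∫⁻ x, ENNReal.ofReal (A x + M1) ∂l := by
      refine lintegral_congr_ae ?_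
      filter_upwards [hσ.left] with x hx
      rw [lintegral_const_mul _ (by fun_prop), hx, Pi.one_apply, mul_one]
    have e2 : ∫⁻ x, ∫⁻ z, ENNReal.ofReal (B z + M2) * σ (x, z) ∂l ∂l =
        ∫⁻ z, ENNReal.ofReal (B z + M2) ∂l := by
      rw [lintegral_lintegral_swap (by fun_prop)]
      refine lintegral_congr_ae ?_
      filter_upwards [hσ.right] with z hz
      rw [lintegral_const_mul _ (by fun_prop), hz, Pi.one_apply, mul_one]
    have e3 : ∫⁻ x, ∫⁻ z, ENNReal.ofReal (M1 + M2) * σ (x, z) ∂l ∂l = ENNReal.ofReal (M1 + M2) := by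
      simp_rw [lintegral_const_mul' _ _ ENNReal.ofReal_ne_top]
      rw [hone, mul_one]
    rw [← e1, ← e2, ← e3]
    have hbm' : Measurable fun q : E × E => ENNReal.ofReal (bregman φ T q.1 q.2) * σ q :=
      hbm.ennreal_ofReal.mul hσm
    rw [← lintegral_const_mul _ (by fun_prop)]
    simp_rw [← lintegral_const_mul' 2 _ (by simp : (2 : ℝ≥0∞) ≠ ∞)]
    rw [← lintegral_add_left (by fun_prop), ← lintegral_add_left (by fun_prop),
      ← lintegral_add_left (by fun_prop)]
    refine lintegral_congr_ae ?_
    filter_upwards [Measure.support_mem_ae (μ := l)] with x hx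
    rw [← lintegral_add_left (by fun_prop), ← lintegral_add_left (by fun_prop),
      ← lintegral_add_left (by fun_prop)]
    refine lintegral_congr_ae ?_
    filter_upwards [Measure.support_mem_ae (μ := l)] with z hz
    exact hpt x hx z hz

/-- A regularised minimiser, seen as a kernel on the source space, minimises the regularised
Bregman energy. -/
lemma IsROTMinimiser.exists_kernel {p ε : ℝ} (hp : 1 < p) (hε : 0 < ε) {lam mu : Measure E}
    [IsProbabilityMeasure lam] [IsProbabilityMeasure mu] (hlam : IsCompact lam.support)
    (hmu : IsCompact mu.support) {π : Measure (E × E)}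
    (h : IsROTMinimiser (polyReg p) ε lam mu π) {T : E → E} (hT : Continuous T)
    (hmap : mu = lam.map T) {φ : E → ℝ} (hφc : Continuous φ)
    (hφ : ∀ x ∈ lam.support, ∀ z ∈ lam.support, 0 ≤ bregman φ T x z) :
    ∃ σ : E × E → ℝ≥0∞, IsMinKernel lam (fun q => ENNReal.ofReal (bregman φ T q.1 q.2))
        (ENNReal.ofReal (ε ^ 2 / (2 * (p - 1)))) p σ ∧
      kernelEnergy lam (fun q => ENNReal.ofReal (bregman φ T q.1 q.2))
        (ENNReal.ofReal (ε ^ 2 / (2 * (p - 1)))) p σ ≠ ∞ ∧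
      ∀ U : Set (E × E), MeasurableSet U →
        π U = ∫⁻ x, ∫⁻ z, U.indicator 1 (x, T z) * σ (x, z) ∂lam ∂lam := by
  have hTm := hT.measurable
  have hp0 : 0 < p - 1 := by linarith
  obtain ⟨hac, hS, ht, hmin⟩ := h.energy_le hp hε hlam hmu
  have hπfin : IsFiniteMeasure π := ⟨by
    have : π.fst Set.univ = 1 := by rw [h.1.1]; simp
    rw [Measure.fst_univ] at this
    simp [this]⟩
  set P := lam.prod mu with hP
  set F : E × E → E × E := Prod.map id T with hF
  have hFm : Measurable F := measurable_id.prodMap hTm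
  have hPF : P = (lam.prod lam).map F := by
    rw [hP, hmap, hF, ← Measure.map_prod_map lam lam measurable_id hTm, Measure.map_id]
  set ρ := π.rnDeriv P with hρ
  have hρm : Measurable ρ := Measure.measurable_rnDeriv _ _
  have hπ : P.withDensity ρ = π := Measure.withDensity_rnDeriv_eq _ _ hac
  have hlift : ∀ f : E × E → ℝ≥0∞, Measurable f →
      ∫⁻ q, f q ∂π = ∫⁻ x, ∫⁻ z, f (x, T z) * ρ (x, T z) ∂lam ∂lam := by
    intro f hf
    conv_lhs => rw [← hπ]
    rw [lintegral_withDensity_eq_lintegral_mul _ hρm hf, hPF,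
      lintegral_map (hρm.mul hf) hFm, lintegral_prod _ (by fun_prop)]
    simp only [hF, Prod.map_apply, Pi.mul_apply, id, mul_comm]
  have hσ : IsKernelDensity lam 1 (ρ ∘ F) := by
    refine ⟨hρm.comp hFm, ?_, ?_⟩
    · have h1 := ae_lintegral_right_eq_one hρm (by rw [← hP, hπ]; exact h.1.1)
      filter_upwards [h1] with x hx
      rw [hmap, lintegral_map (by fun_prop) hTm] at hx
      exact hx
    · have h1 := ae_lintegral_left_eq_one hρm (by rw [← hP, hπ]; exact h.1.2)
      rw [hmap] at h1
      exact ae_of_ae_map hTm.aemeasurable h1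
  have hcost : transportCost π =
      ∫⁻ x, ∫⁻ z, ENNReal.ofReal (‖x - T z‖ ^ 2) * (ρ ∘ F) (x, z) ∂lam ∂lam :=
    hlift _ (by fun_prop)
  have hpow : ∫⁻ q, ρ q ^ p ∂P = ∫⁻ x, ∫⁻ z, (ρ ∘ F) (x, z) ^ p ∂lam ∂lam := by
    rw [hPF, lintegral_map (by fun_prop) hFm, lintegral_prod _ (by fun_prop)]
    rfl
  obtain ⟨M, N, hM, hN, hMN⟩ := exists_cost_add_eq hlam hT hφc hφ
  have h2a : ENNReal.ofReal (ε ^ 2 / (p - 1)) = 2 * ENNReal.ofReal (ε ^ 2 / (2 * (p - 1))) := by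
    rw [← ENNReal.ofReal_ofNat, ← ENNReal.ofReal_mul (by norm_num)]
    congr 1
    field_simp
  have henergy : ∀ σ', IsKernelDensity lam 1 σ' →
      ∫⁻ x, ∫⁻ z, ENNReal.ofReal (‖x - T z‖ ^ 2) * σ' (x, z) ∂lam ∂lam +
        ENNReal.ofReal (ε ^ 2 / (p - 1)) * ∫⁻ x, ∫⁻ z, σ' (x, z) ^ p ∂lam ∂lam + M =
      N + 2 * kernelEnergy lam (fun q => ENNReal.ofReal (bregman φ T q.1 q.2))
        (ENNReal.ofReal (ε ^ 2 / (2 * (p - 1)))) p σ' := by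
    intro σ' hσ'
    rw [add_right_comm, hMN σ' hσ', h2a, kernelEnergy]
    ring
  -- The kernel is the density of `π` composed with `Prod.map id T`, so its `p`-th power integral
  -- equals that of `π`. A competing kernel is pushed forward, which can only lower that integral.
  refine ⟨ρ ∘ F, ⟨hσ, fun σ' hσ' => ?_⟩, fun htop => ?_, fun U hU => ?_⟩
  · have hm' : IsFiniteMeasure ((lam.prod lam).withDensity σ') := by
      refine isFiniteMeasure_withDensity ?_
      rw [lintegral_prod _ hσ'.meas.aemeasurable, hσ'.lintegral_eq]
      simp
    set π' := ((lam.prod lam).withDensity σ').map F with hπ'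
    have hac' : π' ≪ P := by
      rw [hPF]
      exact (withDensity_absolutelyContinuous _ _).map hFm
    have hσm := hσ'.meas
    have hf1 : ((lam.prod lam).withDensity σ').map Prod.fst = lam := by
      ext s hs
      rw [Measure.map_apply measurable_fst hs, withDensity_apply _ (measurable_fst hs),
        ← Set.prod_univ, ← Measure.prod_restrict, Measure.restrict_univ,
        lintegral_prod _ hσm.aemeasurable, lintegral_congr_ae (ae_restrict_of_ae hσ'.left)]
      simp
    have hf2 : ((lam.prod lam).withDensity σ').map Prod.snd = lam := by
      ext s hs
      rw [Measure.map_apply measurable_snd hs, withDensity_apply _ (measurable_snd hs),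
        ← Set.univ_prod, ← Measure.prod_restrict, Measure.restrict_univ,
        lintegral_prod_symm _ hσm.aemeasurable, lintegral_congr_ae (ae_restrict_of_ae hσ'.right)]
      simp
    have hmem : π' ∈ couplings lam mu := by
      constructor
      · rw [hπ', Measure.fst, Measure.map_map measurable_fst hFm]
        exact hf1
      · rw [hπ', Measure.snd, Measure.map_map measurable_snd hFm, hmap]
        conv_rhs => rw [← hf2]
        rw [Measure.map_map hTm measurable_snd]
        rfl
    have hcost' : transportCost π' =
        ∫⁻ x, ∫⁻ z, ENNReal.ofReal (‖x - T z‖ ^ 2) * σ' (x, z) ∂lam ∂lam := by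
      rw [transportCost, hπ', lintegral_map (by fun_prop) hFm,
        lintegral_withDensity_eq_lintegral_mul _ hσm (by fun_prop), lintegral_prod _ (by fun_prop)]
      simp only [hF, Prod.map_apply, Pi.mul_apply, id, mul_comm]
    have hpow' : ∫⁻ q, (π'.rnDeriv P q) ^ p ∂P ≤ ∫⁻ x, ∫⁻ z, σ' (x, z) ^ p ∂lam ∂lam := by
      have := lintegral_rnDeriv_map_rpow_le (m := lam.prod lam) hFm hσm hp
      rw [lintegral_prod _ (by fun_prop), ← hPF] at this
      exact this
    have h1 := hmin π' hmem hac'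
    rw [hcost, hpow, hcost'] at h1
    have h2 := h1.trans (add_le_add_right (mul_le_mul_right hpow' _) _)
    have h3 := add_le_add_left h2 M
    rw [henergy _ hσ, henergy _ hσ'] at h3
    have h4 := (ENNReal.add_le_add_iff_left hN).1 h3
    exact (ENNReal.mul_le_mul_iff_right two_ne_zero (by simp)).1 h4
  · have h1 := henergy _ hσ
    rw [htop, ← hcost, ← hpow] at h1
    have h2 : transportCost π + ENNReal.ofReal (ε ^ 2 / (p - 1)) * ∫⁻ q, ρ q ^ p ∂P + M ≠ ∞ :=
      ENNReal.add_ne_top.2 ⟨ENNReal.add_ne_top.2 ⟨ht, ENNReal.mul_ne_top ENNReal.ofReal_ne_top hS⟩,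
        hM⟩
    rw [h1] at h2
    simp at h2
  · rw [← lintegral_indicator_one hU, hlift _ (measurable_one.indicator hU)]
    rfl

end Lift

/-! ### One far pair forces much mass near it to be moved far. -/

section Forward

variable {d : ℕ}

local notation "E" => EuclideanSpace ℝ (Fin d)

lemma measurable_bregman {φ : E → ℝ} (hφ : Continuous φ) {T : E → E} (hT : Continuous T) :
    Measurable fun q : E × E => bregman φ T q.1 q.2 := by
  have : Continuous fun q : E × E => φ q.1 - φ q.2 - inner ℝ (T q.2) (q.1 - q.2) := by fun_prop
  exact this.measurable

lemma IsKernelDensity.lintegral_fst {X : Type*} [MeasurableSpace X] {l : Measure X}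
    {σ : X × X → ℝ≥0∞} (h : IsKernelDensity l 1 σ) {f : X → ℝ≥0∞} :
    ∫⁻ x, ∫⁻ z, f x * σ (x, z) ∂l ∂l = ∫⁻ x, f x ∂l := by
  have := h.meas
  refine lintegral_congr_ae ?_
  filter_upwards [h.left] with x hx
  rw [lintegral_const_mul _ (by fun_prop), hx, Pi.one_apply, mul_one]

lemma IsKernelDensity.lintegral_snd {X : Type*} [MeasurableSpace X] {l : Measure X} [SFinite l]
    {σ : X × X → ℝ≥0∞} (h : IsKernelDensity l 1 σ) {f : X → ℝ≥0∞} (hf : Measurable f) :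
    ∫⁻ x, ∫⁻ z, f z * σ (x, z) ∂l ∂l = ∫⁻ z, f z ∂l := by
  have := h.meas
  rw [lintegral_lintegral_swap (by fun_prop)]
  refine lintegral_congr_ae ?_
  filter_upwards [h.right] with x hx
  rw [lintegral_const_mul _ (by fun_prop), hx, Pi.one_apply, mul_one]

/-- Every set charged by a minimal kernel contains a pair which is almost cyclically monotone with
respect to all but a small mass of other pairs. -/
lemma IsMinKernel.exists_generic_pair {l : Measure E} [IsProbabilityMeasure l] {T : E → E}
    (hT : Continuous T) {φ : E → ℝ} (hφc : Continuous φ)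
    (hφ : ∀ x ∈ l.support, ∀ z ∈ l.support, 0 ≤ bregman φ T x z) {a : ℝ≥0∞} {p : ℝ} (hp : 1 < p)
    {σ : E × E → ℝ≥0∞}
    (h : IsMinKernel l (fun q => ENNReal.ofReal (bregman φ T q.1 q.2)) a p σ)
    (hfin : kernelEnergy l (fun q => ENNReal.ofReal (bregman φ T q.1 q.2)) a p σ ≠ ∞)
    {τ r : ℝ} (hτ : 0 < τ) (hr : 0 ≤ r)
    (hc : 2 * (a * ENNReal.ofReal p * (2 * ENNReal.ofReal τ) ^ (p - 1)) ≤ ENNReal.ofReal r)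
    {V : Set (E × E)} (hV : ∫⁻ x, ∫⁻ z, V.indicator 1 (x, z) * σ (x, z) ∂l ∂l ≠ 0) :
    ∃ x z, (x, z) ∈ V ∧ x ∈ l.support ∧ z ∈ l.support ∧ ∃ G : Set (E × E), MeasurableSet G ∧
      ∫⁻ x', ∫⁻ z', Gᶜ.indicator 1 (x', z') * σ (x', z') ∂l ∂l ≤ ENNReal.ofReal (2 / τ) ∧
      ∀ q ∈ G, q.1 ∈ l.support ∧ q.2 ∈ l.support ∧ -r ≤ inner ℝ (q.1 - x) (T q.2 - T z) := by
  set D : E × E → ℝ≥0∞ := fun q => ENNReal.ofReal (bregman φ T q.1 q.2) with hD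
  have hDm : Measurable D := (measurable_bregman hφc hT).ennreal_ofReal
  have hσm := h.1.meas
  set c0 := 2 * (a * ENNReal.ofReal p * (2 * ENNReal.ofReal τ) ^ (p - 1)) with hc0
  have hτ0 : ENNReal.ofReal τ ≠ 0 := by simpa using hτ
  set W : Set (E × E × E × E) := {q | (σ (q.1, q.2.2.2) ≤ ENNReal.ofReal τ ∧
    σ (q.2.2.1, q.2.1) ≤ ENNReal.ofReal τ) ∧
    D (q.1, q.2.2.2) + D (q.2.2.1, q.2.1) + c0 < D (q.1, q.2.1) + D (q.2.2.1, q.2.2.2)} with hW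
  have hWm : MeasurableSet W := by
    refine MeasurableSet.inter (MeasurableSet.inter ?_ ?_) ?_
    · exact measurableSet_le (f := fun q : E × E × E × E => σ (q.1, q.2.2.2)) (by fun_prop)
        measurable_const
    · exact measurableSet_le (f := fun q : E × E × E × E => σ (q.2.2.1, q.2.1)) (by fun_prop)
        measurable_const
    · exact measurableSet_lt
        (f := fun q : E × E × E × E => D (q.1, q.2.2.2) + D (q.2.2.1, q.2.1) + c0)
        (g := fun q : E × E × E × E => D (q.1, q.2.1) + D (q.2.2.1, q.2.2.2))
        (by fun_prop) (by fun_prop)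
  have hzero := h.swap hp hDm hfin hτ0 hWm
    (fun x z x' z' hw => ⟨⟨hw.1.2, hw.1.1⟩, by
      have h2 : D (x, z') + D (x', z) + c0 < D (x, z) + D (x', z') := hw.2
      show D (x', z) + D (x, z') + c0 < D (x', z') + D (x, z)
      rwa [add_comm (D (x', z)), add_comm (D (x', z'))]⟩)
    (fun x z x' z' hw => hw.1.1) (fun x z x' z' hw => hw.2)
  have hwm : Measurable (W.indicator (1 : E × E × E × E → ℝ≥0∞)) := measurable_one.indicator hWm
  have hae : ∀ᵐ x ∂l, ∀ᵐ z ∂l, σ (x, z) * ∫⁻ x', ∫⁻ z', W.indicator 1 (x, z, x', z') *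
      σ (x', z') ∂l ∂l = 0 := by
    rw [lintegral_eq_zero_iff (by fun_prop)] at hzero
    filter_upwards [hzero] with x hx
    rw [Pi.zero_apply, lintegral_eq_zero_iff (by fun_prop)] at hx
    filter_upwards [hx] with z hz
    refine Eq.trans ?_ hz
    rw [← lintegral_const_mul _ (by fun_prop)]
    refine lintegral_congr fun x' => ?_
    rw [← lintegral_const_mul _ (by fun_prop)]
    refine lintegral_congr fun z' => ?_
    ring
  have hsupp : ∀ᵐ x ∂l, x ∈ l.support := Measure.support_mem_ae
  obtain ⟨x, z, hxz, hxK, hzK, hxl, hzr, hw0⟩ : ∃ x z, (x, z) ∈ V ∧ x ∈ l.support ∧ z ∈ l.support ∧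
      ∫⁻ z', σ (x, z') ∂l = 1 ∧ ∫⁻ x', σ (x', z) ∂l = 1 ∧
      ∫⁻ x', ∫⁻ z', W.indicator 1 (x, z, x', z') * σ (x', z') ∂l ∂l = 0 := by
    by_contra hcon
    push Not at hcon
    apply hV
    rw [show (0 : ℝ≥0∞) = ∫⁻ _, 0 ∂l by simp]
    refine lintegral_congr_ae ?_
    filter_upwards [hsupp, h.1.left, hae] with x x1 x2 x3
    rw [show (0 : ℝ≥0∞) = ∫⁻ _, 0 ∂l by simp]
    refine lintegral_congr_ae ?_
    filter_upwards [hsupp, h.1.right, x3] with z z1 z2 z3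
    by_contra hne
    obtain ⟨n1, n2⟩ := mul_ne_zero_iff.1 hne
    have hmem : (x, z) ∈ V := by
      by_contra hno
      simp [hno] at n1
    exact hcon x z hmem x1 z1 x2 z2 ((mul_eq_zero.1 z3).resolve_left n2)
  -- The exchange argument needs density at most `τ` on the exchanged pairs. Both sections of `σ`
  -- have integral one, so by Chebyshev each exceptional set has `l`-mass at most `1 / τ`, and by
  -- the marginals the same mass under `σ`.
  set S1 : Set E := {z' | ENNReal.ofReal τ ≤ σ (x, z')} with hS1
  set S2 : Set E := {x' | ENNReal.ofReal τ ≤ σ (x', z)} with hS2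
  have hS1m : MeasurableSet S1 := measurableSet_le measurable_const (by fun_prop)
  have hS2m : MeasurableSet S2 := measurableSet_le measurable_const (by fun_prop)
  have hm1 : Measurable (S1.indicator (1 : E → ℝ≥0∞)) := measurable_one.indicator hS1m
  have hm2 : Measurable (S2.indicator (1 : E → ℝ≥0∞)) := measurable_one.indicator hS2m
  have hcheb : ∀ f : E → ℝ≥0∞, Measurable f → ∫⁻ y, f y ∂l = 1 →
      l {y | ENNReal.ofReal τ ≤ f y} ≤ ENNReal.ofReal (1 / τ) := by
    intro f hf h1
    have := mul_meas_ge_le_lintegral (μ := l) hf (ENNReal.ofReal τ)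
    rw [h1] at this
    rw [one_div, ENNReal.ofReal_inv_of_pos hτ, ← one_div]
    rw [ENNReal.le_div_iff_mul_le (Or.inl hτ0) (Or.inl ENNReal.ofReal_ne_top), mul_comm]
    exact this
  have hKm : MeasurableSet l.support := Measure.isClosed_support.measurableSet
  refine ⟨x, z, hxz, hxK, hzK, ((l.support ×ˢ l.support) \ (Prod.snd ⁻¹' S1 ∪ Prod.fst ⁻¹' S2)) \
    {q | (x, z, q) ∈ W}, ?_, ?_, ?_⟩
  · exact ((hKm.prod hKm).diff ((measurable_snd hS1m).union (measurable_fst hS2m))).diff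
      (measurable_prodMk_left (measurable_prodMk_left hWm))
  · calc _ ≤ ∫⁻ x', ∫⁻ z', (S1.indicator 1 z' * σ (x', z') + S2.indicator 1 x' * σ (x', z') +
          W.indicator 1 (x, z, x', z') * σ (x', z')) ∂l ∂l := by
          refine lintegral_mono_ae ?_
          filter_upwards [hsupp] with x' hx'
          refine lintegral_mono_ae ?_
          filter_upwards [hsupp] with z' hz'
          rw [← add_mul, ← add_mul]
          gcongr
          by_cases h1 : z' ∈ S1
          · simp only [Set.indicator_of_mem h1]
            refine (Set.indicator_le_self' (by simp) _).trans ?_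
            simp only [Pi.one_apply, add_assoc]
            exact le_self_add
          by_cases h2 : x' ∈ S2
          · simp only [Set.indicator_of_mem h2]
            refine (Set.indicator_le_self' (by simp) _).trans ?_
            simp only [Pi.one_apply]
            rw [add_right_comm]
            exact le_add_self
          by_cases h3 : (x, z, x', z') ∈ W
          · simp only [Set.indicator_of_mem h3]
            refine (Set.indicator_le_self' (by simp) _).trans ?_
            simp only [Pi.one_apply]
            exact le_add_self
          · rw [Set.indicator_of_notMem]
            · simp
            · rw [Set.notMem_compl_iff]
              exact ⟨⟨⟨hx', hz'⟩, fun hh => hh.elim h1 h2⟩, h3⟩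
      _ = l S1 + l S2 + 0 := by
          rw [← lintegral_indicator_one hS1m, ← lintegral_indicator_one hS2m, ← hw0,
            ← h.1.lintegral_snd hm1, ← h.1.lintegral_fst (f := S2.indicator 1), ← lintegral_add_left (by fun_prop),
            ← lintegral_add_left (by fun_prop)]
          refine lintegral_congr fun x' => ?_
          rw [← lintegral_add_left (by fun_prop), ← lintegral_add_left (by fun_prop)]
      _ ≤ ENNReal.ofReal (1 / τ) + ENNReal.ofReal (1 / τ) := by
          rw [add_zero]
          exact add_le_add (hcheb _ (by fun_prop) hxl) (hcheb _ (by fun_prop) hzr)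
      _ = _ := by
          rw [← ENNReal.ofReal_add (by positivity) (by positivity)]
          congr 1
          ring
  · rintro ⟨x', z'⟩ ⟨⟨⟨hx', hz'⟩, hns⟩, hnW⟩
    refine ⟨hx', hz', ?_⟩
    have hx'K : x' ∈ l.support := hx'
    have hz'K : z' ∈ l.support := hz'
    have n1 : σ (x, z') ≤ ENNReal.ofReal τ := le_of_lt (not_le.1 fun hh => hns (Or.inl hh))
    have n2 : σ (x', z) ≤ ENNReal.ofReal τ := le_of_lt (not_le.1 fun hh => hns (Or.inr hh))
    have n3 : D (x, z) + D (x', z') ≤ D (x, z') + D (x', z) + c0 :=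
      not_lt.1 fun hh => hnW ⟨⟨n1, n2⟩, hh⟩
    have n4 := n3.trans (add_le_add_right hc _)
    have b1 := hφ _ hxK _ hzK
    have b2 := hφ _ hx'K _ hz'K
    have b3 := hφ _ hxK _ hz'K
    have b4 := hφ _ hx'K _ hzK
    simp only [hD] at n4
    rw [← ENNReal.ofReal_add b1 b2, ← ENNReal.ofReal_add b3 b4,
      ← ENNReal.ofReal_add (by positivity) hr, ENNReal.ofReal_le_ofReal_iff (by positivity)] at n4
    simp only [bregman, inner_sub_left, inner_sub_right] at n4 ⊢
    rw [real_inner_comm (T z') x', real_inner_comm (T z') x, real_inner_comm (T z) x',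
      real_inner_comm (T z) x]
    linarith

/-- A ball is connected, so one that meets both `K` and its complement would meet the frontier. -/
lemma ball_subset_of_le_infDist_frontier {K : Set E} {x : E} (hx : x ∈ K) {R : ℝ}
    (h : R ≤ Metric.infDist x (frontier K)) : Metric.ball x R ⊆ K := by
  rcases le_or_gt R 0 with hR | hR
  · rw [Metric.ball_eq_empty.2 hR]
    exact Set.empty_subset _
  by_contra hcon
  obtain ⟨y, hy, hyK⟩ := Set.not_subset.1 hcon
  have hnf : ∀ w ∈ Metric.ball x R, w ∉ frontier K := by
    intro w hw hwf
    have := Metric.infDist_le_dist_of_mem (x := x) hwf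
    rw [Metric.mem_ball, dist_comm] at hw
    linarith
  have hcov : ∀ w ∈ Metric.ball x R, w ∈ interior K ∨ w ∈ (closure K)ᶜ := by
    intro w hw
    by_contra hcon
    push Not at hcon
    exact hnf w hw ⟨not_not.1 hcon.2, hcon.1⟩
  obtain ⟨w, -, hw1, hw2⟩ := (convex_ball x R).isPreconnected (interior K) (closure K)ᶜ
    isOpen_interior isClosed_closure.isOpen_compl hcov
    ⟨x, Metric.mem_ball_self hR, (hcov x (Metric.mem_ball_self hR)).resolve_right
      fun h => h (subset_closure hx)⟩
    ⟨y, hy, (hcov y hy).resolve_left fun h => hyK (interior_subset h)⟩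
  exact hw2 (subset_closure (interior_subset hw1))

/-- If a minimal kernel moves a pair at `x0` far away, then there is a unit direction into which
most mass near `x0` is moved. -/
lemma IsMinKernel.exists_direction {l : Measure E} [IsProbabilityMeasure l] {L : ℝ≥0} {T : E → E}
    (hT : LipschitzWith L T) {φ : E → ℝ} (hφc : Continuous φ)
    (hφ : ∀ x ∈ l.support, ∀ z ∈ l.support, 0 ≤ bregman φ T x z) {a : ℝ≥0∞} {p : ℝ} (hp : 1 < p)
    {σ : E × E → ℝ≥0∞}
    (h : IsMinKernel l (fun q => ENNReal.ofReal (bregman φ T q.1 q.2)) a p σ)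
    (hfin : kernelEnergy l (fun q => ENNReal.ofReal (bregman φ T q.1 q.2)) a p σ ≠ ∞)
    {τ R : ℝ} (hτ : 0 < τ) (hR : 0 < R)
    (hc : 2 * (a * ENNReal.ofReal p * (2 * ENNReal.ofReal τ) ^ (p - 1)) ≤ ENNReal.ofReal (R ^ 2))
    {x0 y0 : E} (hball : Metric.ball x0 R ⊆ l.support)
    (hV : ∀ r > 0, ∫⁻ x, ∫⁻ z, (Metric.ball x0 r ×ˢ Metric.ball y0 r).indicator 1 (x, T z) *
      σ (x, z) ∂l ∂l ≠ 0) (hbad : (8 + 3 * L) * R < ‖y0 - T x0‖) :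
    ∃ (x z e : E) (ρ : ℝ), x ∈ l.support ∧ Metric.ball x (3 * R / 4) ⊆ l.support ∧ ‖e‖ = 1 ∧
      T z - T x = ρ • e ∧ (7 + 3 * L) * R ≤ ρ ∧ ∃ G : Set (E × E), MeasurableSet G ∧
      ∫⁻ x', ∫⁻ z', Gᶜ.indicator 1 (x', z') * σ (x', z') ∂l ∂l ≤ ENNReal.ofReal (2 / τ) ∧
      ∀ q ∈ G, q.1 ∈ l.support ∧ q.2 ∈ l.support ∧
        -R ^ 2 ≤ inner ℝ (q.1 - x) (T q.2 - T z) := by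
  -- Replacing `(x0, y0)` by a generic pair within `r` changes the displacement by at most `(1 + L)
  -- * r = R / 4`.
  set r := R / (4 * (1 + L)) with hr
  have hL0 : (0 : ℝ) ≤ L := L.2
  have hr0 : 0 < r := by positivity
  have hrR : (1 + L) * r = R / 4 := by rw [hr]; field_simp
  have hrR' : r ≤ R / 4 := by nlinarith
  obtain ⟨x, z, hxz, hxK, hzK, G, hGm, hG, hGp⟩ :=
    h.exists_generic_pair hT.continuous hφc hφ hp hfin hτ (sq_nonneg R) hc
    (V := {q | (q.1, T q.2) ∈ Metric.ball x0 r ×ˢ Metric.ball y0 r}) (hV r hr0)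
  obtain ⟨hx, hz⟩ : dist x x0 < r ∧ dist (T z) y0 < r := hxz
  have hTx : dist (T x) (T x0) ≤ L * r :=
    (hT.dist_le_mul x x0).trans (by gcongr)
  have hρ : (7 + 3 * L) * R ≤ ‖T z - T x‖ := by
    have : dist y0 (T x0) ≤ dist (T z) y0 + dist (T z) (T x) + dist (T x) (T x0) := by
      have h1 := dist_triangle y0 (T z) (T x0)
      have h2 := dist_triangle (T z) (T x) (T x0)
      rw [dist_comm y0 (T z)] at h1
      linarith
    rw [dist_eq_norm y0, dist_eq_norm (T z) (T x)] at this
    linarith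
  have hρ0 : 0 < ‖T z - T x‖ := lt_of_lt_of_le (by positivity) hρ
  refine ⟨x, z, ‖T z - T x‖⁻¹ • (T z - T x), ‖T z - T x‖, hxK, ?_, ?_, ?_, hρ, G, hGm, hG, hGp⟩
  · refine (Metric.ball_subset_ball' ?_).trans hball
    linarith
  · rw [norm_smul, norm_inv, norm_norm, inv_mul_cancel₀ hρ0.ne']
  · rw [smul_smul, mul_inv_cancel₀ hρ0.ne', one_smul]

/-- A target far from `T x'`, with `x'` well inside the support, has a large Bregman gap. -/
lemma le_bregman_of_ball_subset {K : Set E} {L : ℝ≥0} {T : E → E} (hT : LipschitzWith L T)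
    {φ : E → ℝ} (hφ : ∀ x ∈ K, ∀ z ∈ K, 0 ≤ bregman φ T x z) {x z : E} (hz : z ∈ K) {t : ℝ}
    (ht : 0 ≤ t) (hx : Metric.closedBall x t ⊆ K) :
    t * (‖T z - T x‖ - L * t) ≤ bregman φ T x z := by
  rcases eq_or_ne (T z - T x) 0 with h0 | h0
  · rw [h0, norm_zero]
    have := hφ x (hx (Metric.mem_closedBall_self ht)) z hz
    have h2 : 0 ≤ t * (L * t) := by positivity
    linarith
  set v := ‖T z - T x‖⁻¹ • (T z - T x) with hv
  have hn : ‖v‖ = 1 := by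
    rw [hv, norm_smul, norm_inv, norm_norm, inv_mul_cancel₀ (norm_ne_zero_iff.2 h0)]
  -- A step of length `t` from `x` towards `T z - T x` stays in `K`. The chain through this point
  -- has increment `t * ⟪T z - T (x + t • v), v⟫`, which bounds the gap from below.
  have huK : x + t • v ∈ K := hx (by
    rw [Metric.mem_closedBall, dist_eq_norm, add_sub_cancel_left, norm_smul, hn, mul_one,
      Real.norm_of_nonneg ht])
  have h1 := hφ _ huK _ hz
  have h2 := hφ _ (hx (Metric.mem_closedBall_self ht)) _ huK
  have h3 : inner ℝ (T z - T x) v = ‖T z - T x‖ := by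
    rw [hv, inner_smul_right, real_inner_self_eq_norm_sq]
    field_simp
  have h4 : inner ℝ (T (x + t • v) - T x) v ≤ L * t := by
    refine (real_inner_le_norm _ _).trans ?_
    rw [hn, mul_one]
    have := hT.norm_sub_le (x + t • v) x
    rwa [add_sub_cancel_left, norm_smul, hn, mul_one, Real.norm_of_nonneg ht] at this
  have h5 : t * inner ℝ (T z - T (x + t • v)) v ≤ bregman φ T x z := by
    simp only [bregman, inner_sub_left, inner_sub_right, inner_add_right, inner_smul_right] at *
    linarith
  refine le_trans ?_ h5
  gcongr
  have : inner ℝ (T z - T (x + t • v)) v =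
      inner ℝ (T z - T x) v - inner ℝ (T (x + t • v) - T x) v := by
    rw [← inner_sub_left]; congr 1; abel
  rw [this, h3]
  linarith

/-- Let `e` be the direction of the displacement at the far pair. Points `x'` of the ball of radius
`R / 8` around `x + (3 * R / 8) • e` satisfy `⟪x' - x, e⟫ ≥ R / 4`, so approximate monotonicity
forces their generic targets to be far from `T x'`, and `le_bregman_of_ball_subset` makes the gap
large. The level `4 / (D * (R / 8) ^ d)` leaves an exceptional mass of at most half the lower bound
for the ball. -/
lemma IsMinKernel.le_lintegral_of_far {l : Measure E} [IsProbabilityMeasure l] {L : ℝ≥0}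
    {T : E → E}
    (hT : LipschitzWith L T) {φ : E → ℝ} (hφc : Continuous φ)
    (hφ : ∀ x ∈ l.support, ∀ z ∈ l.support, 0 ≤ bregman φ T x z) {a : ℝ≥0∞} {p : ℝ} (hp : 1 < p)
    {σ : E × E → ℝ≥0∞}
    (h : IsMinKernel l (fun q => ENNReal.ofReal (bregman φ T q.1 q.2)) a p σ)
    (hfin : kernelEnergy l (fun q => ENNReal.ofReal (bregman φ T q.1 q.2)) a p σ ≠ ∞)
    {D R : ℝ} (hD : 0 < D) (hR : 0 < R)
    (hlow : ∀ (z : E) (r : ℝ), 0 < r → Metric.ball z r ⊆ l.support →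
      D * r ^ d ≤ l.real (Metric.ball z r))
    (hc : 2 * (a * ENNReal.ofReal p * (2 * ENNReal.ofReal (4 / (D * (R / 8) ^ d))) ^ (p - 1)) ≤
      ENNReal.ofReal (R ^ 2))
    {x0 y0 : E} (hball : Metric.ball x0 R ⊆ l.support)
    (hV : ∀ r > 0, ∫⁻ x, ∫⁻ z, (Metric.ball x0 r ×ˢ Metric.ball y0 r).indicator 1 (x, T z) *
      σ (x, z) ∂l ∂l ≠ 0) (hbad : (8 + 3 * L) * R < ‖y0 - T x0‖) :
    ENNReal.ofReal (D * (R / 8) ^ d / 2) ≤ ∫⁻ x, ∫⁻ z, {q : E × E | R ^ 2 / 8 ≤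
      bregman φ T q.1 q.2}.indicator 1 (x, z) * σ (x, z) ∂l ∂l := by
  have hτ : 0 < 4 / (D * (R / 8) ^ d) := by positivity
  obtain ⟨x, z, e, ρ, hxK, hxb, he, hze, hρ, G, hGm, hG, hGp⟩ :=
    h.exists_direction hT hφc hφ hp hfin hτ hR hc hball hV hbad
  have hL0 : (0 : ℝ) ≤ L := L.2
  have hσm := h.1.meas
  set m := D * (R / 8) ^ d with hm
  have hm0 : 0 < m := by positivity
  set B := Metric.ball (x + (3 * R / 8) • e) (R / 8) with hB
  set H : Set (E × E) := {q : E × E | R ^ 2 / 8 ≤ bregman φ T q.1 q.2} with hH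
  have hHm : MeasurableSet H :=
    measurableSet_le measurable_const (measurable_bregman hφc hT.continuous)
  have hne : ‖(3 * R / 8) • e‖ = 3 * R / 8 := by
    rw [norm_smul, he, mul_one, Real.norm_of_nonneg (by positivity)]
  have hBK : B ⊆ l.support := by
    refine (Metric.ball_subset_ball' ?_).trans hxb
    rw [dist_eq_norm, add_sub_cancel_left, hne]
    linarith
  have hBl : ENNReal.ofReal m ≤ l B := by
    rw [ENNReal.ofReal_le_iff_le_toReal (measure_ne_top _ _)]
    exact hlow _ _ (by positivity) hBK
  have hsub : ∀ q ∈ G, q.1 ∈ B → q ∈ H := by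
    rintro ⟨x', z'⟩ hq hxB
    obtain ⟨hx', hz', hin⟩ := hGp _ hq
    simp only at hx' hz' hin hxB
    set w := x' - x with hw
    have hβ : ‖w - (3 * R / 8) • e‖ < R / 8 := by
      rw [hB, Metric.mem_ball, dist_eq_norm, ← sub_sub] at hxB
      exact hxB
    have hwn : ‖w‖ ≤ R / 2 := by
      calc ‖w‖ = ‖(w - (3 * R / 8) • e) + (3 * R / 8) • e‖ := by rw [sub_add_cancel]
        _ ≤ _ := norm_add_le _ _
        _ ≤ R / 2 := by rw [hne]; linarith
    have hwe : R / 4 ≤ inner ℝ w e := by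
      have h1 := (abs_le.1 ((abs_real_inner_le_norm (w - (3 * R / 8) • e) e).trans
        (by rw [he, mul_one]))).1
      rw [inner_sub_left, inner_smul_left, real_inner_self_eq_norm_sq, he] at h1
      simp only [conj_trivial] at h1
      linarith
    have hbig : (7 + 3 * L) * R * (R / 4) - R ^ 2 ≤ inner ℝ w (T z' - T x) := by
      have e1 : inner ℝ w (T z' - T x) = inner ℝ w (T z' - T z) + ρ * inner ℝ w e := by
        rw [← inner_smul_right, ← hze, ← inner_add_right]
        congr 1; abel
      have h2 : (7 + 3 * L) * R * (R / 4) ≤ ρ * inner ℝ w e := by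
        have hρ0 : 0 ≤ ρ := le_trans (by positivity) hρ
        gcongr
      rw [e1]
      linarith
    have h3 : inner ℝ w (T z' - T x) ≤ R / 2 * ‖T z' - T x‖ :=
      (real_inner_le_norm _ _).trans (by gcongr)
    have h4 : ((7 + 3 * L) / 2 - 2) * R ≤ ‖T z' - T x‖ := by
      have : R / 2 * (((7 + 3 * L) / 2 - 2) * R) ≤ R / 2 * ‖T z' - T x‖ := by nlinarith
      exact le_of_mul_le_mul_left this (by positivity)
    have h5 : ‖T x' - T x‖ ≤ L * (R / 2) := (hT.norm_sub_le _ _).trans (by gcongr)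
    have h6 : (L + 1) * R ≤ ‖T z' - T x'‖ := by
      have : ‖T z' - T x‖ ≤ ‖T z' - T x'‖ + ‖T x' - T x‖ := by
        calc _ = ‖(T z' - T x') + (T x' - T x)‖ := by congr 1; abel
          _ ≤ _ := norm_add_le _ _
      nlinarith
    have h7 := le_bregman_of_ball_subset hT hφ hz' (t := R / 8) (by positivity) (x := x') (by
      refine (Metric.closedBall_subset_ball' ?_).trans hxb
      rw [dist_eq_norm]
      linarith)
    show R ^ 2 / 8 ≤ bregman φ T x' z'
    refine le_trans ?_ h7
    have : R / 8 * ((L + 1) * R - L * (R / 8)) ≤ R / 8 * (‖T z' - T x'‖ - L * (R / 8)) := by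
      gcongr
    refine le_trans ?_ this
    have : 0 ≤ L * R ^ 2 := by positivity
    nlinarith
  have hGm' : Measurable (Gᶜ.indicator (1 : E × E → ℝ≥0∞)) := measurable_one.indicator hGm.compl
  have hle : l B ≤ ENNReal.ofReal (2 / (4 / m)) +
      ∫⁻ x, ∫⁻ z, H.indicator 1 (x, z) * σ (x, z) ∂l ∂l := by
    rw [← lintegral_indicator_one measurableSet_ball,
      ← h.1.lintegral_fst (f := B.indicator 1)]
    refine le_trans ?_ (add_le_add_left hG _)
    rw [← lintegral_add_left (by fun_prop)]
    refine lintegral_mono fun x' => ?_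
    rw [← lintegral_add_left (by fun_prop)]
    refine lintegral_mono fun z' => ?_
    rw [← add_mul]
    dsimp only
    gcongr
    by_cases h1 : x' ∈ B
    · by_cases h2 : (x', z') ∈ G
      · rw [Set.indicator_of_mem (hsub _ h2 h1)]
        exact (Set.indicator_le_self' (by simp) _).trans le_add_self
      · rw [Set.indicator_of_mem (s := Gᶜ) h2]
        exact (Set.indicator_le_self' (by simp) _).trans le_self_add
    · rw [Set.indicator_of_notMem h1]
      exact zero_le
  have h2 : 2 / (4 / m) = m / 2 := by field_simp; norm_num
  rw [h2] at hle
  have h3 := hBl.trans hle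
  rw [show m = m / 2 + m / 2 by ring, ENNReal.ofReal_add (by positivity) (by positivity)] at h3
  simp only [add_halves] at h3
  exact (ENNReal.add_le_add_iff_left ENNReal.ofReal_ne_top).1 h3

/-- In dimension one a minimal kernel moves no pair far away from the boundary. -/
lemma IsMinKernel.not_far_of_dim_one {l : Measure (EuclideanSpace ℝ (Fin 1))}
    [IsProbabilityMeasure l] {L : ℝ≥0}
    {T : EuclideanSpace ℝ (Fin 1) → EuclideanSpace ℝ (Fin 1)}
    (hT : LipschitzWith L T) {φ : EuclideanSpace ℝ (Fin 1) → ℝ} (hφc : Continuous φ)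
    (hφ : ∀ x ∈ l.support, ∀ z ∈ l.support, 0 ≤ bregman φ T x z) {a : ℝ≥0∞} {p : ℝ} (hp : 1 < p)
    {σ : EuclideanSpace ℝ (Fin 1) × EuclideanSpace ℝ (Fin 1) → ℝ≥0∞}
    (h : IsMinKernel l (fun q => ENNReal.ofReal (bregman φ T q.1 q.2)) a p σ)
    (hfin : kernelEnergy l (fun q => ENNReal.ofReal (bregman φ T q.1 q.2)) a p σ ≠ ∞)
    {D R : ℝ} (hD : 0 < D) (hR : 0 < R)
    (hlow : ∀ (z : EuclideanSpace ℝ (Fin 1)) (r : ℝ), 0 < r → Metric.ball z r ⊆ l.support →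
      D * r ^ 1 ≤ l.real (Metric.ball z r))
    (hc : 2 * (a * ENNReal.ofReal p * (2 * ENNReal.ofReal (4 / (D * (R / 8) ^ 1))) ^ (p - 1)) ≤
      ENNReal.ofReal (R ^ 2))
    {x0 y0 : EuclideanSpace ℝ (Fin 1)} (hball : Metric.ball x0 R ⊆ l.support)
    (hV : ∀ r > 0, ∫⁻ x, ∫⁻ z, (Metric.ball x0 r ×ˢ Metric.ball y0 r).indicator 1 (x, T z) *
      σ (x, z) ∂l ∂l ≠ 0) : ‖y0 - T x0‖ ≤ (8 + 3 * L) * R := by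
  by_contra hbad
  have hτ : 0 < 4 / (D * (R / 8) ^ 1) := by positivity
  obtain ⟨x, z, e, ρ, hxK, hxb, he, hze, hρ, G, hGm, hG, hGp⟩ :=
    h.exists_direction hT hφc hφ hp hfin hτ hR hc hball hV (not_le.1 hbad)
  have hL0 : (0 : ℝ) ≤ L := L.2
  have hσm := h.1.meas
  set m := D * (R / 8) ^ 1 with hm
  have hm0 : 0 < m := by positivity
  have hee : inner ℝ e e = (1 : ℝ) := by rw [real_inner_self_eq_norm_sq, he, one_pow]
  have hspan : ∀ w : EuclideanSpace ℝ (Fin 1), w = (inner ℝ w e : ℝ) • e := by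
    intro w
    obtain ⟨c, rfl⟩ := exists_smul_eq_of_finrank_eq_one
      (show Module.finrank ℝ (EuclideanSpace ℝ (Fin 1)) = 1 by simp)
      (show e ≠ 0 from fun h0 => by simp [h0] at he) w
    rw [inner_smul_left, hee]
    simp
  set B := Metric.ball (x + (3 * R / 8) • e) (R / 8) with hB
  have hBK : B ⊆ l.support := by
    refine (Metric.ball_subset_ball' ?_).trans hxb
    rw [dist_eq_norm, add_sub_cancel_left, norm_smul, he, mul_one,
      Real.norm_of_nonneg (by positivity)]
    linarith
  have hBl : ENNReal.ofReal m ≤ l B := by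
    rw [ENNReal.ofReal_le_iff_le_toReal (measure_ne_top _ _)]
    exact hlow _ _ (by positivity) hBK
  -- Apart from mass `m / 2`, everything starting in the half-line `A1` has its second point in the
  -- smaller half-line `A2`. The ball `B` lies between them and has mass at least `m`, a
  -- contradiction with the equal marginals.
  set A1 : Set (EuclideanSpace ℝ (Fin 1)) := {w | R / 4 ≤ inner ℝ (w - x) e} with hA1
  set A2 : Set (EuclideanSpace ℝ (Fin 1)) := {w | R / 2 ≤ inner ℝ (w - x) e} with hA2
  have hA1m : MeasurableSet A1 := (isClosed_le continuous_const (by fun_prop)).measurableSet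
  have hA2m : MeasurableSet A2 := (isClosed_le continuous_const (by fun_prop)).measurableSet
  have hsub : ∀ q ∈ G, q.1 ∈ A1 → q.2 ∈ A2 := by
    rintro ⟨x', z'⟩ hq hxA
    obtain ⟨hx', hz', hin⟩ := hGp _ hq
    replace hxA : R / 4 ≤ inner ℝ (x' - x) e := hxA
    simp only at hx' hz' hin
    rw [hspan (x' - x), inner_smul_left] at hin
    simp only [conj_trivial] at hin
    have h1 : -(4 * R) ≤ inner ℝ e (T z' - T z) := by
      by_contra hcon
      push Not at hcon
      have : inner ℝ (x' - x) e * inner ℝ e (T z' - T z) ≤ R / 4 * inner ℝ e (T z' - T z) :=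
        mul_le_mul_of_nonpos_right hxA (by linarith)
      nlinarith
    set u := x + (R / 2) • e with hu
    have hux : ‖u - x‖ = R / 2 := by
      rw [hu, add_sub_cancel_left, norm_smul, he, mul_one, Real.norm_of_nonneg (by positivity)]
    have huK : u ∈ l.support := hxb (by
      rw [Metric.mem_ball, dist_eq_norm, hux]; linarith)
    have h2 : inner ℝ e (T u - T x) ≤ L * (R / 2) := by
      refine (real_inner_le_norm _ _).trans ?_
      rw [he, one_mul, ← hux]
      exact hT.norm_sub_le _ _
    have h3 : inner ℝ e (T z - T x) = ρ := by
      rw [hze, inner_smul_right, hee, mul_one]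
    have h4 : 0 < inner ℝ e (T z' - T u) := by
      have e1 : inner ℝ e (T z' - T u) = inner ℝ e (T z' - T z) + inner ℝ e (T z - T x) -
          inner ℝ e (T u - T x) := by
        simp only [inner_sub_right]; ring
      rw [e1, h3]
      have : 0 ≤ L * R := by positivity
      nlinarith
    -- On the line, monotonicity of `T` turns the order of `T z'` and `T u` into the order of `z'`
    -- and `u`.
    have h5 : 0 ≤ inner ℝ (z' - u) (T z' - T u) := by
      rw [← bregman_add_swap φ]
      exact add_nonneg (hφ _ hz' _ huK) (hφ _ huK _ hz')
    rw [hspan (z' - u), inner_smul_left] at h5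
    simp only [conj_trivial] at h5
    have h6 : 0 ≤ inner ℝ (z' - u) e := nonneg_of_mul_nonneg_left h5 h4
    show R / 2 ≤ inner ℝ (z' - x) e
    rw [hu, ← sub_sub, inner_sub_left, inner_smul_left, hee] at h6
    simp only [conj_trivial] at h6
    linarith
  have hGm' : Measurable (Gᶜ.indicator (1 : EuclideanSpace ℝ (Fin 1) ×
    EuclideanSpace ℝ (Fin 1) → ℝ≥0∞)) := measurable_one.indicator hGm.compl
  have hA2m' : Measurable (A2.indicator (1 : EuclideanSpace ℝ (Fin 1) → ℝ≥0∞)) :=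
    measurable_one.indicator hA2m
  have hle : l A1 ≤ ENNReal.ofReal (2 / (4 / m)) + l A2 := by
    rw [← lintegral_indicator_one hA1m, ← lintegral_indicator_one hA2m,
      ← h.1.lintegral_fst (f := A1.indicator 1), ← h.1.lintegral_snd hA2m']
    refine le_trans ?_ (add_le_add_left hG _)
    rw [← lintegral_add_left (by fun_prop)]
    refine lintegral_mono fun x' => ?_
    rw [← lintegral_add_left (by fun_prop)]
    refine lintegral_mono fun z' => ?_
    rw [← add_mul]
    dsimp only
    gcongr
    by_cases h1 : x' ∈ A1
    · by_cases h2 : (x', z') ∈ G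
      · rw [Set.indicator_of_mem (hsub _ h2 h1)]
        exact (Set.indicator_le_self' (by simp) _).trans le_add_self
      · rw [Set.indicator_of_mem (s := Gᶜ) h2]
        exact (Set.indicator_le_self' (by simp) _).trans le_self_add
    · rw [Set.indicator_of_notMem h1]
      exact zero_le
  have hBA : ∀ w ∈ B, w ∈ A1 ∧ w ∉ A2 := by
    intro w hw
    have hβ : ‖(w - x) - (3 * R / 8) • e‖ < R / 8 := by
      rw [hB, Metric.mem_ball, dist_eq_norm, ← sub_sub] at hw
      exact hw
    have h1 := abs_le.1 ((abs_real_inner_le_norm ((w - x) - (3 * R / 8) • e) e).trans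
      (by rw [he, mul_one]))
    rw [inner_sub_left, inner_smul_left, hee] at h1
    simp only [conj_trivial] at h1
    constructor
    · show R / 4 ≤ inner ℝ (w - x) e
      linarith [h1.1]
    · show ¬ R / 2 ≤ inner ℝ (w - x) e
      rw [not_le]
      linarith [h1.2]
  have hsum : l B + l A2 ≤ l A1 := by
    rw [← measure_union (Set.disjoint_left.2 fun w hw => (hBA w hw).2) hA2m]
    refine measure_mono (Set.union_subset (fun w hw => (hBA w hw).1) fun w hw => ?_)
    have hw' : R / 2 ≤ inner ℝ (w - x) e := hw
    show R / 4 ≤ inner ℝ (w - x) e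
    linarith
  have h2 : 2 / (4 / m) = m / 2 := by field_simp; norm_num
  rw [h2] at hle
  have h3 := (ENNReal.add_le_add_iff_right (measure_ne_top l A2)).1 (hsum.trans hle)
  have h4 := (ENNReal.ofReal_le_ofReal_iff (by positivity)).1 (hBl.trans h3)
  linarith

end Forward

/-! ### The energy comparison that excludes far pairs. -/

section NoFarPair

variable {d : ℕ}

local notation "E" => EuclideanSpace ℝ (Fin d)

/-- Counting powers of `ω`, with `N = d * (p - 1) + 2`: the regularisation weight has exponent `(d +
2) * N` and the density level contributes `-2 * d * (p - 1)`, in total `d * N + 4`. The square of `κ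
* ω ^ 2` has exponent `4`, so the entropy price of an exchange is negligible for small `ω`. -/
lemma exists_swap_cost_le (hd : 1 ≤ d) {p D κ : ℝ} (hp : 1 < p) (hD : 0 < D) (hκ : 0 < κ) :
    ∃ w : ℝ, 0 < w ∧ w ≤ 1 ∧ ∀ ω, 0 < ω → ω ≤ w →
      2 * (ENNReal.ofReal ((ω ^ (d + 2)) ^ ((d : ℝ) * (p - 1) + 2) / (2 * (p - 1))) *
        ENNReal.ofReal p *
        (2 * ENNReal.ofReal (4 / (D * (κ * ω ^ 2 / 8) ^ d))) ^ (p - 1)) ≤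
      ENNReal.ofReal ((κ * ω ^ 2) ^ 2) := by
  have hp1 : 0 < p - 1 := by linarith
  set c5 : ℝ := 8 * 8 ^ d / (D * κ ^ d) with hc5
  have hc50 : 0 < c5 := by positivity
  set C : ℝ := p / (p - 1) * c5 ^ (p - 1) / κ ^ 2 with hC
  have hC0 : 0 < C := by positivity
  refine ⟨min 1 (1 / C), by positivity, min_le_left _ _, fun ω hω hle => ?_⟩
  have hω1 : ω ≤ 1 := hle.trans (min_le_left _ _)
  have hωC : C * ω ≤ 1 := by
    have := hle.trans (min_le_right _ _)
    rw [le_div_iff₀ hC0] at this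
    linarith
  have e1 : (2 : ℝ≥0∞) * ENNReal.ofReal (4 / (D * (κ * ω ^ 2 / 8) ^ d)) =
      ENNReal.ofReal (c5 * (ω ^ (2 * d))⁻¹) := by
    rw [← ENNReal.ofReal_ofNat, ← ENNReal.ofReal_mul (by norm_num)]
    congr 1
    rw [hc5, div_pow, mul_pow, ← pow_mul]
    field_simp
    norm_num
  rw [e1, ENNReal.ofReal_rpow_of_nonneg (by positivity) hp1.le,
    ← ENNReal.ofReal_mul (by positivity),
    ← ENNReal.ofReal_mul (by positivity), ← ENNReal.ofReal_ofNat,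
    ← ENNReal.ofReal_mul (by norm_num)]
  refine ENNReal.ofReal_le_ofReal ?_
  have e2 : (ω ^ (d + 2)) ^ ((d : ℝ) * (p - 1) + 2) =
      ω ^ (((d : ℝ) + 2) * ((d : ℝ) * (p - 1) + 2)) := by
    rw [← Real.rpow_natCast, ← Real.rpow_mul hω.le]
    push_cast
    rfl
  have e3 : (c5 * (ω ^ (2 * d))⁻¹) ^ (p - 1) =
      c5 ^ (p - 1) * ω ^ (-(2 * (d : ℝ) * (p - 1))) := by
    rw [Real.mul_rpow hc50.le (by positivity), ← Real.rpow_natCast, ← Real.rpow_neg hω.le,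
      ← Real.rpow_mul hω.le]
    push_cast
    rw [neg_mul]
  have e4 : ω ^ (((d : ℝ) + 2) * ((d : ℝ) * (p - 1) + 2)) * ω ^ (-(2 * (d : ℝ) * (p - 1))) =
      ω ^ ((d : ℝ) * ((d : ℝ) * (p - 1) + 2)) * ω ^ 4 := by
    rw [← Real.rpow_natCast ω 4, ← Real.rpow_add hω, ← Real.rpow_add hω]
    congr 1
    push_cast
    ring
  have e5 : ω ^ ((d : ℝ) * ((d : ℝ) * (p - 1) + 2)) ≤ ω := by
    conv_rhs => rw [← Real.rpow_one ω]
    refine Real.rpow_le_rpow_of_exponent_ge hω hω1 ?_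
    have hd' : (1 : ℝ) ≤ d := by exact_mod_cast hd
    have : 0 ≤ (d : ℝ) * (p - 1) := by positivity
    nlinarith
  rw [e2, e3]
  calc _ = C * κ ^ 2 * (ω ^ (((d : ℝ) + 2) * ((d : ℝ) * (p - 1) + 2)) *
        ω ^ (-(2 * (d : ℝ) * (p - 1)))) := by
        rw [hC]; field_simp
    _ = C * κ ^ 2 * ω ^ ((d : ℝ) * ((d : ℝ) * (p - 1) + 2)) * ω ^ 4 := by rw [e4]; ring
    _ ≤ C * κ ^ 2 * ω * ω ^ 4 := by gcongr
    _ = (C * ω) * (κ * ω ^ 2) ^ 2 := by ring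
    _ ≤ 1 * (κ * ω ^ 2) ^ 2 := by gcongr
    _ = _ := one_mul _

/-- The gap and its swap are nonnegative and add up to `⟪x - z, T x - T z⟫`. -/
lemma bregman_le_sq {K : Set E} {L : ℝ≥0} {T : E → E} (hT : LipschitzWith L T)
    {φ : E → ℝ} (hφ : ∀ x ∈ K, ∀ z ∈ K, 0 ≤ bregman φ T x z) {x z : E} (hx : x ∈ K) (hz : z ∈ K) :
    bregman φ T x z ≤ L * ‖x - z‖ ^ 2 := by
  have h1 := bregman_add_swap φ T x z
  have h2 : inner ℝ (x - z) (T x - T z) ≤ ‖x - z‖ * (L * ‖x - z‖) :=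
    (real_inner_le_norm _ _).trans (by gcongr; exact hT.norm_sub_le _ _)
  have := hφ z hz x hx
  nlinarith

lemma kernelEnergy_bregman_le {l : Measure E} [IsProbabilityMeasure l] {L : ℝ≥0} {T : E → E}
    (hT : LipschitzWith L T) {φ : E → ℝ}
    (hφ : ∀ x ∈ l.support, ∀ z ∈ l.support, 0 ≤ bregman φ T x z) {M a b p : ℝ} (hLM : L ≤ M)
    (hab : a ≤ M * b) {τ : E × E → ℝ≥0∞} (hτ : Measurable τ) :
    kernelEnergy l (fun q => ENNReal.ofReal (bregman φ T q.1 q.2)) (ENNReal.ofReal a) p τ ≤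
      ENNReal.ofReal M * (∫⁻ x, ∫⁻ y, ENNReal.ofReal (‖x - y‖ ^ 2) * τ (x, y) ∂l ∂l +
        ENNReal.ofReal b * ∫⁻ x, ∫⁻ y, τ (x, y) ^ p ∂l ∂l) := by
  have hM : 0 ≤ M := L.2.trans hLM
  rw [kernelEnergy, mul_add, ← mul_assoc, ← ENNReal.ofReal_mul hM]
  refine add_le_add ?_ (mul_le_mul_left (ENNReal.ofReal_le_ofReal hab) _)
  rw [← lintegral_const_mul _ (by fun_prop)]
  refine lintegral_mono_ae ?_
  filter_upwards [Measure.support_mem_ae (μ := l)] with x hx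
  rw [← lintegral_const_mul _ (by fun_prop)]
  refine lintegral_mono_ae ?_
  filter_upwards [Measure.support_mem_ae (μ := l)] with z hz
  rw [← mul_assoc, ← ENNReal.ofReal_mul hM]
  gcongr
  exact (bregman_le_sq hT hφ hx hz).trans (by gcongr)

lemma exists_lt_one_mul_inv_rpow_le (p : ℝ) {c : ℝ} (hc : 0 < c) :
    ∃ θ : ℝ, 0 < θ ∧ θ < 1 ∧ θ * θ⁻¹ ^ p ≤ 1 + c := by
  have hcont : ContinuousAt (fun θ : ℝ => θ * θ⁻¹ ^ p) 1 := by
    refine continuousAt_id.mul ((continuousAt_inv₀ one_ne_zero).rpow_const ?_)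
    left; norm_num
  have h1 : ∀ᶠ θ in nhds (1 : ℝ), θ * θ⁻¹ ^ p < 1 + c :=
    hcont.eventually_lt_const (by simpa using hc)
  have h2 : ∀ᶠ θ in nhds (1 : ℝ), 0 < θ := lt_mem_nhds one_pos
  have h3 := (h1.and h2).filter_mono (nhdsWithin_le_nhds (s := Set.Iio 1))
  obtain ⟨θ, ⟨ha, hb⟩, hθ⟩ := (h3.and self_mem_nhdsWithin).exists
  exact ⟨θ, hb, hθ, ha.le⟩

set_option maxHeartbeats 1000000 in
/-- In dimension at least two, for small regularisation, minimal kernels move no pair far away from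
the boundary. -/
lemma exists_not_far (hd : 2 ≤ d) {p D κ : ℝ} (hp : 1 < p) (hD : 0 < D) (hκ : 0 < κ)
    {l mu : Measure E} [IsProbabilityMeasure l] (hK : IsCompact l.support)
    (hl : l ≪ volume) (hmu : mu ≪ volume) {L : ℝ≥0} {T : E → E}
    (hT : LipschitzWith L T) (hopt : IsOTMinimiser l mu (l.map (fun x => (x, T x))))
    {φ : E → ℝ} (hφc : Continuous φ)
    (hφ : ∀ x ∈ l.support, ∀ z ∈ l.support, 0 ≤ bregman φ T x z)
    (hlow : ∀ (z : E) (r : ℝ), 0 < r → Metric.ball z r ⊆ l.support →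
      D * r ^ d ≤ l.real (Metric.ball z r)) :
    ∃ w : ℝ, 0 < w ∧ ∀ ω, 0 < ω → ω ≤ w → ∀ σ : E × E → ℝ≥0∞,
      IsMinKernel l (fun q => ENNReal.ofReal (bregman φ T q.1 q.2))
        (ENNReal.ofReal ((ω ^ (d + 2)) ^ ((d : ℝ) * (p - 1) + 2) / (2 * (p - 1)))) p σ →
      kernelEnergy l (fun q => ENNReal.ofReal (bregman φ T q.1 q.2))
        (ENNReal.ofReal ((ω ^ (d + 2)) ^ ((d : ℝ) * (p - 1) + 2) / (2 * (p - 1)))) p σ ≠ ∞ →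
      ∀ x0 y0 : E, Metric.ball x0 (κ * ω ^ 2) ⊆ l.support →
      (∀ r > 0, ∫⁻ x, ∫⁻ z, (Metric.ball x0 r ×ˢ Metric.ball y0 r).indicator 1 (x, T z) *
        σ (x, z) ∂l ∂l ≠ 0) → ‖y0 - T x0‖ ≤ (8 + 3 * L) * (κ * ω ^ 2) := by
  have hp1 : 0 < p - 1 := by linarith
  obtain ⟨Λ', hΛ'⟩ := hK.exists_bound_of_continuousOn (f := fun x : E => x) (by fun_prop)
  set Λ := max 1 Λ' with hΛ
  have hΛ1 : 1 ≤ Λ := le_max_left _ _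
  have hbox : ∀ᵐ x ∂l, ∀ i, |x i| ≤ Λ := by
    filter_upwards [Measure.support_mem_ae (μ := l)] with x hx i
    exact ((PiLp.norm_apply_le x i).trans (hΛ' x hx)).trans (le_max_right _ _)
  obtain ⟨C, hC, hself⟩ := exists_selfCoupling hd hp (Λ := Λ) (by linarith)
  set b : ℝ := (2 : ℝ) ^ (-(2 / (p - 1))) with hb
  have hb0 : 0 < b := by positivity
  have hb1 : b < 1 := Real.rpow_lt_one_of_one_lt_of_neg (by norm_num) (by
    rw [neg_lt_zero]; positivity)
  set M : ℝ := max (L : ℝ) (1 / (2 * (p - 1))) with hM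
  have hM0 : 0 < M := lt_of_lt_of_le (by positivity) (le_max_right _ _)
  set C1 := 2 * C * M with hC1
  have hC10 : 0 < C1 := by positivity
  -- `c3 * δ ^ 2` is the cost `R ^ 2 / 8` times the mass `D * (R / 8) ^ d / 2` forced by a far pair.
  -- The parameters below keep the competing terms under half of it: `c3 / 8` each for `η` and `θ`,
  -- and `c3 / 4` for the self-coupling.
  set c3 : ℝ := D * κ ^ (d + 2) / (16 * 8 ^ d) with hc3
  have hc30 : 0 < c3 := by positivity
  set η := c3 / (8 * C1) with hη
  have hη0 : 0 < η := by positivity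
  obtain ⟨θ, hθ0, hθ1, hθ⟩ := exists_lt_one_mul_inv_rpow_le p (c := c3 / (8 * C1)) (by positivity)
  set Ψ := max 1 ((1 - θ) * (1 - θ)⁻¹ ^ p) with hΨ
  have hΨ0 : 0 < Ψ := lt_of_lt_of_le one_pos (le_max_left _ _)
  -- The order of choices matters: `J0` makes the tail small after `Ψ` is known, then `s` beats `4 ^
  -- J0`, and only then are `U` and `s0` taken. The bound on `ω` comes last and so depends on the
  -- measures and the map.
  obtain ⟨J0, hJ0⟩ := exists_pow_lt_of_lt_one
    (show 0 < c3 / (8 * (Ψ * M * C)) by positivity) hb1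
  set s := min 1 (c3 / (16 * (Ψ * M * C) * 4 ^ J0)) with hs
  have hs0 : 0 < s := by positivity
  have hs1 : s ≤ 1 := min_le_left _ _
  obtain ⟨s0, hs00, U, hUm, hUl, hU⟩ := hopt.exists_almost_symmetric hl hmu hT hφc hφ hη0
    (θ := ENNReal.ofReal (s / 3)) (by simpa using hs0)
  obtain ⟨w1, hw1, hw11, hswap⟩ := exists_swap_cost_le (d := d) (by omega) hp hD hκ
  refine ⟨min w1 (min s (min (s * κ ^ 2 / (24 * C1)) (s * s0 / (3 * C1)))), by positivity,
    fun ω hω hωle σ hσ hfin x0 y0 hball hV => ?_⟩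
  by_contra hbad
  have ω1 : ω ≤ w1 := hωle.trans (min_le_left _ _)
  have ω2 : ω ≤ s := hωle.trans ((min_le_right _ _).trans (min_le_left _ _))
  have ω3 : ω ≤ s * κ ^ 2 / (24 * C1) := hωle.trans ((min_le_right _ _).trans
    ((min_le_right _ _).trans (min_le_left _ _)))
  have ω4 : ω ≤ s * s0 / (3 * C1) := hωle.trans ((min_le_right _ _).trans
    ((min_le_right _ _).trans (min_le_right _ _)))
  have hω1 : ω ≤ 1 := ω1.trans hw11
  set R := κ * ω ^ 2 with hR
  have hR0 : 0 < R := by positivity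
  set δ := ω ^ (d + 2) with hδ
  have hδ0 : 0 < δ := by positivity
  have hδω : δ ≤ ω := pow_le_of_le_one hω.le hω1 (by omega)
  have hδ1 : δ ≤ 1 := hδω.trans hω1
  set a := ENNReal.ofReal (δ ^ ((d : ℝ) * (p - 1) + 2) / (2 * (p - 1))) with ha
  set H : Set (E × E) := {q : E × E | R ^ 2 / 8 ≤ bregman φ T q.1 q.2} with hH
  have hbm := measurable_bregman hφc hT.continuous
  have hHm : MeasurableSet H := measurableSet_le measurable_const hbm
  have hσm := hσ.1.meas
  set Dq : E × E → ℝ≥0∞ := fun q => ENNReal.ofReal (bregman φ T q.1 q.2) with hDq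
  have hDm : Measurable Dq := hbm.ennreal_ofReal
  have hHmass := hσ.le_lintegral_of_far hT hφc hφ hp hfin hD hR0 hlow (hswap ω hω ω1) hball hV
    (not_le.1 hbad)
  have hcoup : ∀ τ : E × E → ℝ≥0∞, Measurable τ → kernelEnergy l Dq a p τ ≤ ENNReal.ofReal M *
      (∫⁻ x, ∫⁻ y, ENNReal.ofReal (‖x - y‖ ^ 2) * τ (x, y) ∂l ∂l +
        ENNReal.ofReal (δ ^ ((d : ℝ) * (p - 1) + 2)) * ∫⁻ x, ∫⁻ y, τ (x, y) ^ p ∂l ∂l) := by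
    intro τ hτ
    refine kernelEnergy_bregman_le hT hφ (le_max_left _ _) ?_ hτ
    rw [div_eq_mul_one_div, mul_comm]
    gcongr
    exact le_max_right _ _
  -- The a priori bound: comparison with a self-coupling of all of `l`, with `J0 = 0`.
  have hE : kernelEnergy l Dq a p σ ≤ ENNReal.ofReal (C1 * δ ^ 2) := by
    obtain ⟨τ, hτ, hτE⟩ := hself 0 l hbox δ hδ0 (hδ1.trans hΛ1) 1 measurable_one (fun _ => le_rfl)
      (by simpa using pow_le_one₀ hδ0.le hδ1)
    refine ((hσ.2 τ hτ).trans (hcoup τ hτ.meas)).trans ?_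
    refine (mul_le_mul_right hτE _).trans_eq ?_
    simp only [pow_zero, one_mul, Pi.one_apply, lintegral_const, measure_univ, ENNReal.ofReal_one]
    rw [show (1 : ℝ≥0∞) + 1 = ENNReal.ofReal 2 by rw [ENNReal.ofReal_ofNat]; norm_num,
      ← ENNReal.ofReal_mul hC.le, ← ENNReal.ofReal_mul (by positivity),
      ← ENNReal.ofReal_mul hM0.le, hC1]
    congr 1
    ring
  have hED : ∫⁻ x, ∫⁻ z, Dq (x, z) * σ (x, z) ∂l ∂l ≤ ENNReal.ofReal (C1 * δ ^ 2) :=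
    le_self_add.trans hE
  have hES : a * ∫⁻ x, ∫⁻ z, σ (x, z) ^ p ∂l ∂l ≤ ENNReal.ofReal (C1 * δ ^ 2) :=
    le_add_self.trans hE
  set G : Set (E × E) := {q | Dq (q.2, q.1) ≤ (1 + ENNReal.ofReal η) * Dq q} with hG
  have hGm : MeasurableSet G := measurableSet_le (by fun_prop) (by fun_prop)
  obtain ⟨g, hgm, hg1, hgs, hgs', hcost⟩ := hσ.cost_indicator_le hp hDm hfin hGm hHm
    (η := ENNReal.ofReal η) (s := ENNReal.ofReal s) (θ := ENNReal.ofReal θ)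
    (fun x y hxy => hxy) (by simpa using hs1) (by simpa using hθ0) (by simpa using hθ1)
  -- A pair outside `G \ H` has second point outside `U`, or gap at least `s0` or `R ^ 2 / 8`. The
  -- last two cases are handled by Markov's inequality, since `δ ^ 2` and `δ ^ 2 / R ^ 2`, of order
  -- `ω ^ (2 * d)`, both tend to zero.
  have hGH : ∫⁻ x, ∫⁻ z, (G \ H)ᶜ.indicator σ (x, z) ∂l ∂l ≤ ENNReal.ofReal s := by
    have hUm' : Measurable (Uᶜ.indicator (1 : E → ℝ≥0∞)) := measurable_one.indicator hUm.compl
    have hpt : ∀ x ∈ l.support, ∀ z ∈ l.support, (G \ H)ᶜ.indicator σ (x, z) ≤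
        Uᶜ.indicator 1 z * σ (x, z) + ENNReal.ofReal (1 / s0 + 8 / R ^ 2) *
          (Dq (x, z) * σ (x, z)) := by
      intro x hx z hz
      by_cases hmem : (x, z) ∈ (G \ H)ᶜ
      swap
      · rw [Set.indicator_of_notMem hmem]; exact zero_le
      rw [Set.indicator_of_mem hmem]
      by_cases hzU : z ∈ U
      swap
      · rw [Set.indicator_of_mem (s := Uᶜ) hzU, Pi.one_apply, one_mul]
        exact le_self_add
      refine le_trans ?_ le_add_self
      rw [← mul_assoc, hDq]
      simp only
      rw [← ENNReal.ofReal_mul (by positivity)]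
      conv_lhs => rw [← one_mul (σ (x, z))]
      gcongr
      rw [← ENNReal.ofReal_one]
      refine ENNReal.ofReal_le_ofReal ?_
      have hpos := hφ x hx z hz
      by_cases hxH : R ^ 2 / 8 ≤ bregman φ T x z
      · have h1 : 1 ≤ 8 / R ^ 2 * bregman φ T x z := by
          calc (1 : ℝ) = 8 / R ^ 2 * (R ^ 2 / 8) := by field_simp
            _ ≤ _ := by gcongr
        have h2 : 0 ≤ 1 / s0 * bregman φ T x z := by positivity
        linarith
      · have hG' : (x, z) ∉ G := fun hh => hmem ⟨hh, hxH⟩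
        have hs' : s0 ≤ bregman φ T x z := by
          by_contra hcon
          apply hG'
          have h1 := hU z hzU x hx (not_le.1 hcon)
          show ENNReal.ofReal (bregman φ T z x) ≤
            (1 + ENNReal.ofReal η) * ENNReal.ofReal (bregman φ T x z)
          rw [← ENNReal.ofReal_one, ← ENNReal.ofReal_add zero_le_one hη0.le,
            ← ENNReal.ofReal_mul (by positivity)]
          exact ENNReal.ofReal_le_ofReal h1
        have h1 : 1 ≤ 1 / s0 * bregman φ T x z := by
          calc (1 : ℝ) = 1 / s0 * s0 := by field_simp
            _ ≤ _ := by gcongr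
        have h2 : 0 ≤ 8 / R ^ 2 * bregman φ T x z := by positivity
        linarith
    calc _ ≤ ∫⁻ x, ∫⁻ z, (Uᶜ.indicator 1 z * σ (x, z) + ENNReal.ofReal (1 / s0 + 8 / R ^ 2) *
          (Dq (x, z) * σ (x, z))) ∂l ∂l := by
          refine lintegral_mono_ae ?_
          filter_upwards [Measure.support_mem_ae (μ := l)] with x hx
          refine lintegral_mono_ae ?_
          filter_upwards [Measure.support_mem_ae (μ := l)] with z hz
          exact hpt x hx z hz
      _ = l Uᶜ + ENNReal.ofReal (1 / s0 + 8 / R ^ 2) *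
          ∫⁻ x, ∫⁻ z, Dq (x, z) * σ (x, z) ∂l ∂l := by
          rw [← lintegral_indicator_one hUm.compl, ← hσ.1.lintegral_snd hUm',
            ← lintegral_const_mul _ (by fun_prop), ← lintegral_add_left (by fun_prop)]
          refine lintegral_congr fun x => ?_
          rw [← lintegral_const_mul _ (by fun_prop), ← lintegral_add_left (by fun_prop)]
      _ ≤ ENNReal.ofReal (s / 3) + ENNReal.ofReal (1 / s0 + 8 / R ^ 2) *
          ENNReal.ofReal (C1 * δ ^ 2) := by gcongr
      _ ≤ ENNReal.ofReal s := by
          rw [← ENNReal.ofReal_mul (by positivity),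
            ← ENNReal.ofReal_add (by positivity) (by positivity)]
          refine ENNReal.ofReal_le_ofReal ?_
          have h1 : 1 / s0 * (C1 * δ ^ 2) ≤ s / 3 := by
            have h2 : δ ^ 2 ≤ s * s0 / (3 * C1) :=
              (pow_le_of_le_one hδ0.le hδ1 two_ne_zero).trans (hδω.trans ω4)
            calc 1 / s0 * (C1 * δ ^ 2) ≤ 1 / s0 * (C1 * (s * s0 / (3 * C1))) := by gcongr
              _ = s / 3 := by field_simp
          have h2 : 8 / R ^ 2 * (C1 * δ ^ 2) ≤ s / 3 := by
            have h3 : δ ^ 2 = ω ^ (2 * d) * ω ^ 4 := by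
              rw [hδ, ← pow_mul, ← pow_add]; congr 1; ring
            have h4 : ω ^ (2 * d) ≤ s * κ ^ 2 / (24 * C1) :=
              (pow_le_of_le_one hω.le hω1 (by omega)).trans ω3
            calc 8 / R ^ 2 * (C1 * δ ^ 2) = 8 * C1 / κ ^ 2 * ω ^ (2 * d) := by
                  rw [h3, hR]; field_simp
              _ ≤ 8 * C1 / κ ^ 2 * (s * κ ^ 2 / (24 * C1)) := by gcongr
              _ = s / 3 := by field_simp; norm_num
          nlinarith
  -- The deficit has mass at least `s`, hence at least `δ ^ d`, and at most `2 * s`.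
  obtain ⟨τ, hτ, hτE⟩ := hself J0 l hbox δ hδ0 (hδ1.trans hΛ1) g hgm hg1
    ((ENNReal.ofReal_le_ofReal ((pow_le_of_le_one hδ0.le hδ1 (by omega)).trans
      (hδω.trans ω2))).trans hgs)
  have hτE' : kernelEnergy l Dq a p τ ≤
      ENNReal.ofReal (M * (δ ^ 2 * (C * (4 ^ J0 * (2 * s) + b ^ J0)))) := by
    refine (hcoup τ hτ.meas).trans ?_
    rw [ENNReal.ofReal_mul hM0.le, ENNReal.ofReal_mul (by positivity), ENNReal.ofReal_mul hC.le,
      ENNReal.ofReal_add (by positivity) (by positivity), ENNReal.ofReal_mul (by positivity),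
      ENNReal.ofReal_pow (by norm_num : (0 : ℝ) ≤ 4), ENNReal.ofReal_ofNat]
    refine mul_le_mul_right (hτE.trans ?_) _
    gcongr
    calc _ ≤ ENNReal.ofReal s + ENNReal.ofReal s := hgs'.trans (by gcongr)
      _ = _ := by rw [← ENNReal.ofReal_add hs0.le hs0.le, two_mul]
  have hfinal := hcost τ hτ
  have hX : ENNReal.ofReal (c3 * δ ^ 2) ≤
      ∫⁻ x, ∫⁻ y, H.indicator (fun q => Dq q * σ q) (x, y) ∂l ∂l := by
    calc ENNReal.ofReal (c3 * δ ^ 2) =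
          ENNReal.ofReal (R ^ 2 / 8) * ENNReal.ofReal (D * (R / 8) ^ d / 2) := by
          rw [← ENNReal.ofReal_mul (by positivity)]
          congr 1
          rw [hc3, hδ, hR, div_pow, mul_pow κ (ω ^ 2) d, ← pow_mul ω 2 d, ← pow_mul ω (d + 2) 2]
          field_simp
          ring
      _ ≤ ENNReal.ofReal (R ^ 2 / 8) * ∫⁻ x, ∫⁻ z, H.indicator 1 (x, z) * σ (x, z) ∂l ∂l := by
          gcongr
      _ ≤ _ := by
          have hHm' : Measurable (H.indicator (1 : E × E → ℝ≥0∞)) := measurable_one.indicator hHm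
          rw [← lintegral_const_mul _ (by fun_prop)]
          refine lintegral_mono fun x => ?_
          rw [← lintegral_const_mul _ (by fun_prop)]
          refine lintegral_mono fun z => ?_
          by_cases hm : (x, z) ∈ H
          · simp only [Set.indicator_of_mem hm, Pi.one_apply, one_mul]
            gcongr
            exact ENNReal.ofReal_le_ofReal hm
          · simp [Set.indicator_of_notMem hm]
  set S := a * ∫⁻ x, ∫⁻ z, σ (x, z) ^ p ∂l ∂l with hS
  have hSfin : S ≠ ∞ := ne_top_of_le_ne_top ENNReal.ofReal_ne_top hES
  have hθS : ENNReal.ofReal θ * (ENNReal.ofReal θ)⁻¹ ^ p * S ≤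
      S + ENNReal.ofReal (c3 / 8 * δ ^ 2) := by
    have e : ENNReal.ofReal θ * (ENNReal.ofReal θ)⁻¹ ^ p = ENNReal.ofReal (θ * θ⁻¹ ^ p) := by
      rw [ENNReal.ofReal_mul hθ0.le, ← ENNReal.ofReal_inv_of_pos hθ0,
        ENNReal.ofReal_rpow_of_nonneg (by positivity) (by linarith)]
    calc _ ≤ ENNReal.ofReal (1 + c3 / (8 * C1)) * S := by rw [e]; gcongr
      _ = S + ENNReal.ofReal (c3 / (8 * C1)) * S := by
          rw [ENNReal.ofReal_add zero_le_one (by positivity), add_mul, ENNReal.ofReal_one, one_mul]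
      _ ≤ S + ENNReal.ofReal (c3 / (8 * C1)) * ENNReal.ofReal (C1 * δ ^ 2) := by gcongr
      _ = _ := by
          rw [← ENNReal.ofReal_mul (by positivity)]
          congr 2
          field_simp
  have hηE : ENNReal.ofReal η * ∫⁻ x, ∫⁻ z, Dq (x, z) * σ (x, z) ∂l ∂l ≤
      ENNReal.ofReal (c3 / 8 * δ ^ 2) := by
    calc _ ≤ ENNReal.ofReal η * ENNReal.ofReal (C1 * δ ^ 2) := by gcongr
      _ = _ := by
          rw [← ENNReal.ofReal_mul (by positivity)]
          congr 1
          rw [hη]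
          field_simp
  have hΨE : ∫⁻ x, ∫⁻ y, Dq (x, y) * τ (x, y) ∂l ∂l + (1 - ENNReal.ofReal θ) *
      (1 - ENNReal.ofReal θ)⁻¹ ^ p * (a * ∫⁻ x, ∫⁻ y, τ (x, y) ^ p ∂l ∂l) ≤
      ENNReal.ofReal (c3 / 4 * δ ^ 2) := by
    have h1θ : 0 < 1 - θ := by linarith
    have e : (1 - ENNReal.ofReal θ) * (1 - ENNReal.ofReal θ)⁻¹ ^ p =
        ENNReal.ofReal ((1 - θ) * (1 - θ)⁻¹ ^ p) := by
      rw [ENNReal.ofReal_mul h1θ.le, ← ENNReal.ofReal_one, ← ENNReal.ofReal_sub _ hθ0.le,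
        ← ENNReal.ofReal_inv_of_pos h1θ,
        ENNReal.ofReal_rpow_of_nonneg (by positivity) (by linarith)]
    calc _ ≤ ENNReal.ofReal Ψ * kernelEnergy l Dq a p τ := by
          rw [e, kernelEnergy, mul_add]
          gcongr
          · refine le_mul_of_one_le_left zero_le ?_
            rw [← ENNReal.ofReal_one]
            exact ENNReal.ofReal_le_ofReal (le_max_left _ _)
          · exact le_max_right _ _
      _ ≤ ENNReal.ofReal Ψ *
          ENNReal.ofReal (M * (δ ^ 2 * (C * (4 ^ J0 * (2 * s) + b ^ J0)))) := by gcongr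
      _ ≤ _ := by
          rw [← ENNReal.ofReal_mul hΨ0.le]
          refine ENNReal.ofReal_le_ofReal ?_
          have h1 : Ψ * M * C * (4 ^ J0 * (2 * s)) ≤ c3 / 8 := by
            have : s ≤ c3 / (16 * (Ψ * M * C) * 4 ^ J0) := min_le_right _ _
            rw [le_div_iff₀ (by positivity)] at this
            linarith
          have h2 : Ψ * M * C * b ^ J0 ≤ c3 / 8 := by
            have := hJ0.le
            rw [le_div_iff₀ (by positivity)] at this
            linarith
          calc _ = (Ψ * M * C * (4 ^ J0 * (2 * s)) + Ψ * M * C * b ^ J0) * δ ^ 2 := by ring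
            _ ≤ (c3 / 8 + c3 / 8) * δ ^ 2 := by gcongr
            _ = _ := by ring
  have hcomb : ENNReal.ofReal (c3 * δ ^ 2) + S ≤ ENNReal.ofReal (c3 / 2 * δ ^ 2) + S := by
    calc _ ≤ _ := add_le_add_left hX _
      _ ≤ _ := hfinal
      _ ≤ ENNReal.ofReal (c3 / 8 * δ ^ 2) + (S + ENNReal.ofReal (c3 / 8 * δ ^ 2)) +
          ENNReal.ofReal (c3 / 4 * δ ^ 2) := by
          rw [add_assoc (_ + _)]
          exact add_le_add (add_le_add hηE hθS) hΨE
      _ = _ := by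
          rw [add_comm S, ← add_assoc, add_right_comm, ← ENNReal.ofReal_add (by positivity)
            (by positivity), ← ENNReal.ofReal_add (by positivity) (by positivity)]
          congr 2
          ring
  have h1 := (ENNReal.ofReal_le_ofReal_iff (by positivity)).1
    ((ENNReal.add_le_add_iff_right hSfin).1 hcomb)
  have : 0 < c3 * δ ^ 2 := by positivity
  nlinarith

end NoFarPair

/-! ### Assembly of the theorem. -/

lemma fst_mem_support {X Y : Type*} [TopologicalSpace X] [TopologicalSpace Y] [MeasurableSpace X]
    [MeasurableSpace Y] [OpensMeasurableSpace X] {π : Measure (X × Y)} {x : X} {y : Y}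
    (h : (x, y) ∈ π.support) : x ∈ π.fst.support := by
  rw [Measure.mem_support_iff_forall] at h ⊢
  intro U hU
  obtain ⟨V, hVU, hVo, hxV⟩ := mem_nhds_iff.1 hU
  refine lt_of_lt_of_le ?_ (measure_mono hVU)
  rw [Measure.fst_apply hVo.measurableSet]
  exact h _ ((hVo.preimage continuous_fst).mem_nhds hxV)

/-- For small regularisation, minimal kernels move no pair far away from the boundary. -/
lemma exists_not_far_of_pos {d : ℕ} (hd : 1 ≤ d) {p D κ : ℝ} (hp : 1 < p) (hD : 0 < D)
    (hκ : 0 < κ) {l mu : Measure (EuclideanSpace ℝ (Fin d))} [IsProbabilityMeasure l]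
    (hK : IsCompact l.support) (hl : l ≪ volume) (hmu : mu ≪ volume) {L : ℝ≥0}
    {T : EuclideanSpace ℝ (Fin d) → EuclideanSpace ℝ (Fin d)}
    (hT : LipschitzWith L T) (hopt : IsOTMinimiser l mu (l.map (fun x => (x, T x))))
    {φ : EuclideanSpace ℝ (Fin d) → ℝ} (hφc : Continuous φ)
    (hφ : ∀ x ∈ l.support, ∀ z ∈ l.support, 0 ≤ bregman φ T x z)
    (hlow : ∀ (z : EuclideanSpace ℝ (Fin d)) (r : ℝ), 0 < r → Metric.ball z r ⊆ l.support →
      D * r ^ d ≤ l.real (Metric.ball z r)) :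
    ∃ w : ℝ, 0 < w ∧ ∀ ω, 0 < ω → ω ≤ w →
      ∀ σ : EuclideanSpace ℝ (Fin d) × EuclideanSpace ℝ (Fin d) → ℝ≥0∞,
      IsMinKernel l (fun q => ENNReal.ofReal (bregman φ T q.1 q.2))
        (ENNReal.ofReal ((ω ^ (d + 2)) ^ ((d : ℝ) * (p - 1) + 2) / (2 * (p - 1)))) p σ →
      kernelEnergy l (fun q => ENNReal.ofReal (bregman φ T q.1 q.2))
        (ENNReal.ofReal ((ω ^ (d + 2)) ^ ((d : ℝ) * (p - 1) + 2) / (2 * (p - 1)))) p σ ≠ ∞ →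
      ∀ x0 y0 : EuclideanSpace ℝ (Fin d), Metric.ball x0 (κ * ω ^ 2) ⊆ l.support →
      (∀ r > 0, ∫⁻ x, ∫⁻ z, (Metric.ball x0 r ×ˢ Metric.ball y0 r).indicator 1 (x, T z) *
        σ (x, z) ∂l ∂l ≠ 0) → ‖y0 - T x0‖ ≤ (8 + 3 * L) * (κ * ω ^ 2) := by
  rcases hd.eq_or_lt with rfl | hd2
  · obtain ⟨w, hw, -, hswap⟩ := exists_swap_cost_le le_rfl hp hD hκ
    exact ⟨w, hw, fun ω hω hωw σ hσ hfin x0 y0 hball hV =>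
      hσ.not_far_of_dim_one hT hφc hφ hp hfin hD (by positivity) hlow (hswap ω hω hωw) hball hV⟩
  · exact exists_not_far hd2 hp hD hκ hK hl hmu hT hopt hφc hφ hlow

theorem corollary1p7 (d : ℕ) (p : ℝ) (hp : 1 < p) (D : ℝ) (hD : 0 < D) (L : ℝ≥0)
    (κ : ℝ) (hκ : 0 < κ) :
    ∃ c : ℝ, 0 < c ∧
      ∀ lam mu : Measure (EuclideanSpace ℝ (Fin d)),
        IsProbabilityMeasure lam → IsProbabilityMeasure mu →
        IsCompact lam.support → IsCompact mu.support →
        lam ≪ volume → mu ≪ volume →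
        (∀ (z : EuclideanSpace ℝ (Fin d)) (r : ℝ), 0 < r →
          Metric.ball z r ⊆ lam.support → D * r ^ d ≤ lam.real (Metric.ball z r)) →
        ∀ T : EuclideanSpace ℝ (Fin d) → EuclideanSpace ℝ (Fin d),
          LipschitzOnWith L T lam.support →
          IsOTMinimiser lam mu (lam.map (fun x => (x, T x))) →
          ∃ ε₀ : ℝ, 0 < ε₀ ∧ ∀ ε : ℝ, 0 < ε → ε ≤ ε₀ →
            ∀ π : Measure (EuclideanSpace ℝ (Fin d) × EuclideanSpace ℝ (Fin d)),
              IsROTMinimiser (polyReg p) ε lam mu π →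
              ∀ x y : EuclideanSpace ℝ (Fin d), (x, y) ∈ π.support →
                ‖y - T x‖ ≤ c * (κ * ε ^ (4 / (((d : ℝ) * (p - 1) + 2) * ((d : ℝ) + 2)))) ∨
                Metric.infDist x (frontier lam.support) <
                  κ * ε ^ (4 / (((d : ℝ) * (p - 1) + 2) * ((d : ℝ) + 2))) := by
  -- `T` is Lipschitz only on the support. It is replaced by a global extension, whose constant
  -- depends on `d` and `L` alone.
  set L' : ℝ≥0 := lipschitzExtensionConstant (EuclideanSpace ℝ (Fin d)) * L with hL'
  have hL0 : (0 : ℝ) ≤ L' := L'.2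
  refine ⟨8 + 3 * L', by positivity, ?_⟩
  intro lam mu _ _ hlamK hmuK hlam hmu hlow T hT hopt
  rcases Nat.eq_zero_or_pos d with rfl | hd
  · refine ⟨1, one_pos, fun ε hε _ π _ x y _ => Or.inl ?_⟩
    rw [Subsingleton.elim (y - T x) 0, norm_zero]
    positivity
  obtain ⟨T', hT', heq⟩ := hT.extend_finite_dimension
  have hmapeq : lam.map (fun x => (x, T x)) = lam.map (fun x => (x, T' x)) := by
    refine Measure.map_congr ?_
    filter_upwards [Measure.support_mem_ae (μ := lam)] with x hx
    rw [heq hx]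
  rw [hmapeq] at hopt
  have hmap : mu = lam.map T' := by
    rw [← hopt.1.2, Measure.snd_map_prodMk measurable_id']
  obtain ⟨φ, hφc, hφ⟩ := hopt.exists_potential hlamK hT'
  obtain ⟨w, hw, hfar⟩ := exists_not_far_of_pos hd hp hD hκ hlamK hlam hmu hT' hopt hφc hφ hlow
  set N : ℝ := (d : ℝ) * (p - 1) + 2 with hN
  have hp1 : 0 < p - 1 := by linarith
  have hN0 : 0 < N := by positivity
  have hd2 : (0 : ℝ) < (d : ℝ) + 2 := by positivity
  -- The value of `ε` at which `ω = ε ^ (2 / (N * (d + 2)))` equals `w`.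
  refine ⟨w ^ (N * ((d : ℝ) + 2) / 2), by positivity, fun ε hε hεle π hπ x y hxy => ?_⟩
  rw [or_iff_not_imp_right]
  intro hdist
  set ω : ℝ := ε ^ (2 / (N * ((d : ℝ) + 2))) with hω
  have hω0 : 0 < ω := by positivity
  have hωw : ω ≤ w := by
    calc ω ≤ (w ^ (N * ((d : ℝ) + 2) / 2)) ^ (2 / (N * ((d : ℝ) + 2))) := by
          rw [hω]; gcongr
      _ = w := by
          rw [← Real.rpow_mul hw.le, div_mul_div_comm, mul_comm, div_self (by positivity),
            Real.rpow_one]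
  have hω2 : ε ^ (4 / (N * ((d : ℝ) + 2))) = ω ^ 2 := by
    rw [hω, ← Real.rpow_natCast, ← Real.rpow_mul hε.le]
    congr 1
    push_cast
    ring
  have hωε : (ω ^ (d + 2)) ^ N = ε ^ 2 := by
    rw [hω, ← Real.rpow_natCast, ← Real.rpow_mul hε.le, ← Real.rpow_mul hε.le, ← Real.rpow_natCast]
    congr 1
    push_cast
    field_simp
  rw [hω2] at hdist ⊢
  have hx : x ∈ lam.support := by
    have := fst_mem_support hxy
    rwa [hπ.1.1] at this
  obtain ⟨σ, hσ, hfin, hσπ⟩ := hπ.exists_kernel hp hε hlamK hmuK hT'.continuous hmap hφc hφ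
  rw [← hωε] at hσ hfin
  rw [heq hx]
  refine hfar ω hω0 hωw σ hσ hfin x y
    (ball_subset_of_le_infDist_frontier hx (not_lt.1 hdist)) fun r hr => ?_
  rw [← hσπ _ (measurableSet_ball.prod measurableSet_ball)]
  exact ((Measure.mem_support_iff_forall _).1 hxy _
    (prod_mem_nhds (Metric.ball_mem_nhds _ hr) (Metric.ball_mem_nhds _ hr))).ne'
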